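/- Let $\mu(G)$ denote the maximum size of a matching in a graph $G$. Consider a graph on $n\ge 1$ vertices, initially without edges, that undergoes an online sequence of updates, each of which inserts a new edge between two present vertices or deletes a present vertex together with all its incident edges (deleted vertices do not return). Assume that the graph is bipartite at all times, and let $m$ be the total number of edges inserted; neither $m$ nor a bipartition is given to the algorithm. There exist a deterministic dynamic algorithm (a single word-RAM program, with words of $O(\log(n+1/\varepsilon))$ bits and unit-cost instructions, that receives $n$ and $\lceil 1/\varepsilon\rceil$ as input) and an absolute constant $C$ such that, for every real $\varepsilon\in(0,1)$, every $n\ge 1$ and every such sequence of updates, the algorithm explicitly maintains, initially and after each update, a matching $M$ of the current graph $G$ (stored as an array of mates) with $$|M|\;\ge\;\mu(G)-\varepsilon n ,$$ and its total running time over the initialization and all updates is at most $$C\left(\frac{n}{\varepsilon^{8}}+\frac{m}{\varepsilon^{5}}\right).$$ -/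

import Mathlib

namespace DynMatching

/-! ### The word RAM -/

/-- Instructions of a deterministic word RAM. `R i` denotes register `i`, `mem` is the
random-access memory; all arithmetic is on `w`-bit words, that is, modulo `2 ^ w`. -/
inductive Instr : Type
  /-- `R d := c` -/
  | const (d c : ℕ)
  /-- `R d := R a` -/
  | move (d a : ℕ)
  /-- `R d := R a + R b` -/
  | add (d a b : ℕ)
  /-- `R d := R a - R b` -/
  | sub (d a b : ℕ)
  /-- `R d := R a * R b` -/
  | mul (d a b : ℕ)
  /-- `R d := mem (R a)` -/
  | load (d a : ℕ)
  /-- `mem (R a) := R b` -/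
  | store (a b : ℕ)
  /-- if `R a < R b`, go to instruction number `l` -/
  | jlt (a b l : ℕ)
  /-- if `R a = R b`, go to instruction number `l` -/
  | jeq (a b l : ℕ)

/-- A program is a finite list of instructions, numbered from `0`. -/
abbrev Program : Type := List Instr

/-- A machine state: registers, memory and program counter. -/
structure State : Type where
  reg : ℕ → ℕ
  mem : ℕ → ℕ
  pc : ℕ

/-- Write the word `x` (reduced modulo `2 ^ w`) to register `d` and go to the next instruction. -/
def State.setReg (s : State) (w d x : ℕ) : State :=
  { reg := Function.update s.reg d (x % 2 ^ w), mem := s.mem, pc := s.pc + 1 }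

/-- The effect of a single instruction on a machine with word size `w`. -/
def Instr.exec (w : ℕ) (s : State) : Instr → State
  | .const d c => s.setReg w d c
  | .move d a => s.setReg w d (s.reg a)
  | .add d a b => s.setReg w d (s.reg a + s.reg b)
  | .sub d a b => s.setReg w d (s.reg a + 2 ^ w - s.reg b)
  | .mul d a b => s.setReg w d (s.reg a * s.reg b)
  | .load d a => s.setReg w d (s.mem (s.reg a))
  | .store a b =>
      { reg := s.reg, mem := Function.update s.mem (s.reg a) (s.reg b), pc := s.pc + 1 }
  | .jlt a b l =>
      { reg := s.reg, mem := s.mem, pc := if s.reg a < s.reg b then l else s.pc + 1 }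
  | .jeq a b l =>
      { reg := s.reg, mem := s.mem, pc := if s.reg a = s.reg b then l else s.pc + 1 }

/-- `RunsTo P w s t s'`: started in state `s`, program `P` on word size `w` halts (its program
counter leaves the program) after executing exactly `t` instructions, and `s'` is the final
state. Every instruction takes one unit of time. -/
inductive RunsTo (P : Program) (w : ℕ) : State → ℕ → State → Prop
  | halt (s : State) (h : P[s.pc]? = none) : RunsTo P w s 0 s
  | step (s : State) (I : Instr) (t : ℕ) (s' : State) (h : P[s.pc]? = some I)
      (hrun : RunsTo P w (I.exec w s) t s') : RunsTo P w s (t + 1) s'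

/-- Call the program: put the request `(op, x, y)` into registers `0`, `1`, `2` and set the
program counter to `0`. Memory and all other registers keep their contents. -/
def State.call (s : State) (op x y : ℕ) : State :=
  { reg := Function.update (Function.update (Function.update s.reg 0 op) 1 x) 2 y
    mem := s.mem
    pc := 0 }

/-- The machine with all registers and all memory cells equal to zero. -/
def State.zero : State :=
  { reg := fun _ => 0, mem := fun _ => 0, pc := 0 }

/-- The initial call, with request `(0, n, k)`: the vertex set is `{0, …, n - 1}` and `k` is
the accuracy parameter. -/
def State.start (n k : ℕ) : State := State.zero.call 0 n k

/-! ### Dynamic graphs -/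

/-- Updates of a dynamic graph with (initial) vertex set `Fin n`. -/
inductive Update (n : ℕ) : Type
  /-- insert the edge `{u, v}` -/
  | insertEdge (u v : Fin n)
  /-- delete the vertex `v` with all its incident edges -/
  | deleteVertex (v : Fin n)

/-- Pass an update to the program: edge insertions are the request `(1, u, v)`, vertex deletions
the request `(2, v, 0)`. -/
def State.feed {n : ℕ} (s : State) : Update n → State
  | .insertEdge u v => s.call 1 u v
  | .deleteVertex v => s.call 2 v 0

/-- A dynamic graph at one moment: the set of vertices not deleted so far and the current edges.
Deleted vertices stay in the type `Fin n` as isolated vertices. -/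
structure DynGraph (n : ℕ) : Type where
  alive : Set (Fin n)
  graph : SimpleGraph (Fin n)

/-- At the beginning all `n` vertices and no edges are present. -/
def DynGraph.empty (n : ℕ) : DynGraph n := ⟨Set.univ, ⊥⟩

/-- The dynamic graph after an update. -/
def DynGraph.apply {n : ℕ} (D : DynGraph n) : Update n → DynGraph n
  | .insertEdge u v => ⟨D.alive, D.graph ⊔ SimpleGraph.edge u v⟩
  | .deleteVertex v => ⟨D.alive \ {v}, D.graph.deleteIncidenceSet v⟩

/-- An edge may be inserted if it joins two distinct present vertices and is not yet present;
a vertex may be deleted if it is present. -/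
def DynGraph.Allows {n : ℕ} (D : DynGraph n) : Update n → Prop
  | .insertEdge u v => u ∈ D.alive ∧ v ∈ D.alive ∧ u ≠ v ∧ ¬ D.graph.Adj u v
  | .deleteVertex v => v ∈ D.alive

/-- The dynamic graph after a sequence of updates of the initially empty graph. -/
def graphAfter {n : ℕ} (σ : List (Update n)) : DynGraph n :=
  σ.foldl DynGraph.apply (DynGraph.empty n)

/-- A legal update sequence for bipartite graphs: every update is allowed at its time, and the
graph is bipartite at all times. -/
def IsLegal {n : ℕ} (σ : List (Update n)) : Prop :=
  (∀ (i : ℕ) (hi : i < σ.length), (graphAfter (σ.take i)).Allows σ[i]) ∧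
    ∀ i ≤ σ.length, (graphAfter (σ.take i)).graph.IsBipartite

/-- Whether an update is an edge insertion. -/
def Update.isInsertion {n : ℕ} : Update n → Bool
  | .insertEdge _ _ => true
  | .deleteVertex _ => false

/-- The total number of edges inserted by a sequence of updates. -/
def numInsertions {n : ℕ} (σ : List (Update n)) : ℕ := σ.countP Update.isInsertion

/-! ### Matchings -/

/-- The maximum number of edges of a matching in a finite graph. -/
noncomputable def matchingNumber {n : ℕ} (G : SimpleGraph (Fin n)) : ℕ :=
  sSup {k : ℕ | ∃ M : G.Subgraph, M.IsMatching ∧ M.edgeSet.ncard = k}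

/-- The supremum defining the matching number is over a bounded set, hence is a genuine
maximum. -/
theorem ncard_edgeSet_le_matchingNumber {n : ℕ} {G : SimpleGraph (Fin n)} {M : G.Subgraph}
    (hM : M.IsMatching) : M.edgeSet.ncard ≤ matchingNumber G := by
  refine le_csSup ⟨Nat.card (Sym2 (Fin n)), ?_⟩ ⟨M, hM, rfl⟩
  rintro k ⟨M', -, rfl⟩
  exact Set.ncard_le_card _

/-- The first `n` memory cells hold the matching `M` as an array of mates: cell `u` holds `v + 1`
if `u` is matched to `v`, and `0` if `u` is unmatched. -/
def Stores {n : ℕ} {G : SimpleGraph (Fin n)} (s : State) (M : G.Subgraph) : Prop :=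
  (∀ u v : Fin n, M.Adj u v → s.mem u = v + 1) ∧ ∀ u : Fin n, u ∉ M.verts → s.mem u = 0

/-- The state `s` stores a matching of `G` of size at least `μ(G) - δ`. -/
def HoldsMatching {n : ℕ} (G : SimpleGraph (Fin n)) (δ : ℝ) (s : State) : Prop :=
  ∃ M : G.Subgraph, M.IsMatching ∧ Stores s M ∧
    (matchingNumber G : ℝ) - δ ≤ (M.edgeSet.ncard : ℝ)

/-- Program `P`, on word size `w`, called once with `(n, k)` and then with the updates in `σ` one
after the other, halts in each call, holds a matching of size at least `μ - δ` of the
current graph after the initial call and after each update, and executes `T` instructions in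
total. Here `s i` is the state after the first `i` updates, and `t i` the time of the call that
led to it. -/
def MaintainsMatching (P : Program) (w n k : ℕ) (δ : ℝ) (σ : List (Update n)) (T : ℕ) : Prop :=
  ∃ (s : ℕ → State) (t : ℕ → ℕ),
    RunsTo P w (State.start n k) (t 0) (s 0) ∧
    (∀ (i : ℕ) (hi : i < σ.length), RunsTo P w ((s i).feed σ[i]) (t (i + 1)) (s (i + 1))) ∧
    (∀ i ≤ σ.length, HoldsMatching (graphAfter (σ.take i)).graph δ (s i)) ∧
    T = ∑ i ∈ Finset.range (σ.length + 1), t i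

end DynMatching

/-!
Let `k = ⌈1 / ε⌉` and `Q = 16 * k`. The program maintains a cover: values `0, …, Q` at the vertices
that add up to at least `Q` at the two ends of each edge. By weak duality twice the sum of a cover
is at least `Q` times the number of vertices of any matching.

*Deletions become insertions.* When a vertex `v < n` is deleted, it is flagged and gets a pendant
edge to an extra vertex `v + n`; old edges at `v` stay in the list. In a cover of all stored edges,
each pendant edge takes up `Q` by itself, and the rest covers the current graph. Hence the set of
edges to be covered only grows (`Linked`).

*Potential.* Let `S` be the sum of the cover `y`, and `T` a threshold. If an inserted edge is
violated, `y` is reflected at this constraint, which does not move `y` away from any vector that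
satisfies it (`dist2_reflect`). While `S > T`, a round decreases all positive values by one and
repairs all violated edges. If there is a cover of sum at most `T - 2 * n + 1`, the round brings
`y` closer to it by `2 * n` in squared distance (`dist2_decr`), which is at most `2 * n * Q ^ 2`.
So after more than `Q ^ 2` rounds there is no such cover; then `T` is raised by `4 * n` and the
matching is recomputed. As `S ≤ 2 * n * Q`, this happens at most `8 * k` times (`Prog.rounds_spec`).

*Matchings.* The bipartition is unknown, so the program runs an auction with prices up to `8 * k`
on the bipartite double cover of the current graph: every vertex is a bidder and an object.
Its prices yield a cover whose sum is close to that of its matching (`Prog.auction_spec`). The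
matching of the double cover is a union of directed paths and cycles in the graph. The cycles are
even since the graph is bipartite, so that every other edge of each path and cycle can be kept, and
this gives a matching with at least half as many edges (`Prog.extract_spec`). Since no cover is much
smaller than `T`, this matching is large in comparison with `T`. A deletion costs it at most two
matched vertices, which the new pendant edge makes up for. This is the field `Good.size`; together
with `S ≤ T` and weak duality it bounds the loss by `n / k ≤ ε * n` (`Linked.exists_matching`).

*Time.* There are `O(k ^ 3)` rounds, and `O(k)` auctions of `O(k ^ 2)` rounds each, all of them
linear in the number of vertices and stored edges, and at most `n` edges are pendant. The total is
`O(k ^ 3 * (n + m))`, which is less than required (`Tracks.clk_le`).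

The program is written in a small structured language with arrays and a clock, which is compiled to
the word RAM (`Big.simulate`), and verified with a weakest-precondition calculus (`Wp`).
-/

namespace DynMatching

/-! ### A structured language over the word RAM -/

/-- Structured programs over word variables (`v`) and arrays (`A`), to be compiled to the RAM. -/
inductive Cmd : Type
  | skip
  | const (d c : ℕ)
  | move (d a : ℕ)
  | add (d a b : ℕ)
  | sub (d a b : ℕ)
  | mul (d a b : ℕ)
  | read (d j a : ℕ)
  | write (j a b : ℕ)
  | seq (c₁ c₂ : Cmd)
  | ifLt (a b : ℕ) (c₁ c₂ : Cmd)
  | ifEq (a b : ℕ) (c₁ c₂ : Cmd)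
  | whileLt (a b : ℕ) (c : Cmd)

/-- Sequential composition of structured programs. -/
infixr:60 " ;; " => Cmd.seq

/-- A state of a structured program: variables, arrays, and a clock that bounds the number of
RAM instructions executed so far. -/
structure Store : Type where
  v : ℕ → ℕ
  A : ℕ → ℕ → ℕ
  clk : ℕ

/-- Assign `x` to variable `d`. -/
def Store.set (s : Store) (d x : ℕ) : Store := ⟨Function.update s.v d x, s.A, s.clk + 2⟩

/-- Write `x` to cell `i` of array `j`. -/
def Store.put (s : Store) (j i x : ℕ) : Store :=
  ⟨s.v, Function.update s.A j (Function.update (s.A j) i x), s.clk + 2⟩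

/-- The charge for a test together with the at most two jumps that it causes. -/
def Store.tick (s : Store) : Store := ⟨s.v, s.A, s.clk + 3⟩

@[simp] theorem Store.set_v (s : Store) (d x : ℕ) : (s.set d x).v = Function.update s.v d x := rfl
@[simp] theorem Store.set_A (s : Store) (d x : ℕ) : (s.set d x).A = s.A := rfl
@[simp] theorem Store.set_clk (s : Store) (d x : ℕ) : (s.set d x).clk = s.clk + 2 := rfl
@[simp] theorem Store.put_v (s : Store) (j i x : ℕ) : (s.put j i x).v = s.v := rfl
@[simp] theorem Store.put_A (s : Store) (j i x : ℕ) :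
    (s.put j i x).A = Function.update s.A j (Function.update (s.A j) i x) := rfl
@[simp] theorem Store.put_clk (s : Store) (j i x : ℕ) : (s.put j i x).clk = s.clk + 2 := rfl
@[simp] theorem Store.tick_v (s : Store) : s.tick.v = s.v := rfl
@[simp] theorem Store.tick_A (s : Store) : s.tick.A = s.A := rfl
@[simp] theorem Store.tick_clk (s : Store) : s.tick.clk = s.clk + 3 := rfl

/-- Big-step semantics with word bound `W` and array length `L`. A step is only possible if no
arithmetic overflow occurs and all array indices are in range; values are therefore genuine
natural numbers, not residues. -/
inductive Big (W L : ℕ) : Cmd → Store → Store → Prop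
  | skip (s) : Big W L .skip s s
  | const (d c s) (h : c < W) : Big W L (.const d c) s (s.set d c)
  | move (d a s) : Big W L (.move d a) s (s.set d (s.v a))
  | add (d a b s) (h : s.v a + s.v b < W) : Big W L (.add d a b) s (s.set d (s.v a + s.v b))
  | sub (d a b s) (h : s.v b ≤ s.v a) : Big W L (.sub d a b) s (s.set d (s.v a - s.v b))
  | mul (d a b s) (h : s.v a * s.v b < W) : Big W L (.mul d a b) s (s.set d (s.v a * s.v b))
  | read (d j a s) (h : s.v a < L) : Big W L (.read d j a) s (s.set d (s.A j (s.v a)))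
  | write (j a b s) (h : s.v a < L) : Big W L (.write j a b) s (s.put j (s.v a) (s.v b))
  | seq (c₁ c₂ s s₁ s₂) (h₁ : Big W L c₁ s s₁) (h₂ : Big W L c₂ s₁ s₂) : Big W L (c₁ ;; c₂) s s₂
  | ifLt_pos (a b c₁ c₂ s s') (h : s.v a < s.v b) (h' : Big W L c₁ s.tick s') :
      Big W L (.ifLt a b c₁ c₂) s s'
  | ifLt_neg (a b c₁ c₂ s s') (h : ¬ s.v a < s.v b) (h' : Big W L c₂ s.tick s') :
      Big W L (.ifLt a b c₁ c₂) s s'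
  | ifEq_pos (a b c₁ c₂ s s') (h : s.v a = s.v b) (h' : Big W L c₁ s.tick s') :
      Big W L (.ifEq a b c₁ c₂) s s'
  | ifEq_neg (a b c₁ c₂ s s') (h : ¬ s.v a = s.v b) (h' : Big W L c₂ s.tick s') :
      Big W L (.ifEq a b c₁ c₂) s s'
  | while_neg (a b c s) (h : ¬ s.v a < s.v b) : Big W L (.whileLt a b c) s s.tick
  | while_pos (a b c s s₁ s₂) (h : s.v a < s.v b) (h₁ : Big W L c s.tick s₁)
      (h₂ : Big W L (.whileLt a b c) s₁ s₂) : Big W L (.whileLt a b c) s s₂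

/-! ### Compilation -/

/-- Machine code of a structured program, placed at address `p`. Variable `x` lives in register
`x`, register `40 + j` holds the base address of array `j`, and register `60` is scratch. An
unconditional jump is `jeq 0 0`. -/
def Cmd.code : Cmd → ℕ → List Instr
  | .skip, _ => []
  | .const d c, _ => [.const d c]
  | .move d a, _ => [.move d a]
  | .add d a b, _ => [.add d a b]
  | .sub d a b, _ => [.sub d a b]
  | .mul d a b, _ => [.mul d a b]
  | .read d j a, _ => [.add 60 (40 + j) a, .load d 60]
  | .write j a b, _ => [.add 60 (40 + j) a, .store 60 b]
  | .seq c₁ c₂, p => c₁.code p ++ c₂.code (p + (c₁.code p).length)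
  | .ifLt a b c₁ c₂, p =>
      let k₂ := c₂.code (p + 1)
      let k₁ := c₁.code (p + 1 + k₂.length + 1)
      .jlt a b (p + 1 + k₂.length + 1) :: (k₂ ++
        .jeq 0 0 (p + 1 + k₂.length + 1 + k₁.length) :: k₁)
  | .ifEq a b c₁ c₂, p =>
      let k₂ := c₂.code (p + 1)
      let k₁ := c₁.code (p + 1 + k₂.length + 1)
      .jeq a b (p + 1 + k₂.length + 1) :: (k₂ ++
        .jeq 0 0 (p + 1 + k₂.length + 1 + k₁.length) :: k₁)
  | .whileLt a b c, p =>
      let k := c.code (p + 2)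
      .jlt a b (p + 2) :: .jeq 0 0 (p + 2 + k.length + 1) :: (k ++ [.jeq 0 0 p])

/-- The program only uses variables below `40` and arrays below `9`. -/
def Cmd.Ok : Cmd → Bool
  | .skip => true
  | .const d _ => d < 40
  | .move d a => d < 40 && a < 40
  | .add d a b => d < 40 && a < 40 && b < 40
  | .sub d a b => d < 40 && a < 40 && b < 40
  | .mul d a b => d < 40 && a < 40 && b < 40
  | .read d j a => d < 40 && j < 9 && a < 40
  | .write j a b => j < 9 && a < 40 && b < 40
  | .seq c₁ c₂ => c₁.Ok && c₂.Ok
  | .ifLt a b c₁ c₂ => a < 40 && b < 40 && c₁.Ok && c₂.Ok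
  | .ifEq a b c₁ c₂ => a < 40 && b < 40 && c₁.Ok && c₂.Ok
  | .whileLt a b c => a < 40 && b < 40 && c.Ok

/-- The machine state `s` represents the store `h`: array `j` occupies the memory cells
`j * L, …, j * L + L - 1`. -/
structure Represents (w L : ℕ) (h : Store) (s : State) : Prop where
  reg : ∀ x < 40, s.reg x = h.v x
  base : ∀ j < 9, s.reg (40 + j) = j * L
  mem : ∀ j < 9, ∀ i < L, s.mem (j * L + i) = h.A j i
  reg_lt : ∀ x, s.reg x < 2 ^ w
  mem_lt : ∀ a, s.mem a < 2 ^ w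

/-- `P` leads from `s` to `s'` in exactly `t` steps. -/
def Steps (P : Program) (w : ℕ) (s : State) (t : ℕ) (s' : State) : Prop :=
  ∀ t₂ s₂, RunsTo P w s' t₂ s₂ → RunsTo P w s (t + t₂) s₂

theorem Steps.refl (P : Program) (w : ℕ) (s : State) : Steps P w s 0 s := by
  intro t₂ s₂ h
  simpa using h

theorem Steps.trans {P : Program} {w : ℕ} {s s₁ s₂ : State} {t t' : ℕ}
    (h : Steps P w s t s₁) (h' : Steps P w s₁ t' s₂) : Steps P w s (t + t') s₂ := by
  intro t₃ s₃ h₃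
  rw [add_assoc]
  exact h _ _ (h' _ _ h₃)

theorem Steps.single {P : Program} {w : ℕ} {s : State} {I : Instr} (h : P[s.pc]? = some I) :
    Steps P w s 1 (I.exec w s) := by
  intro t₂ s₂ h₂
  rw [add_comm]
  exact RunsTo.step s I t₂ s₂ h h₂

/-- The instruction list `l` occurs in `P` at address `p`. -/
def CodeAt (P : Program) (p : ℕ) (l : List Instr) : Prop :=
  ∃ pre post, P = pre ++ l ++ post ∧ pre.length = p

theorem CodeAt.append {P : Program} {p : ℕ} {l₁ l₂ : List Instr} (h : CodeAt P p (l₁ ++ l₂)) :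
    CodeAt P p l₁ ∧ CodeAt P (p + l₁.length) l₂ := by
  obtain ⟨pre, post, rfl, rfl⟩ := h
  exact ⟨⟨pre, l₂ ++ post, by simp, rfl⟩, ⟨pre ++ l₁, post, by simp, by simp⟩⟩

theorem CodeAt.cons {P : Program} {p : ℕ} {I : Instr} {l : List Instr} (h : CodeAt P p (I :: l)) :
    P[p]? = some I ∧ CodeAt P (p + 1) l := by
  obtain ⟨pre, post, rfl, rfl⟩ := h
  refine ⟨by simp, ⟨pre ++ [I], post, by simp, by simp⟩⟩

/-- Assigning a word to a variable commutes with the representation. -/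
theorem Represents.setReg {w L : ℕ} {h : Store} {s : State} (r : Represents w L h s) {d x : ℕ}
    (hd : d < 40) (hx : x < 2 ^ w) : Represents w L (h.set d x) (s.setReg w d x) := by
  have e : x % 2 ^ w = x := Nat.mod_eq_of_lt hx
  refine ⟨?_, ?_, r.mem, ?_, r.mem_lt⟩
  · intro y hy
    simp only [State.setReg, Store.set_v, Function.update_apply, e]
    split_ifs
    · rfl
    · exact r.reg y hy
  · intro j hj
    simp only [State.setReg, Function.update_apply, e]
    rw [if_neg (by omega)]
    exact r.base j hj
  · intro y
    simp only [State.setReg, Function.update_apply, e]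
    split_ifs
    · exact hx
    · exact r.reg_lt y

theorem Represents.scratch {w L : ℕ} {h : Store} {s : State} (r : Represents w L h s) (x : ℕ) :
    Represents w L h (s.setReg w 60 x) := by
  refine ⟨?_, ?_, r.mem, ?_, r.mem_lt⟩
  · intro y hy
    simp only [State.setReg, Function.update_apply]
    rw [if_neg (by omega)]
    exact r.reg y hy
  · intro j hj
    simp only [State.setReg, Function.update_apply]
    rw [if_neg (by omega)]
    exact r.base j hj
  · intro y
    simp only [State.setReg, Function.update_apply]
    split_ifs
    · exact Nat.mod_lt _ (by positivity)
    · exact r.reg_lt y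

theorem Represents.of_eq {w L : ℕ} {h h' : Store} {s s' : State} (r : Represents w L h s)
    (hv : h'.v = h.v) (hA : h'.A = h.A) (hreg : s'.reg = s.reg) (hmem : s'.mem = s.mem) :
    Represents w L h' s' :=
  ⟨by rw [hreg, hv]; exact r.reg, by rw [hreg]; exact r.base, by rw [hmem, hA]; exact r.mem,
    by rw [hreg]; exact r.reg_lt, by rw [hmem]; exact r.mem_lt⟩

theorem Represents.put {w L : ℕ} {h : Store} {s s' : State} (r : Represents w L h s) {j i x : ℕ}
    (hj : j < 9) (hi : i < L) (hx : x < 2 ^ w) (hreg : s'.reg = s.reg)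
    (hmem : s'.mem = Function.update s.mem (j * L + i) x) : Represents w L (h.put j i x) s' := by
  refine ⟨by rw [hreg]; exact r.reg, by rw [hreg]; exact r.base, ?_, by rw [hreg]; exact r.reg_lt,
    ?_⟩
  · intro j' hj' i' hi'
    have key : j' * L + i' = j * L + i ↔ j' = j ∧ i' = i := by
      constructor
      · intro e
        have hL : 0 < L := by omega
        have h1 := congrArg (· / L) e
        have h2 := congrArg (· % L) e
        simp only [Nat.mul_comm _ L, Nat.mul_add_div hL, Nat.div_eq_of_lt hi,
          Nat.div_eq_of_lt hi', Nat.mul_add_mod, Nat.mod_eq_of_lt hi, Nat.mod_eq_of_lt hi'] at h1 h2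
        exact ⟨by omega, h2⟩
      · rintro ⟨rfl, rfl⟩; rfl
    rw [hmem]
    simp only [Function.update_apply, Store.put_A, key]
    by_cases h1 : j' = j
    · subst h1
      by_cases h2 : i' = i
      · simp [h2]
      · simp [h2, r.mem j' hj' i' hi']
    · simp [h1, r.mem j' hj' i' hi']
  · intro a
    rw [hmem]
    simp only [Function.update_apply]
    split_ifs
    · exact hx
    · exact r.mem_lt a

/-- Compiler correctness: an execution of a structured program is simulated by its machine code,
in a number of steps bounded by the advance of the clock. -/
theorem Big.simulate {w L : ℕ} (hL : 9 * L ≤ 2 ^ w) {P : Program} {c : Cmd} {h h' : Store}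
    (hb : Big (2 ^ w) L c h h') : ∀ (s : State), c.Ok = true → CodeAt P s.pc (c.code s.pc) →
      Represents w L h s → ∃ t s', Steps P w s t s' ∧ s'.pc = s.pc + (c.code s.pc).length ∧
        Represents w L h' s' ∧ h.clk + t ≤ h'.clk := by
  have hmod : ∀ {a b : ℕ}, a < 2 ^ w → b ≤ a → (a + 2 ^ w - b) % 2 ^ w = a - b := by
    intro a b ha hb
    rw [show a + 2 ^ w - b = (a - b) + 2 ^ w by omega, Nat.add_mod_right]
    exact Nat.mod_eq_of_lt (by omega)
  have haddr : ∀ {j i : ℕ}, j < 9 → i < L → (j * L + i) % 2 ^ w = j * L + i := by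
    intro j i hj hi
    apply Nat.mod_eq_of_lt
    have : (j + 1) * L ≤ 9 * L := Nat.mul_le_mul_right _ hj
    rw [add_mul] at this
    omega
  have jump : ∀ (s : State) (l : ℕ), P[s.pc]? = some (.jeq 0 0 l) →
      Steps P w s 1 ⟨s.reg, s.mem, l⟩ := by
    intro s l hs
    have := Steps.single (w := w) hs
    simpa [Instr.exec] using this
  induction hb with
  | skip s₀ =>
    intro s _ _ hr
    exact ⟨0, s, Steps.refl _ _ _, by simp [Cmd.code], hr, le_rfl⟩
  | const d c s₀ hc =>
    intro s hok hcode hr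
    simp only [Cmd.Ok, decide_eq_true_eq] at hok
    exact ⟨1, _, Steps.single hcode.cons.1, rfl, hr.setReg hok hc, by simp⟩
  | move d a s₀ =>
    intro s hok hcode hr
    simp only [Cmd.Ok, Bool.and_eq_true, decide_eq_true_eq] at hok
    refine ⟨1, _, Steps.single hcode.cons.1, rfl, ?_, by simp⟩
    rw [← hr.reg a hok.2]
    exact hr.setReg hok.1 (hr.reg_lt a)
  | add d a b s₀ hlt =>
    intro s hok hcode hr
    simp only [Cmd.Ok, Bool.and_eq_true, decide_eq_true_eq] at hok
    refine ⟨1, _, Steps.single hcode.cons.1, rfl, ?_, by simp⟩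
    rw [← hr.reg a hok.1.2, ← hr.reg b hok.2] at hlt ⊢
    exact hr.setReg hok.1.1 hlt
  | sub d a b s₀ hle =>
    intro s hok hcode hr
    simp only [Cmd.Ok, Bool.and_eq_true, decide_eq_true_eq] at hok
    refine ⟨1, _, Steps.single hcode.cons.1, rfl, ?_, by simp⟩
    rw [← hr.reg a hok.1.2, ← hr.reg b hok.2] at hle ⊢
    have ha := hr.reg_lt a
    have key := hr.setReg (x := s.reg a - s.reg b) hok.1.1 (by omega)
    have e : Instr.exec w s (.sub d a b) = s.setReg w d (s.reg a - s.reg b) := by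
      simp only [Instr.exec, State.setReg, hmod ha hle]
      rw [Nat.mod_eq_of_lt (by omega : s.reg a - s.reg b < 2 ^ w)]
    rw [e]
    exact key
  | mul d a b s₀ hlt =>
    intro s hok hcode hr
    simp only [Cmd.Ok, Bool.and_eq_true, decide_eq_true_eq] at hok
    refine ⟨1, _, Steps.single hcode.cons.1, rfl, ?_, by simp⟩
    rw [← hr.reg a hok.1.2, ← hr.reg b hok.2] at hlt ⊢
    exact hr.setReg hok.1.1 hlt
  | read d j a s₀ hlt =>
    intro s hok hcode hr
    simp only [Cmd.Ok, Bool.and_eq_true, decide_eq_true_eq] at hok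
    obtain ⟨⟨hd, hj⟩, ha⟩ := hok
    have hc := hcode.cons
    have hc2 := hc.2.cons
    refine ⟨1 + 1, _, (Steps.single hc.1).trans (Steps.single hc2.1), rfl, ?_, by simp⟩
    have e : (Instr.exec w s (.add 60 (40 + j) a)).reg 60 = j * L + s₀.v a := by
      simp only [Instr.exec, State.setReg, Function.update_self]
      rw [hr.base j hj, hr.reg a ha, haddr hj hlt]
    have e2 : (Instr.exec w s (.add 60 (40 + j) a)).mem (j * L + s₀.v a) = s₀.A j (s₀.v a) :=
      hr.mem j hj _ hlt
    have hr' : Represents w L s₀ (Instr.exec w s (.add 60 (40 + j) a)) := hr.scratch _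
    show Represents w L _ (State.setReg _ w d _)
    rw [e, e2]
    refine hr'.setReg hd ?_
    rw [← e2]
    exact hr.mem_lt _
  | write j a b s₀ hlt =>
    intro s hok hcode hr
    simp only [Cmd.Ok, Bool.and_eq_true, decide_eq_true_eq] at hok
    obtain ⟨⟨hj, ha⟩, hb⟩ := hok
    have hc := hcode.cons
    have hc2 := hc.2.cons
    refine ⟨1 + 1, _, (Steps.single hc.1).trans (Steps.single hc2.1), rfl, ?_, by simp⟩
    have e : (Instr.exec w s (.add 60 (40 + j) a)).reg 60 = j * L + s₀.v a := by
      simp only [Instr.exec, State.setReg, Function.update_self]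
      rw [hr.base j hj, hr.reg a ha, haddr hj hlt]
    have hr' : Represents w L s₀ (Instr.exec w s (.add 60 (40 + j) a)) := hr.scratch _
    have e2 := hr'.reg b hb
    refine hr'.put hj hlt ?_ rfl ?_
    · rw [← e2]; exact hr'.reg_lt b
    · simp only [Instr.exec.eq_7]
      rw [e, e2]
  | seq c₁ c₂ s₀ s₁ s₂ _ _ ih₁ ih₂ =>
    intro s hok hcode hr
    simp only [Cmd.Ok, Bool.and_eq_true] at hok
    have hc := CodeAt.append hcode
    obtain ⟨t₁, s₁', hs₁, hp₁, hr₁, ht₁⟩ := ih₁ s hok.1 hc.1 hr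
    obtain ⟨t₂, s₂', hs₂, hp₂, hr₂, ht₂⟩ := ih₂ s₁' hok.2 (by rw [hp₁]; exact hc.2) hr₁
    refine ⟨t₁ + t₂, s₂', hs₁.trans hs₂, ?_, hr₂, by omega⟩
    rw [hp₂, hp₁]
    simp [Cmd.code, add_assoc]
  | ifLt_pos a b c₁ c₂ s₀ s₁ hlt _ ih =>
    intro s hok hcode hr
    simp only [Cmd.Ok, Bool.and_eq_true, decide_eq_true_eq] at hok
    have hc := CodeAt.cons hcode
    have hc2 := CodeAt.append hc.2
    have hc3 := CodeAt.cons hc2.2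
    have st := Steps.single (w := w) hc.1
    have e : Instr.exec w s (.jlt a b (s.pc + 1 + (c₂.code (s.pc + 1)).length + 1)) =
        ⟨s.reg, s.mem, s.pc + 1 + (c₂.code (s.pc + 1)).length + 1⟩ := by
      simp only [Instr.exec]
      rw [hr.reg a hok.1.1.1, hr.reg b hok.1.1.2, if_pos hlt]
    rw [e] at st
    obtain ⟨t₁, s₁', hs₁, hp₁, hr₁, ht₁⟩ := ih
      ⟨s.reg, s.mem, s.pc + 1 + (c₂.code (s.pc + 1)).length + 1⟩ hok.1.2 hc3.2
      (hr.of_eq rfl rfl rfl rfl)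
    refine ⟨1 + t₁, s₁', st.trans hs₁, ?_, hr₁, ?_⟩
    · rw [hp₁]
      simp [Cmd.code]
      omega
    · simp at ht₁
      omega
  | ifLt_neg a b c₁ c₂ s₀ s₁ hlt _ ih =>
    intro s hok hcode hr
    simp only [Cmd.Ok, Bool.and_eq_true, decide_eq_true_eq] at hok
    have hc := CodeAt.cons hcode
    have hc2 := CodeAt.append hc.2
    have hc3 := CodeAt.cons hc2.2
    have st := Steps.single (w := w) hc.1
    have e : Instr.exec w s (.jlt a b (s.pc + 1 + (c₂.code (s.pc + 1)).length + 1)) =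
        ⟨s.reg, s.mem, s.pc + 1⟩ := by
      simp only [Instr.exec]
      rw [hr.reg a hok.1.1.1, hr.reg b hok.1.1.2, if_neg hlt]
    rw [e] at st
    obtain ⟨t₁, s₁', hs₁, hp₁, hr₁, ht₁⟩ := ih ⟨s.reg, s.mem, s.pc + 1⟩ hok.2 hc2.1
      (hr.of_eq rfl rfl rfl rfl)
    simp only at hp₁
    have st2 := jump s₁' _ (by rw [hp₁]; exact hc3.1)
    refine ⟨1 + t₁ + 1, _, (st.trans hs₁).trans st2, ?_, hr₁.of_eq rfl rfl rfl rfl, ?_⟩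
    · simp [Cmd.code]
      omega
    · simp at ht₁
      omega
  | ifEq_pos a b c₁ c₂ s₀ s₁ hlt _ ih =>
    intro s hok hcode hr
    simp only [Cmd.Ok, Bool.and_eq_true, decide_eq_true_eq] at hok
    have hc := CodeAt.cons hcode
    have hc2 := CodeAt.append hc.2
    have hc3 := CodeAt.cons hc2.2
    have st := Steps.single (w := w) hc.1
    have e : Instr.exec w s (.jeq a b (s.pc + 1 + (c₂.code (s.pc + 1)).length + 1)) =
        ⟨s.reg, s.mem, s.pc + 1 + (c₂.code (s.pc + 1)).length + 1⟩ := by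
      simp only [Instr.exec]
      rw [hr.reg a hok.1.1.1, hr.reg b hok.1.1.2, if_pos hlt]
    rw [e] at st
    obtain ⟨t₁, s₁', hs₁, hp₁, hr₁, ht₁⟩ := ih
      ⟨s.reg, s.mem, s.pc + 1 + (c₂.code (s.pc + 1)).length + 1⟩ hok.1.2 hc3.2
      (hr.of_eq rfl rfl rfl rfl)
    refine ⟨1 + t₁, s₁', st.trans hs₁, ?_, hr₁, ?_⟩
    · rw [hp₁]
      simp [Cmd.code]
      omega
    · simp at ht₁
      omega
  | ifEq_neg a b c₁ c₂ s₀ s₁ hlt _ ih =>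
    intro s hok hcode hr
    simp only [Cmd.Ok, Bool.and_eq_true, decide_eq_true_eq] at hok
    have hc := CodeAt.cons hcode
    have hc2 := CodeAt.append hc.2
    have hc3 := CodeAt.cons hc2.2
    have st := Steps.single (w := w) hc.1
    have e : Instr.exec w s (.jeq a b (s.pc + 1 + (c₂.code (s.pc + 1)).length + 1)) =
        ⟨s.reg, s.mem, s.pc + 1⟩ := by
      simp only [Instr.exec]
      rw [hr.reg a hok.1.1.1, hr.reg b hok.1.1.2, if_neg hlt]
    rw [e] at st
    obtain ⟨t₁, s₁', hs₁, hp₁, hr₁, ht₁⟩ := ih ⟨s.reg, s.mem, s.pc + 1⟩ hok.2 hc2.1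
      (hr.of_eq rfl rfl rfl rfl)
    simp only at hp₁
    have st2 := jump s₁' _ (by rw [hp₁]; exact hc3.1)
    refine ⟨1 + t₁ + 1, _, (st.trans hs₁).trans st2, ?_, hr₁.of_eq rfl rfl rfl rfl, ?_⟩
    · simp [Cmd.code]
      omega
    · simp at ht₁
      omega
  | while_neg a b c s₀ hlt =>
    intro s hok hcode hr
    simp only [Cmd.Ok, Bool.and_eq_true, decide_eq_true_eq] at hok
    have hc := CodeAt.cons hcode
    have hc2 := CodeAt.cons hc.2
    have st := Steps.single (w := w) hc.1
    have e : Instr.exec w s (.jlt a b (s.pc + 2)) = ⟨s.reg, s.mem, s.pc + 1⟩ := by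
      simp only [Instr.exec]
      rw [hr.reg a hok.1.1, hr.reg b hok.1.2, if_neg hlt]
    rw [e] at st
    have st2 := jump ⟨s.reg, s.mem, s.pc + 1⟩ _ hc2.1
    refine ⟨1 + 1, _, st.trans st2, ?_, hr.of_eq rfl rfl rfl rfl, by simp⟩
    simp [Cmd.code]
    omega
  | while_pos a b c s₀ s₁ s₂ hlt _ _ ih₁ ih₂ =>
    intro s hok hcode hr
    have hok' := hok
    have hcode' := hcode
    simp only [Cmd.Ok, Bool.and_eq_true, decide_eq_true_eq] at hok
    have hc := CodeAt.cons hcode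
    have hc2 := CodeAt.cons hc.2
    have hc3 := CodeAt.append hc2.2
    have hc4 := CodeAt.cons hc3.2
    have st := Steps.single (w := w) hc.1
    have e : Instr.exec w s (.jlt a b (s.pc + 2)) = ⟨s.reg, s.mem, s.pc + 2⟩ := by
      simp only [Instr.exec]
      rw [hr.reg a hok.1.1, hr.reg b hok.1.2, if_pos hlt]
    rw [e] at st
    obtain ⟨t₁, s₁', hs₁, hp₁, hr₁, ht₁⟩ := ih₁ ⟨s.reg, s.mem, s.pc + 2⟩ hok.2 hc3.1
      (hr.of_eq rfl rfl rfl rfl)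
    simp only at hp₁
    have st2 := jump s₁' _ (by rw [hp₁]; exact hc4.1)
    obtain ⟨t₂, s₂', hs₂, hp₂, hr₂, ht₂⟩ := ih₂ ⟨s₁'.reg, s₁'.mem, s.pc⟩ hok' hcode'
      (hr₁.of_eq rfl rfl rfl rfl)
    refine ⟨1 + t₁ + 1 + t₂, s₂', ((st.trans hs₁).trans st2).trans hs₂, hp₂, hr₂, ?_⟩
    simp at ht₁
    omega

/-! ### Program logic -/

/-- `Wp W L c Q s`: started in `s`, the program `c` terminates without overflow or index errors in
a store satisfying `Q`. -/
def Wp (W L : ℕ) (c : Cmd) (Q : Store → Prop) (s : Store) : Prop := ∃ s', Big W L c s s' ∧ Q s'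

section Rules

variable {W L : ℕ} {Q Q' : Store → Prop} {s : Store} {c c₁ c₂ : Cmd} {a b d j x : ℕ}

theorem Wp.mono (h : Wp W L c Q s) (hQ : ∀ s', Q s' → Q' s') : Wp W L c Q' s := by
  obtain ⟨s', hb, hq⟩ := h
  exact ⟨s', hb, hQ s' hq⟩

@[simp] theorem wp_skip : Wp W L .skip Q s ↔ Q s :=
  ⟨by rintro ⟨_, ⟨⟩, h⟩; exact h, fun h => ⟨s, .skip s, h⟩⟩

@[simp] theorem wp_const : Wp W L (.const d x) Q s ↔ x < W ∧ Q (s.set d x) :=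
  ⟨by rintro ⟨_, ⟨⟩, h⟩; exact ⟨‹_›, h⟩, fun h => ⟨_, .const _ _ _ h.1, h.2⟩⟩

@[simp] theorem wp_move : Wp W L (.move d a) Q s ↔ Q (s.set d (s.v a)) :=
  ⟨by rintro ⟨_, ⟨⟩, h⟩; exact h, fun h => ⟨_, .move _ _ _, h⟩⟩

@[simp] theorem wp_add :
    Wp W L (.add d a b) Q s ↔ s.v a + s.v b < W ∧ Q (s.set d (s.v a + s.v b)) :=
  ⟨by rintro ⟨_, ⟨⟩, h⟩; exact ⟨‹_›, h⟩, fun h => ⟨_, .add _ _ _ _ h.1, h.2⟩⟩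

@[simp] theorem wp_sub :
    Wp W L (.sub d a b) Q s ↔ s.v b ≤ s.v a ∧ Q (s.set d (s.v a - s.v b)) :=
  ⟨by rintro ⟨_, ⟨⟩, h⟩; exact ⟨‹_›, h⟩, fun h => ⟨_, .sub _ _ _ _ h.1, h.2⟩⟩

@[simp] theorem wp_mul :
    Wp W L (.mul d a b) Q s ↔ s.v a * s.v b < W ∧ Q (s.set d (s.v a * s.v b)) :=
  ⟨by rintro ⟨_, ⟨⟩, h⟩; exact ⟨‹_›, h⟩, fun h => ⟨_, .mul _ _ _ _ h.1, h.2⟩⟩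

@[simp] theorem wp_read :
    Wp W L (.read d j a) Q s ↔ s.v a < L ∧ Q (s.set d (s.A j (s.v a))) :=
  ⟨by rintro ⟨_, ⟨⟩, h⟩; exact ⟨‹_›, h⟩, fun h => ⟨_, .read _ _ _ _ h.1, h.2⟩⟩

@[simp] theorem wp_write :
    Wp W L (.write j a b) Q s ↔ s.v a < L ∧ Q (s.put j (s.v a) (s.v b)) :=
  ⟨by rintro ⟨_, ⟨⟩, h⟩; exact ⟨‹_›, h⟩, fun h => ⟨_, .write _ _ _ _ h.1, h.2⟩⟩

@[simp] theorem wp_seq : Wp W L (c₁ ;; c₂) Q s ↔ Wp W L c₁ (Wp W L c₂ Q) s := by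
  constructor
  · rintro ⟨_, ⟨⟩, h⟩
    exact ⟨_, ‹_›, _, ‹_›, h⟩
  · rintro ⟨s₁, h₁, s₂, h₂, h⟩
    exact ⟨s₂, .seq _ _ _ _ _ h₁ h₂, h⟩

@[simp] theorem wp_ifLt : Wp W L (.ifLt a b c₁ c₂) Q s ↔
    (s.v a < s.v b → Wp W L c₁ Q s.tick) ∧ (¬ s.v a < s.v b → Wp W L c₂ Q s.tick) := by
  constructor
  · rintro ⟨s', h, hq⟩
    cases h with
    | ifLt_pos _ _ _ _ _ _ h h' => exact ⟨fun _ => ⟨_, h', hq⟩, fun hn => absurd h hn⟩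
    | ifLt_neg _ _ _ _ _ _ h h' => exact ⟨fun hn => absurd hn h, fun _ => ⟨_, h', hq⟩⟩
  · rintro ⟨h₁, h₂⟩
    by_cases h : s.v a < s.v b
    · obtain ⟨s', hb, hq⟩ := h₁ h
      exact ⟨s', .ifLt_pos _ _ _ _ _ _ h hb, hq⟩
    · obtain ⟨s', hb, hq⟩ := h₂ h
      exact ⟨s', .ifLt_neg _ _ _ _ _ _ h hb, hq⟩

@[simp] theorem wp_ifEq : Wp W L (.ifEq a b c₁ c₂) Q s ↔
    (s.v a = s.v b → Wp W L c₁ Q s.tick) ∧ (¬ s.v a = s.v b → Wp W L c₂ Q s.tick) := by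
  constructor
  · rintro ⟨s', h, hq⟩
    cases h with
    | ifEq_pos _ _ _ _ _ _ h h' => exact ⟨fun _ => ⟨_, h', hq⟩, fun hn => absurd h hn⟩
    | ifEq_neg _ _ _ _ _ _ h h' => exact ⟨fun hn => absurd hn h, fun _ => ⟨_, h', hq⟩⟩
  · rintro ⟨h₁, h₂⟩
    by_cases h : s.v a = s.v b
    · obtain ⟨s', hb, hq⟩ := h₁ h
      exact ⟨s', .ifEq_pos _ _ _ _ _ _ h hb, hq⟩
    · obtain ⟨s', hb, hq⟩ := h₂ h
      exact ⟨s', .ifEq_neg _ _ _ _ _ _ h hb, hq⟩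

/-- The variables a program may assign. -/
def Cmd.mods : Cmd → List ℕ
  | .skip => []
  | .const d _ => [d]
  | .move d _ => [d]
  | .add d _ _ => [d]
  | .sub d _ _ => [d]
  | .mul d _ _ => [d]
  | .read d _ _ => [d]
  | .write _ _ _ => []
  | .seq c₁ c₂ => c₁.mods ++ c₂.mods
  | .ifLt _ _ c₁ c₂ => c₁.mods ++ c₂.mods
  | .ifEq _ _ c₁ c₂ => c₁.mods ++ c₂.mods
  | .whileLt _ _ c => c.mods

/-- The arrays a program may write to. -/
def Cmd.amods : Cmd → List ℕ
  | .write j _ _ => [j]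
  | .seq c₁ c₂ => c₁.amods ++ c₂.amods
  | .ifLt _ _ c₁ c₂ => c₁.amods ++ c₂.amods
  | .ifEq _ _ c₁ c₂ => c₁.amods ++ c₂.amods
  | .whileLt _ _ c => c.amods
  | _ => []

/-- The stores `s` and `s'` agree on everything that `c` cannot modify. -/
def Frame (c : Cmd) (s s' : Store) : Prop :=
  (∀ r, r ∉ c.mods → s'.v r = s.v r) ∧ (∀ j, j ∉ c.amods → s'.A j = s.A j)

theorem Frame.v {c : Cmd} {s s' : Store} (h : Frame c s s') {r : ℕ}
    (hr : c.mods.contains r = false) : s'.v r = s.v r :=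
  h.1 r (by intro hm; simp_all)

theorem Frame.arr {c : Cmd} {s s' : Store} (h : Frame c s s') {j : ℕ}
    (hj : c.amods.contains j = false) : s'.A j = s.A j :=
  h.2 j (by intro hm; simp_all)

theorem Big.frame {s s' : Store} (h : Big W L c s s') : Frame c s s' := by
  induction h with
  | skip => exact ⟨fun _ _ => rfl, fun _ _ => rfl⟩
  | const | move | add | sub | mul | read =>
    refine ⟨fun r hr => ?_, fun _ _ => rfl⟩
    simp only [Cmd.mods, List.mem_singleton] at hr
    simp [hr]
  | write =>
    refine ⟨fun _ _ => rfl, fun r hr => ?_⟩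
    simp only [Cmd.amods, List.mem_singleton] at hr
    simp [hr]
  | seq _ _ _ _ _ _ _ ih₁ ih₂ =>
    refine ⟨fun r hr => ?_, fun r hr => ?_⟩
    · simp only [Cmd.mods, List.mem_append, not_or] at hr
      rw [ih₂.1 r hr.2, ih₁.1 r hr.1]
    · simp only [Cmd.amods, List.mem_append, not_or] at hr
      rw [ih₂.2 r hr.2, ih₁.2 r hr.1]
  | ifLt_pos _ _ _ _ _ _ _ _ ih | ifEq_pos _ _ _ _ _ _ _ _ ih =>
    refine ⟨fun r hr => ?_, fun r hr => ?_⟩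
    · simp only [Cmd.mods, List.mem_append, not_or] at hr
      exact ih.1 r hr.1
    · simp only [Cmd.amods, List.mem_append, not_or] at hr
      exact ih.2 r hr.1
  | ifLt_neg _ _ _ _ _ _ _ _ ih | ifEq_neg _ _ _ _ _ _ _ _ ih =>
    refine ⟨fun r hr => ?_, fun r hr => ?_⟩
    · simp only [Cmd.mods, List.mem_append, not_or] at hr
      exact ih.1 r hr.2
    · simp only [Cmd.amods, List.mem_append, not_or] at hr
      exact ih.2 r hr.2
  | while_neg => exact ⟨fun _ _ => rfl, fun _ _ => rfl⟩
  | while_pos _ _ _ _ _ _ _ _ _ ih₁ ih₂ =>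
    refine ⟨fun r hr => ?_, fun r hr => ?_⟩
    · rw [ih₂.1 r hr, ih₁.1 r hr]; rfl
    · rw [ih₂.2 r hr, ih₁.2 r hr]; rfl

/-- The consequence rule together with the frame rule. -/
theorem Wp.conseq (h : Wp W L c Q s) (hQ : ∀ s', Q s' → Frame c s s' → Q' s') :
    Wp W L c Q' s := by
  obtain ⟨s', hb, hq⟩ := h
  exact ⟨s', hb, hQ s' hq hb.frame⟩

theorem Frame.trans {s₁ s₂ : Store} (h : Frame c s s₁) (h' : Frame c s₁ s₂) : Frame c s s₂ :=
  ⟨fun r hr => (h'.1 r hr).trans (h.1 r hr), fun r hr => (h'.2 r hr).trans (h.2 r hr)⟩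

theorem Frame.refl (c : Cmd) (s : Store) : Frame c s s := ⟨fun _ _ => rfl, fun _ _ => rfl⟩

/-- The rule for loops: an invariant and a decreasing measure. -/
theorem wp_while (I : Store → Prop) (μ : Store → ℕ) (h0 : I s)
    (hbody : ∀ s', I s' → Frame c s s' → s'.v a < s'.v b →
      Wp W L c (fun s'' => I s'' ∧ μ s'' < μ s') s'.tick)
    (hexit : ∀ s', I s' → Frame c s s' → ¬ s'.v a < s'.v b → Q s'.tick) :
    Wp W L (.whileLt a b c) Q s := by
  have key : ∀ (k : ℕ) (s' : Store), μ s' = k → I s' → Frame c s s' →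
      Wp W L (.whileLt a b c) Q s' := by
    intro k
    induction k using Nat.strong_induction_on with
    | _ k ih =>
      intro s' hk hI hf
      by_cases hlt : s'.v a < s'.v b
      · obtain ⟨s₁, hb, hI₁, hμ⟩ := hbody s' hI hf hlt
        obtain ⟨s₂, hb₂, hq⟩ := ih (μ s₁) (by omega) s₁ rfl hI₁
          (hf.trans ⟨hb.frame.1, hb.frame.2⟩)
        exact ⟨s₂, .while_pos _ _ _ _ _ _ hlt hb hb₂, hq⟩
      · exact ⟨_, .while_neg _ _ _ _ hlt, hexit s' hI hf hlt⟩
  exact key _ s rfl h0 (Frame.refl _ _)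

/-- `for i := 0 to n - 1 do c`, where `n` is the value of variable `b` and variable `o` holds
the number one. -/
def Cmd.for (i b o : ℕ) (c : Cmd) : Cmd :=
  .const i 0 ;; .whileLt i b (c ;; .add i i o)

/-- The rule for counting loops. -/
theorem wp_for {i o : ℕ} (I : ℕ → Store → Prop) (ho : s.v o = 1) (hW : s.v b < W)
    (hmods : (c.mods.contains i || c.mods.contains b || c.mods.contains o ||
      decide (i = b) || decide (i = o)) = false)
    (h0 : I 0 (s.set i 0))
    (hbody : ∀ k s', I k s' → Frame (.for i b o c) s s' → s'.v i = k → k < s.v b →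
      Wp W L c (fun s'' => I (k + 1) (s''.set i (k + 1))) s'.tick)
    (hexit : ∀ s', I (s.v b) s' → Frame (.for i b o c) s s' → Q s'.tick) :
    Wp W L (.for i b o c) Q s := by
  simp only [Bool.or_eq_false_iff, decide_eq_false_iff_not] at hmods
  obtain ⟨⟨⟨⟨hi, hb⟩, hco⟩, hib⟩, hio⟩ := hmods
  have hfb : (Cmd.for i b o c).mods.contains b = false := by
    simp only [List.contains_eq_mem, decide_eq_false_iff_not] at hb ⊢
    simp only [Cmd.for, Cmd.mods, List.mem_append, List.mem_singleton, not_or]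
    exact ⟨fun h => hib h.symm, hb, fun h => hib h.symm⟩
  have hfo : (Cmd.for i b o c).mods.contains o = false := by
    simp only [List.contains_eq_mem, decide_eq_false_iff_not] at hco ⊢
    simp only [Cmd.for, Cmd.mods, List.mem_append, List.mem_singleton, not_or]
    exact ⟨fun h => hio h.symm, hco, fun h => hio h.symm⟩
  have hsub : ∀ s', Frame (c ;; .add i i o) (s.set i 0) s' → Frame (.for i b o c) s s' := by
    intro s' hf
    refine ⟨fun r hr => ?_, fun r hr => ?_⟩
    · simp only [Cmd.for, Cmd.mods, List.mem_append, List.mem_singleton, not_or] at hr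
      rw [hf.1 r (by simp [Cmd.mods, hr])]
      simp [hr.1]
    · simp only [Cmd.for, Cmd.amods, List.append_nil, List.nil_append] at hr
      rw [hf.2 r (by simpa [Cmd.amods] using hr)]
      simp
  rw [Cmd.for, wp_seq, wp_const]
  refine ⟨by omega, wp_while (fun s' => s'.v i ≤ s.v b ∧ I (s'.v i) s')
    (fun s' => s.v b - s'.v i) ⟨by simp, by simpa using h0⟩ ?_ ?_⟩
  · rintro s' ⟨hle, hI⟩ hf hlt
    have hF := hsub s' hf
    rw [hF.v hfb] at hlt
    rw [wp_seq]
    refine (hbody (s'.v i) s' hI hF rfl hlt).conseq ?_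
    intro s'' hI'' hf''
    have e1 : s''.v i = s'.v i := hf''.v hi
    have e2 : s''.v o = 1 := (hf''.v hco).trans ((hF.v hfo).trans ho)
    rw [wp_add, e1, e2]
    refine ⟨by omega, ⟨by simp; omega, by simpa using hI''⟩, ?_⟩
    simp
    omega
  · rintro s' ⟨hle, hI⟩ hf hlt
    have hF := hsub s' hf
    rw [hF.v hfb] at hlt
    have : s'.v i = s.v b := by omega
    rw [this] at hI
    exact hexit s' hI hF

end Rules

/-! ### The program -/

/-- the kind of the request -/
notation "rOp" => (0 : ℕ)
/-- the first argument of the request -/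
notation "rX" => (1 : ℕ)
/-- the second argument of the request -/
notation "rY" => (2 : ℕ)
/-- the constant zero -/
notation "rZ" => (3 : ℕ)
/-- the constant one -/
notation "rO" => (4 : ℕ)
/-- the number `n` of vertices -/
notation "rn" => (5 : ℕ)
/-- the accuracy parameter `k` -/
notation "rk" => (6 : ℕ)
/-- the number `2 * n` of vertices including the pendant ones -/
notation "rN" => (7 : ℕ)
/-- the price bound `8 * k` of the auction -/
notation "rB" => (8 : ℕ)
/-- the covering bound `16 * k` -/
notation "rQ" => (9 : ℕ)
/-- the number `(16 * k) ^ 2` of rounds of a phase -/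
notation "rR" => (10 : ℕ)
/-- the step `4 * n` of the threshold -/
notation "rD" => (11 : ℕ)
/-- the number of stored edges -/
notation "rm" => (12 : ℕ)
/-- the threshold for the sum of the potential cover -/
notation "rT" => (13 : ℕ)
/-- the sum of the potential cover -/
notation "rS" => (14 : ℕ)
/-- the number of rounds since the last change of the threshold -/
notation "rc" => (15 : ℕ)
/-- the number of unsatisfied bidders -/
notation "rb" => (16 : ℕ)
/-- a loop counter -/
notation "ri" => (17 : ℕ)
/-- an endpoint of an edge -/
notation "ru" => (18 : ℕ)
/-- an endpoint of an edge -/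
notation "rv" => (19 : ℕ)
/-- the current position of a walk, plus one -/
notation "rwk" => (20 : ℕ)
/-- scratch -/
notation "rt₁" => (21 : ℕ)
/-- scratch -/
notation "rt₂" => (22 : ℕ)
/-- scratch -/
notation "rt₃" => (23 : ℕ)

/-- the array of mates -/
notation "aM" => (0 : ℕ)
/-- first endpoints of the edges -/
notation "aU" => (1 : ℕ)
/-- second endpoints of the edges -/
notation "aV" => (2 : ℕ)
/-- the cover -/
notation "aY" => (3 : ℕ)
/-- flags of the deleted vertices -/
notation "aX" => (4 : ℕ)
/-- prices of objects -/
notation "aP" => (5 : ℕ)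
/-- objects held by bidders, plus one -/
notation "aO" => (6 : ℕ)
/-- holders of objects, plus one -/
notation "aH" => (7 : ℕ)
/-- least prices in the neighbourhoods of bidders -/
notation "aL" => (8 : ℕ)

namespace Prog

/-- Reflect the cover values of the vertices in variables `ru`, `rv` if their sum is too small. -/
def reflect : Cmd :=
  .read rt₁ aY ru ;; .read rt₂ aY rv ;; .add rt₃ rt₁ rt₂ ;;
  .ifLt rt₃ rQ
    (.sub rt₃ rQ rt₃ ;; .add rt₁ rt₁ rt₃ ;; .add rt₂ rt₂ rt₃ ;; .write aY ru rt₁ ;; .write aY rv rt₂ ;;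
      .add rS rS rt₃ ;; .add rS rS rt₃)
    .skip

/-- Load the edge number `ri` into `ru`, `rv`. -/
def getEdge : Cmd := .read ru aU ri ;; .read rv aV ri

/-- Run `c` on the edge number `ri`, unless one of its endpoints has been deleted. -/
def onEdge (c : Cmd) : Cmd :=
  getEdge ;; .read rt₁ aX ru ;;
  .ifEq rt₁ rZ (.read rt₁ aX rv ;; .ifEq rt₁ rZ c .skip) .skip

/-- Repair all violated edges. -/
def scan : Cmd := .for ri rm rO (getEdge ;; reflect)

/-- Decrease all positive cover values by one. -/
def decr : Cmd :=
  .for ri rN rO (.read rt₁ aY ri ;;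
    .ifLt rZ rt₁ (.sub rt₁ rt₁ rO ;; .write aY ri rt₁ ;; .sub rS rS rO) .skip)

/-- Lower the level of bidder `u` to the price of object `v`. -/
def lower (u v : ℕ) : Cmd :=
  .read rt₁ aL u ;; .read rt₂ aP v ;; .ifLt rt₂ rt₁ (.write aL u rt₂) .skip

/-- Compute the least price in the neighbourhood of each bidder. -/
def levels : Cmd :=
  .for ri rN rO (.write aL ri rB) ;;
  .for ri rm rO (onEdge (lower ru rv ;; lower rv ru))

/-- Count the unmatched bidders with a neighbour of price below the bound. -/
def count : Cmd :=
  .move rb rZ ;;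
  .for ri rN rO (.read rt₁ aO ri ;;
    .ifEq rt₁ rZ (.read rt₂ aL ri ;; .ifLt rt₂ rB (.add rb rb rO) .skip) .skip)

/-- If bidder `u` is unmatched and object `v` has the least price in its neighbourhood, then `u`
takes `v` from its holder, and the price of `v` goes up. -/
def bid (u v : ℕ) : Cmd :=
  .read rt₁ aO u ;;
  .ifEq rt₁ rZ
    (.read rt₁ aL u ;;
      .ifLt rt₁ rB
        (.read rt₂ aP v ;;
          .ifEq rt₁ rt₂
            (.read rt₃ aH v ;; .ifLt rZ rt₃ (.sub rt₃ rt₃ rO ;; .write aO rt₃ rZ) .skip ;;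
              .add rt₃ u rO ;; .write aH v rt₃ ;; .add rt₃ v rO ;; .write aO u rt₃ ;;
              .add rt₂ rt₂ rO ;; .write aP v rt₂)
            .skip)
        .skip)
    .skip

/-- One round of bidding. -/
def bids : Cmd := .for ri rm rO (onEdge (bid ru rv ;; bid rv ru))

/-- The auction on the bipartite double cover. -/
def auction : Cmd :=
  .for ri rN rO (.write aP ri rZ ;; .write aO ri rZ ;; .write aH ri rZ) ;;
  levels ;; count ;; .mul rt₁ rb rk ;;
  .whileLt rn rt₁ (bids ;; levels ;; count ;; .mul rt₁ rb rk)

/-- Starting from vertex `rwk - 1`, match every other edge of the trail of bidders and objects. -/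
def trail : Cmd :=
  .whileLt rZ rwk
    (.sub ru rwk rO ;; .read rt₁ aM ru ;; .read rt₂ aO ru ;; .move rwk rZ ;;
      .ifEq rt₁ rZ
        (.ifLt rZ rt₂
          (.sub rv rt₂ rO ;; .write aM ru rt₂ ;; .add rt₁ ru rO ;; .write aM rv rt₁ ;;
            .read rwk aO rv)
          .skip)
        .skip)

/-- Extract a matching of the graph from the matching of the double cover. -/
def extract : Cmd :=
  .for ri rN rO (.write aM ri rZ) ;;
  .for ri rN rO (.read rt₁ aH ri ;; .ifEq rt₁ rZ (.add rwk ri rO ;; trail) .skip) ;;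
  .for ri rN rO (.add rwk ri rO ;; trail)

/-- Unmatch the vertex in variable `x`. -/
def unmatch (x : ℕ) : Cmd :=
  .read rt₁ aM x ;;
  .ifLt rZ rt₁ (.sub rt₁ rt₁ rO ;; .write aM rt₁ rZ ;; .write aM x rZ) .skip

/-- Recompute the matching. -/
def rebuild : Cmd := auction ;; extract

/-- Restore the invariant that the sum of the cover is at most the threshold. -/
def rounds : Cmd :=
  .whileLt rT rS
    (decr ;; scan ;; .add rc rc rO ;;
      .ifLt rR rc (.move rc rZ ;; .add rT rT rD ;; rebuild) .skip)

/-- Insert the edge given by `rX`, `rY`. -/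
def insert : Cmd :=
  .write aU rm rX ;; .write aV rm rY ;; .add rm rm rO ;;
  .move ru rX ;; .move rv rY ;; reflect ;; rounds

/-- Prepare the deletion of the vertex `rX`, which is completed by the insertion of a pendant
edge. -/
def kill : Cmd := unmatch rX ;; .write aX rX rO ;; .add rY rX rn

/-- Set up the parameters. -/
def setup : Cmd :=
  .move rn rX ;; .move rk rY ;; .add rN rn rn ;; .const rt₁ 8 ;; .mul rB rk rt₁ ;;
  .add rQ rB rB ;; .mul rR rQ rQ ;; .add rD rN rN

/-- The program, up to the computation of array addresses. -/
def main : Cmd :=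
  .const rZ 0 ;; .const rO 1 ;;
  .ifEq rOp rZ setup (.ifEq rOp rO insert (kill ;; insert))

end Prog

theorem Prog.main_ok : Prog.main.Ok = true := by decide

/-! ### Potential of a cover -/

/-- The sum of the first `N` values. -/
def total (N : ℕ) (y : ℕ → ℕ) : ℕ := ∑ v ∈ Finset.range N, y v

/-- The squared distance between two vectors. -/
def dist2 (N : ℕ) (y z : ℕ → ℕ) : ℤ := ∑ v ∈ Finset.range N, ((y v : ℤ) - z v) ^ 2

/-- `z` covers the first `m` edges: the sum at each edge is at least `Q`. -/
def Covers (eu ev : ℕ → ℕ) (m Q : ℕ) (z : ℕ → ℕ) : Prop := ∀ i < m, Q ≤ z (eu i) + z (ev i)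

theorem total_update {N u : ℕ} (hu : u < N) (y : ℕ → ℕ) (x : ℕ) :
    total N (Function.update y u x) + y u = total N y + x := by
  unfold total
  rw [← Finset.add_sum_erase _ _ (Finset.mem_range.2 hu),
    ← Finset.add_sum_erase _ y (Finset.mem_range.2 hu)]
  have : ∑ v ∈ (Finset.range N).erase u, Function.update y u x v =
      ∑ v ∈ (Finset.range N).erase u, y v :=
    Finset.sum_congr rfl fun v hv => Function.update_of_ne (Finset.ne_of_mem_erase hv) _ _
  rw [this, Function.update_self]
  omega

theorem dist2_update {N u : ℕ} (hu : u < N) (y z : ℕ → ℕ) (x : ℕ) :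
    dist2 N (Function.update y u x) z = dist2 N y z - ((y u : ℤ) - z u) ^ 2 + ((x : ℤ) - z u) ^ 2 := by
  unfold dist2
  rw [← Finset.add_sum_erase _ _ (Finset.mem_range.2 hu),
    ← Finset.add_sum_erase _ (fun v => ((y v : ℤ) - z v) ^ 2) (Finset.mem_range.2 hu)]
  have : ∑ v ∈ (Finset.range N).erase u, ((Function.update y u x v : ℤ) - z v) ^ 2 =
      ∑ v ∈ (Finset.range N).erase u, ((y v : ℤ) - z v) ^ 2 :=
    Finset.sum_congr rfl fun v hv => by
      rw [Function.update_of_ne (Finset.ne_of_mem_erase hv)]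
  rw [this, Function.update_self]
  ring

theorem total_le {N Q : ℕ} {y : ℕ → ℕ} (h : ∀ v < N, y v ≤ Q) : total N y ≤ N * Q := by
  have := Finset.sum_le_card_nsmul (Finset.range N) y Q (fun v hv => h v (Finset.mem_range.1 hv))
  simpa [total] using this

theorem apply_le_total {N u : ℕ} (hu : u < N) (y : ℕ → ℕ) : y u ≤ total N y :=
  Finset.single_le_sum (f := y) (fun _ _ => Nat.zero_le _) (Finset.mem_range.2 hu)

/-- Reflection at a violated constraint does not move away from any vector satisfying it. -/
theorem dist2_reflect {N Q u v : ℕ} (hu : u < N) (hv : v < N) (huv : u ≠ v) (y z : ℕ → ℕ)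
    (hy : y u + y v ≤ Q) (hz : Q ≤ z u + z v) :
    dist2 N (Function.update (Function.update y u (Q - y v)) v (Q - y u)) z ≤ dist2 N y z := by
  rw [dist2_update hv, dist2_update hu, Function.update_of_ne huv.symm]
  push_cast [show y v ≤ Q by omega, show y u ≤ Q by omega]
  zify at hy hz
  nlinarith [mul_nonneg (sub_nonneg.2 hy) (sub_nonneg.2 hz)]

/-- Decreasing a vector whose sum exceeds that of `z` by `N` moves it towards `z`. -/
theorem dist2_decr {N : ℕ} (y z : ℕ → ℕ) (h : total N z + N ≤ total N y) :
    dist2 N (fun v => y v - 1) z + N ≤ dist2 N y z := by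
  have key : dist2 N (fun v => y v - 1) z ≤
      ∑ v ∈ Finset.range N, (((y v : ℤ) - z v) ^ 2 - 2 * ((y v : ℤ) - z v) + 1) := by
    refine Finset.sum_le_sum fun v _ => ?_
    rcases Nat.eq_zero_or_pos (y v) with h0 | h0
    · simp only [h0]
      have : (0 : ℤ) ≤ z v := Int.natCast_nonneg _
      push_cast
      nlinarith
    · push_cast [Nat.cast_sub h0]
      apply le_of_eq
      ring
  rw [Finset.sum_add_distrib, Finset.sum_sub_distrib, ← Finset.mul_sum,
    Finset.sum_sub_distrib] at key
  unfold total at h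
  zify at h
  simp only [Finset.sum_const, Finset.card_range, nsmul_eq_mul, mul_one] at key
  unfold dist2 at *
  linarith

theorem dist2_nonneg (N : ℕ) (y z : ℕ → ℕ) : 0 ≤ dist2 N y z :=
  Finset.sum_nonneg fun _ _ => sq_nonneg _

theorem dist2_le {N Q : ℕ} {y z : ℕ → ℕ} (hy : ∀ v < N, y v ≤ Q) (hz : ∀ v < N, z v ≤ Q) :
    dist2 N y z ≤ N * (Q * Q) := by
  have : dist2 N y z ≤ ∑ v ∈ Finset.range N, ((Q : ℤ) * Q) := by
    refine Finset.sum_le_sum fun v hv => ?_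
    have h1 := hy v (Finset.mem_range.1 hv)
    have h2 := hz v (Finset.mem_range.1 hv)
    zify at h1 h2
    have h3 : (0 : ℤ) ≤ z v := Int.natCast_nonneg _
    have h4 : (0 : ℤ) ≤ y v := Int.natCast_nonneg _
    nlinarith
  simpa using this

/-! ### Invariants common to all parts of the program -/

/-- The word bound `W` and the array length `L` are large enough. -/
structure Sizes (W L n k : ℕ) : Prop where
  n_pos : 1 ≤ n
  k_pos : 1 ≤ k
  index : 2 * n + 1 ≤ L
  L_lt : L < W
  big : 1000 * (n * k + k * k + n + k) < W

/-- The constants of the program have been set up, and `m` edges are stored. -/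
structure Ready (n k m : ℕ) (s : Store) : Prop where
  zero : s.v rZ = 0
  one : s.v rO = 1
  vn : s.v rn = n
  vk : s.v rk = k
  vN : s.v rN = 2 * n
  vB : s.v rB = 8 * k
  vQ : s.v rQ = 16 * k
  vR : s.v rR = 16 * k * (16 * k)
  vD : s.v rD = 4 * n
  vm : s.v rm = m

/-- The first `m` stored edges join distinct vertices, and those between vertices that have not
been deleted (the vertices `v` with `dd v = 0`) form a bipartite graph. -/
structure EdgesOk (n m L : ℕ) (dd eu ev : ℕ → ℕ) : Prop where
  lt : m < L
  u : ∀ i < m, eu i < 2 * n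
  v : ∀ i < m, ev i < 2 * n
  ne : ∀ i < m, eu i ≠ ev i
  bip : ∃ χ : ℕ → Bool, ∀ i < m, dd (eu i) = 0 → dd (ev i) = 0 → χ (eu i) ≠ χ (ev i)

/-- The program does not change the parameters. -/
def Cmd.keeps (c : Cmd) : Bool := [3, 4, 5, 6, 7, 8, 9, 10, 11, 12].all fun r => !c.mods.contains r

theorem Ready.frame {n k m : ℕ} {s s' : Store} {c : Cmd} (h : Ready n k m s) (hf : Frame c s s')
    (hc : c.keeps = true) : Ready n k m s' := by
  simp only [Cmd.keeps, List.all_cons, List.all_nil, Bool.and_true, Bool.and_eq_true,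
    Bool.not_eq_true'] at hc
  obtain ⟨h3, h4, h5, h6, h7, h8, h9, h10, h11, h12⟩ := hc
  exact ⟨(hf.v h3).trans h.zero, (hf.v h4).trans h.one, (hf.v h5).trans h.vn, (hf.v h6).trans h.vk,
    (hf.v h7).trans h.vN, (hf.v h8).trans h.vB, (hf.v h9).trans h.vQ, (hf.v h10).trans h.vR,
    (hf.v h11).trans h.vD, (hf.v h12).trans h.vm⟩

theorem Ready.set {n k m d x : ℕ} {s : Store} (h : Ready n k m s) (hd : 13 ≤ d) :
    Ready n k m (s.set d x) := by
  have key : ∀ r < 13, (s.set d x).v r = s.v r := fun r hr =>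
    Function.update_of_ne (by omega) _ _
  exact ⟨(key _ (by omega)).trans h.zero, (key _ (by omega)).trans h.one,
    (key _ (by omega)).trans h.vn, (key _ (by omega)).trans h.vk, (key _ (by omega)).trans h.vN,
    (key _ (by omega)).trans h.vB, (key _ (by omega)).trans h.vQ, (key _ (by omega)).trans h.vR,
    (key _ (by omega)).trans h.vD, (key _ (by omega)).trans h.vm⟩

theorem Ready.congr {n k m : ℕ} {s s' : Store} (h : Ready n k m s) (hv : s'.v = s.v) :
    Ready n k m s' := by
  constructor <;> rw [hv]
  exacts [h.zero, h.one, h.vn, h.vk, h.vN, h.vB, h.vQ, h.vR, h.vD, h.vm]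

theorem Ready.tick {n k m : ℕ} {s : Store} (h : Ready n k m s) : Ready n k m s.tick :=
  h.congr rfl

/-! ### Rounds of the covering algorithm -/

section Cover

variable {W L n k m : ℕ} {s : Store}

theorem Prog.decr_spec (hW : Sizes W L n k) (hs : Ready n k m s)
    (hS : s.v rS = total (2 * n) (s.A aY)) :
    Wp W L Prog.decr (fun s' => (∀ v < 2 * n, s'.A aY v = s.A aY v - 1) ∧
      s'.v rS = total (2 * n) (s'.A aY) ∧ s'.clk ≤ s.clk + 20 * (2 * n) + 5) s := by
  obtain ⟨_, _, _, _, _⟩ := hW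
  refine wp_for (fun j s' => (∀ v < j, s'.A aY v = s.A aY v - 1) ∧
      (∀ v, j ≤ v → s'.A aY v = s.A aY v) ∧
      s'.v rS = total (2 * n) (s'.A aY) ∧ s'.clk ≤ s.clk + 20 * j + 2) hs.one ?_ (by decide) ?_ ?_ ?_
  · rw [hs.vN]; omega
  · simpa using hS
  · rintro j s' ⟨h1, h2, h3, h4⟩ hf hj hjN
    have hs' := hs.frame hf (by decide)
    have e1 := hs'.zero
    have e2 := hs'.one
    rw [hs.vN] at hjN
    have hle := apply_le_total hjN (s'.A aY)
    have hupd := total_update hjN (s'.A aY) (s'.A aY j - 1)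
    simp [Function.update_apply, hj, e1, e2]
    refine ⟨by omega, fun hpos => ⟨by omega, by omega, by omega, ?_, ?_, ?_, by omega⟩, ?_⟩
    · intro v hv
      by_cases hvj : v = j
      · subst hvj; simp [h2]
      · simp [hvj, h1 v (by omega)]
    · intro v hv
      rw [if_neg (by omega)]
      exact h2 v (by omega)
    · have := hupd
      unfold Function.update at this
      simp at this
      omega
    · intro h0
      refine ⟨?_, ?_, h3, by omega⟩
      · intro v hv
        by_cases hvj : v = j
        · subst hvj
          have := h2 v le_rfl
          omega
        · exact h1 v (by omega)
      · intro v hv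
        exact h2 v (by omega)
  · rintro s' ⟨h1, h2, h3, h4⟩ hf
    rw [hs.vN] at h1 h4
    refine ⟨h1, h3, ?_⟩
    simp; omega

/-- The effect of repairing one edge. -/
theorem Prog.reflect_spec (hW : Sizes W L n k) (hs : Ready n k m s)
    (hu : s.v ru < 2 * n) (hv : s.v rv < 2 * n) (huv : s.v ru ≠ s.v rv)
    (hQ : ∀ v < 2 * n, s.A aY v ≤ 16 * k) (hS : s.v rS = total (2 * n) (s.A aY)) :
    Wp W L Prog.reflect (fun s' => (∀ v < 2 * n, s'.A aY v ≤ 16 * k) ∧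
      (∀ v, s.A aY v ≤ s'.A aY v) ∧ 16 * k ≤ s'.A aY (s.v ru) + s'.A aY (s.v rv) ∧
      s'.v rS = total (2 * n) (s'.A aY) ∧
      (∀ z : ℕ → ℕ, 16 * k ≤ z (s.v ru) + z (s.v rv) →
        dist2 (2 * n) (s'.A aY) z ≤ dist2 (2 * n) (s.A aY) z) ∧
      s'.clk ≤ s.clk + 25) s := by
  obtain ⟨_, _, _, _, _⟩ := hW
  have e3 := hs.vQ
  have q1 := hQ _ hu
  have q2 := hQ _ hv
  set u := s.v ru with hud
  set v := s.v rv with hvd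
  simp [Prog.reflect, Function.update_apply, e3, ← hud, ← hvd]
  have htot := total_le hQ
  have hmul : 2 * n * (16 * k) = 32 * (n * k) := by ring
  refine ⟨by omega, by omega, by omega, fun hlt => ?_, fun hge => ?_⟩
  · have f1 : s.A aY u + (16 * k - (s.A aY u + s.A aY v)) = 16 * k - s.A aY v := by omega
    have f2 : s.A aY v + (16 * k - (s.A aY u + s.A aY v)) = 16 * k - s.A aY u := by omega
    rw [f1, f2]
    refine ⟨by omega, by omega, by omega, by omega, by omega, by omega, by omega, ?_, ?_, ?_, ?_,
      ?_⟩
    · intro w hw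
      have := hQ w hw
      split_ifs <;> omega
    · intro w
      split_ifs with h1 h2
      · subst h1; omega
      · subst h2; omega
      · omega
    · simp [huv]; omega
    · have a1 := total_update hu (s.A aY) (16 * k - s.A aY v)
      have a2 := total_update hv (Function.update (s.A aY) u (16 * k - s.A aY v))
        (16 * k - s.A aY u)
      rw [Function.update_of_ne huv.symm] at a2
      omega
    · intro z hz
      have := dist2_reflect hu hv huv (s.A aY) z hlt.le hz
      simpa [Function.update_apply] using this
  · exact ⟨hQ, hge, hS⟩

theorem Prog.scan_spec (hW : Sizes W L n k) (hs : Ready n k m s)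
    (hE : EdgesOk n m L (s.A aX) (s.A aU) (s.A aV))
    (hQ : ∀ v < 2 * n, s.A aY v ≤ 16 * k) (hS : s.v rS = total (2 * n) (s.A aY)) :
    Wp W L Prog.scan (fun s' => (∀ v < 2 * n, s'.A aY v ≤ 16 * k) ∧
      Covers (s.A aU) (s.A aV) m (16 * k) (s'.A aY) ∧
      s'.v rS = total (2 * n) (s'.A aY) ∧
      (∀ z : ℕ → ℕ, Covers (s.A aU) (s.A aV) m (16 * k) z →
        dist2 (2 * n) (s'.A aY) z ≤ dist2 (2 * n) (s.A aY) z) ∧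
      s'.clk ≤ s.clk + 40 * m + 5) s := by
  have hWW := hW
  obtain ⟨_, _, _, _, _⟩ := hW
  have hlt := hE.lt
  refine wp_for (fun j s' => (∀ v < 2 * n, s'.A aY v ≤ 16 * k) ∧
      (∀ i < j, 16 * k ≤ s'.A aY (s.A aU i) + s'.A aY (s.A aV i)) ∧
      s'.v rS = total (2 * n) (s'.A aY) ∧
      (∀ z : ℕ → ℕ, Covers (s.A aU) (s.A aV) m (16 * k) z →
        dist2 (2 * n) (s'.A aY) z ≤ dist2 (2 * n) (s.A aY) z) ∧
      s'.clk ≤ s.clk + 40 * j + 2) hs.one ?_ (by decide) ?_ ?_ ?_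
  · rw [hs.vm]; omega
  · simp; exact ⟨hQ, hS⟩
  · rintro j s' ⟨h1, h2, h3, h4, h5⟩ hf hj hjm
    rw [hs.vm] at hjm
    have hs' := hs.frame hf (by decide)
    have f1 : s'.A aU = s.A aU := hf.arr (by decide)
    have f2 : s'.A aV = s.A aV := hf.arr (by decide)
    have g1 := hE.u j hjm
    have g2 := hE.v j hjm
    simp only [getEdge, wp_seq, wp_read]
    simp only [Store.tick_v, Store.tick_A, Store.set_A, Store.set_v, hj, f1, f2]
    refine ⟨by omega, by simp [hj]; omega, ?_⟩
    refine (Prog.reflect_spec hWW (m := m) ((hs'.tick.set (by omega)).set (by omega)) ?_ ?_ ?_ ?_ ?_).mono ?_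
    · simpa [hj] using g1
    · simpa [hj] using g2
    · simpa [hj] using hE.ne j hjm
    · simpa using h1
    · simpa using h3
    · simp [hj]
      intro s'' i1 i2 i3 i4 i5 i6
      refine ⟨i1, ?_, i4, ?_, by omega⟩
      · intro i hi
        by_cases hij : i = j
        · subst hij; exact i3
        · have := h2 i (by omega)
          have a1 := i2 (s.A aU i)
          have a2 := i2 (s.A aV i)
          omega
      · intro z hz
        exact (i5 z (hz j hjm)).trans (h4 z hz)
  · rintro s' ⟨h1, h2, h3, h4, h5⟩ hf
    rw [hs.vm] at h2 h5
    refine ⟨h1, h2, h3, h4, ?_⟩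
    simp; omega

/-- The store `s'` arises from `s` by loading edge number `j` into the variables `ru`, `rv`. -/
structure Loaded (s s' : Store) (j : ℕ) : Prop where
  u : s'.v ru = s.A aU j
  v : s'.v rv = s.A aV j
  other : ∀ r, r ≠ ru → r ≠ rv → r ≠ rt₁ → s'.v r = s.v r
  arr : s'.A = s.A
  clk : s'.clk ≤ s.clk + 14

theorem Loaded.ready {s' : Store} {j : ℕ} (h : Loaded s s' j) (hs : Ready n k m s) :
    Ready n k m s' := by
  constructor <;> rw [h.other _ (by decide) (by decide) (by decide)]
  exacts [hs.zero, hs.one, hs.vn, hs.vk, hs.vN, hs.vB, hs.vQ, hs.vR, hs.vD, hs.vm]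

theorem Prog.wp_onEdge {c : Cmd} {Q : Store → Prop} {j : ℕ} (hW : Sizes W L n k)
    (hs : Ready n k m s) (hE : EdgesOk n m L (s.A aX) (s.A aU) (s.A aV)) (hj : s.v ri = j)
    (hjm : j < m)
    (halive : s.A aX (s.A aU j) = 0 → s.A aX (s.A aV j) = 0 → ∀ s', Loaded s s' j → Wp W L c Q s')
    (hdead : ¬ (s.A aX (s.A aU j) = 0 ∧ s.A aX (s.A aV j) = 0) → ∀ s', Loaded s s' j → Q s') :
    Wp W L (Prog.onEdge c) Q s := by
  have g1 := hE.u j hjm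
  have g2 := hE.v j hjm
  have hlt := hE.lt
  have hL := hW.index
  simp only [Prog.onEdge, Prog.getEdge, wp_seq, wp_read, wp_ifEq, wp_skip]
  simp [hj, hs.zero]
  refine ⟨by omega, by omega, fun h1 => ⟨by omega, fun h2 => ?_, fun h2 => ?_⟩,
    fun h1 => ?_⟩
  · refine halive h1 h2 _ ⟨by simp, by simp, fun r a b c => ?_, rfl, by simp⟩
    simp [a, b, c]
  · refine hdead (fun h => h2 h.2) _ ⟨by simp, by simp, fun r a b c => ?_, rfl, by simp⟩
    simp [a, b, c]
  · refine hdead (fun h => h1 h.1) _ ⟨by simp, by simp, fun r a b c => ?_, rfl, by simp⟩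
    simp [a, b, c]

end Cover

/-! ### The auction on the bipartite double cover -/

/-- One of the first `m` edges joins `u` and `v`, and neither of these vertices has been deleted. -/
def Joins (dd eu ev : ℕ → ℕ) (m u v : ℕ) : Prop :=
  ∃ i < m, dd (eu i) = 0 ∧ dd (ev i) = 0 ∧ ((eu i = u ∧ ev i = v) ∨ (eu i = v ∧ ev i = u))

theorem Joins.symm {dd eu ev : ℕ → ℕ} {m u v : ℕ} (h : Joins dd eu ev m u v) :
    Joins dd eu ev m v u := by
  obtain ⟨i, hi, h1, h2, h⟩ := h
  exact ⟨i, hi, h1, h2, h.symm⟩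

theorem Joins.mono {dd eu ev : ℕ → ℕ} {m m' u v : ℕ} (h : Joins dd eu ev m u v) (hm : m ≤ m') :
    Joins dd eu ev m' u v := by
  obtain ⟨i, hi, h⟩ := h
  exact ⟨i, by omega, h⟩

theorem joins_succ {dd eu ev : ℕ → ℕ} {m u v : ℕ} : Joins dd eu ev (m + 1) u v ↔
    Joins dd eu ev m u v ∨ (dd (eu m) = 0 ∧ dd (ev m) = 0 ∧
      ((eu m = u ∧ ev m = v) ∨ (eu m = v ∧ ev m = u))) := by
  constructor
  · rintro ⟨i, hi, h⟩
    rcases Nat.lt_succ_iff_lt_or_eq.1 hi with hi | rfl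
    · exact .inl ⟨i, hi, h⟩
    · exact .inr h
  · rintro (h | h)
    · exact h.mono (Nat.le_succ m)
    · exact ⟨m, Nat.lt_succ_self m, h⟩

theorem EdgesOk.joins_bip {n m L : ℕ} {dd eu ev : ℕ → ℕ} (h : EdgesOk n m L dd eu ev) :
    ∃ χ : ℕ → Bool, ∀ u v, Joins dd eu ev m u v → χ u ≠ χ v := by
  obtain ⟨χ, hχ⟩ := h.bip
  refine ⟨χ, ?_⟩
  rintro u v ⟨i, hi, h1, h2, ⟨rfl, rfl⟩ | ⟨rfl, rfl⟩⟩
  · exact hχ i hi h1 h2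
  · exact (hχ i hi h1 h2).symm

/-- The number of nonzero values among the first `N`. -/
def support (N : ℕ) (f : ℕ → ℕ) : ℕ := ((Finset.range N).filter fun v => f v ≠ 0).card

/-- The matching held by an auction with `N` bidders and `N` objects, and its prices. Bidder `u`
holds object `x` if `ob u = x + 1`, equivalently `ho x = u + 1`; free objects have price zero, and
held objects are cheapest for their holders up to one unit. -/
structure Auction (N B m : ℕ) (dd eu ev p ob ho : ℕ → ℕ) : Prop where
  ob_ok : ∀ u < N, ∀ x, ob u = x + 1 → x < N ∧ ho x = u + 1 ∧ Joins dd eu ev m u x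
  ho_ok : ∀ x < N, ∀ u, ho x = u + 1 → u < N ∧ ob u = x + 1
  free : ∀ x < N, ho x = 0 → p x = 0
  price : ∀ x < N, p x ≤ B
  happy : ∀ u < N, ∀ x v, ob u = x + 1 → Joins dd eu ev m u v → p x ≤ p v + 1

/-- `lv u` is the least price in the neighbourhood of `u`, or `B` if that is smaller. -/
structure Levels (N B m : ℕ) (dd eu ev p lv : ℕ → ℕ) : Prop where
  le : ∀ u < N, lv u ≤ B
  joins : ∀ u v, Joins dd eu ev m u v → lv u ≤ p v
  attained : ∀ u < N, lv u = B ∨ ∃ v, Joins dd eu ev m u v ∧ lv u = p v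

/-- The number of bidders that hold nothing although a neighbour has a price below `B`. -/
def unhappy (N B : ℕ) (ob lv : ℕ → ℕ) : ℕ :=
  ((Finset.range N).filter fun u => ob u = 0 ∧ lv u < B).card

/-- The state within a round of bidding, where the bids along `D` have been made. The set `Y`
consists of bidders that were unhappy at the beginning and have not got an object since then; each
of the others has raised a price. -/
structure Bidding (N B m c : ℕ) (dd eu ev lv : ℕ → ℕ) (D : ℕ → ℕ → Prop) (p ob ho : ℕ → ℕ) : Prop
    where
  auction : Auction N B m dd eu ev p ob ho
  joins : ∀ u v, Joins dd eu ev m u v → lv u ≤ p v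
  progress : ∃ Y : Finset ℕ, (∀ u ∈ Y, u < N ∧ ob u = 0 ∧ lv u < B ∧ ∀ v, D u v → lv u < p v) ∧
    c ≤ Y.card + total N p

/-- A bid that does not succeed. -/
theorem Bidding.skip {N B m c : ℕ} {dd eu ev lv p ob ho : ℕ → ℕ} {D : ℕ → ℕ → Prop} {u v : ℕ}
    (h : Bidding N B m c dd eu ev lv D p ob ho) (huv : Joins dd eu ev m u v)
    (hno : ob u = 0 → lv u < B → lv u ≠ p v) :
    Bidding N B m c dd eu ev lv (fun a b => D a b ∨ (a = u ∧ b = v)) p ob ho := by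
  obtain ⟨ha, hj, Y, hY, hc⟩ := h
  refine ⟨ha, hj, Y, fun a haY => ?_, hc⟩
  obtain ⟨h1, h2, h3, h4⟩ := hY a haY
  refine ⟨h1, h2, h3, ?_⟩
  rintro b (hD | ⟨rfl, rfl⟩)
  · exact h4 b hD
  · exact lt_of_le_of_ne (hj _ _ huv) (hno h2 h3)

/-- A bid that succeeds. -/
theorem Bidding.take {N B m c : ℕ} {dd eu ev lv p ob ho : ℕ → ℕ} {D : ℕ → ℕ → Prop} {u v : ℕ}
    (h : Bidding N B m c dd eu ev lv D p ob ho) (hu : u < N) (hv : v < N)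
    (huv : Joins dd eu ev m u v) (hob : ob u = 0) (hlt : lv u < B) (heq : lv u = p v) :
    Bidding N B m c dd eu ev lv (fun a b => D a b ∨ (a = u ∧ b = v))
      (Function.update p v (p v + 1))
      (Function.update (if ho v = 0 then ob else Function.update ob (ho v - 1) 0) u (v + 1))
      (Function.update ho v (u + 1)) := by
  obtain ⟨ha, hj, Y, hY, hc⟩ := h
  obtain ⟨a1, a2, a3, a4, a5⟩ := ha
  have hple : ∀ x, p x ≤ Function.update p v (p v + 1) x := by
    intro x
    rw [Function.update_apply]
    split_ifs with h
    · subst h; omega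
    · exact le_rfl
  -- the bidders other than `u` hold what they held, except that nobody else holds `v`
  have hob' : ∀ a, a ≠ u → ∀ x,
      (if ho v = 0 then ob else Function.update ob (ho v - 1) 0) a = x + 1 → a < N →
        x ≠ v ∧ ob a = x + 1 := by
    intro a hau x hx haN
    split_ifs at hx with h0
    · refine ⟨?_, hx⟩
      rintro rfl
      have := (a1 a haN _ hx).2.1
      omega
    · rw [Function.update_apply] at hx
      split_ifs at hx with h1
      refine ⟨?_, hx⟩
      rintro rfl
      have := (a1 a haN _ hx).2.1
      omega
  refine ⟨⟨?_, ?_, ?_, ?_, ?_⟩, fun a b hab => (hj a b hab).trans (hple b), ?_⟩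
  · intro a haN x hx
    by_cases hau : a = u
    · subst hau
      rw [Function.update_self] at hx
      obtain rfl : x = v := by omega
      exact ⟨hv, by simp, huv⟩
    · rw [Function.update_of_ne hau] at hx
      obtain ⟨hxv, hx⟩ := hob' a hau x hx haN
      rw [Function.update_of_ne hxv]
      exact a1 a haN x hx
  · intro x hxN a hx
    by_cases hxv : x = v
    · subst hxv
      rw [Function.update_self] at hx
      obtain rfl : a = u := by omega
      exact ⟨hu, by simp⟩
    · rw [Function.update_of_ne hxv] at hx
      obtain ⟨b1, b2⟩ := a2 x hxN a hx
      have hau : a ≠ u := by rintro rfl; omega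
      refine ⟨b1, ?_⟩
      rw [Function.update_of_ne hau]
      split_ifs with h0
      · exact b2
      · rw [Function.update_of_ne, b2]
        intro e
        have := (a2 v hv a (by omega)).2
        omega
  · intro x hxN hx
    by_cases hxv : x = v
    · subst hxv; simp at hx
    · rw [Function.update_of_ne hxv] at hx ⊢
      exact a3 x hxN hx
  · intro x hxN
    by_cases hxv : x = v
    · subst hxv; rw [Function.update_self]; omega
    · rw [Function.update_of_ne hxv]
      exact a4 x hxN
  · intro a haN x b hx hab
    refine le_trans ?_ (Nat.add_le_add_right (hple b) 1)
    by_cases hau : a = u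
    · subst hau
      rw [Function.update_self] at hx
      obtain rfl : x = v := by omega
      rw [Function.update_self, ← heq]
      exact Nat.add_le_add_right (hj _ _ hab) 1
    · rw [Function.update_of_ne hau] at hx
      obtain ⟨hxv, hx⟩ := hob' a hau x hx haN
      rw [Function.update_of_ne hxv]
      exact a5 a haN x b hx hab
  · refine ⟨Y.erase u, fun a haY => ?_, ?_⟩
    · obtain ⟨hau, haY⟩ := Finset.mem_erase.1 haY
      obtain ⟨h1, h2, h3, h4⟩ := hY a haY
      refine ⟨h1, ?_, h3, ?_⟩
      · rw [Function.update_of_ne hau]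
        split_ifs
        · exact h2
        · rw [Function.update_apply, h2, ite_self]
      · rintro b (hD | ⟨rfl, rfl⟩)
        · exact (h4 b hD).trans_le (hple b)
        · exact absurd rfl hau
    · have := total_update hv p (p v + 1)
      have := Finset.pred_card_le_card_erase (s := Y) (a := u)
      omega

/-- A round of bidding raises the sum of prices and levels by the number of unhappy bidders. -/
theorem Bidding.total_le {N B m c : ℕ} {dd eu ev lv lv' p ob ho : ℕ → ℕ}
    (h : Bidding N B m c dd eu ev lv (Joins dd eu ev m) p ob ho) (hlv : ∀ u < N, lv u ≤ B)
    (h' : Levels N B m dd eu ev p lv') : c + total N lv ≤ total N p + total N lv' := by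
  obtain ⟨-, hj, Y, hY, hc⟩ := h
  have hle : ∀ u < N, lv u ≤ lv' u := by
    intro u hu
    rcases h'.attained u hu with e | ⟨v, huv, e⟩
    · rw [e]; exact hlv u hu
    · rw [e]; exact hj u v huv
  have hlt : ∀ u ∈ Y, lv u < lv' u := by
    intro u hu
    obtain ⟨h1, h2, h3, h4⟩ := hY u hu
    rcases h'.attained u h1 with e | ⟨v, huv, e⟩
    · rw [e]; exact h3
    · rw [e]; exact h4 v huv
  have hsub : Y ⊆ Finset.range N := fun u hu => Finset.mem_range.2 (hY u hu).1
  have key : total N lv + Y.card ≤ total N lv' := by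
    have e : Y.card = ∑ u ∈ Finset.range N, if u ∈ Y then 1 else 0 := by
      rw [Finset.sum_ite_mem, Finset.inter_eq_right.2 hsub, Finset.card_eq_sum_ones]
    rw [e, total, total, ← Finset.sum_add_distrib]
    refine Finset.sum_le_sum fun u hu => ?_
    split_ifs with hY'
    · exact hlt u hY'
    · exact hle u (Finset.mem_range.1 hu)
  omega

/-- The prices and levels of an auction yield a cover whose size is close to that of the
matching. -/
theorem Auction.exists_cover {N B m : ℕ} {dd eu ev p ob ho lv : ℕ → ℕ}
    (h : Auction N B m dd eu ev p ob ho) (hl : Levels N B m dd eu ev p lv) :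
    ∃ z : ℕ → ℕ, (∀ v < N, z v ≤ 2 * B) ∧ Covers eu ev m (2 * B) z ∧
      total N z ≤ support N ob * (B + 1) + unhappy N B ob lv * B + support N dd * (2 * B) := by
  refine ⟨fun v => if dd v ≠ 0 then 2 * B else (B - lv v) + p v, ?_, ?_, ?_⟩
  · intro v hv
    have := h.price v hv
    simp only
    split_ifs <;> omega
  · intro i hi
    by_cases h1 : dd (eu i) = 0
    · by_cases h2 : dd (ev i) = 0
      · have j1 : Joins dd eu ev m (eu i) (ev i) := ⟨i, hi, h1, h2, .inl ⟨rfl, rfl⟩⟩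
        have h3 := hl.joins _ _ j1
        have h4 := hl.joins _ _ j1.symm
        simp only [h1, h2, ne_eq, not_true_eq_false, if_false]
        omega
      · simp [h2]
    · simp [h1]
  · have hsum : ∑ x ∈ Finset.range N, p x =
        ∑ u ∈ Finset.range N, if ob u ≠ 0 then p (ob u - 1) else 0 := by
      rw [← Finset.sum_filter]
      have e : ∑ x ∈ Finset.range N, p x =
          ∑ x ∈ (Finset.range N).filter (fun x => ho x ≠ 0), p x := by
        rw [Finset.sum_filter]
        refine Finset.sum_congr rfl fun x hx => ?_
        split_ifs with h0
        · rfl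
        · exact h.free x (Finset.mem_range.1 hx) (not_not.1 h0)
      rw [e]
      refine Finset.sum_nbij' (fun x => ho x - 1) (fun u => ob u - 1) ?_ ?_ ?_ ?_ ?_
      · intro x hx
        obtain ⟨h1, h2⟩ := Finset.mem_filter.1 hx
        have := h.ho_ok x (Finset.mem_range.1 h1) (ho x - 1) (by omega)
        simp [this.1, this.2]
      · intro u hu
        obtain ⟨h1, h2⟩ := Finset.mem_filter.1 hu
        have := h.ob_ok u (Finset.mem_range.1 h1) (ob u - 1) (by omega)
        simp [this.1, this.2.1]
      · intro x hx
        obtain ⟨h1, h2⟩ := Finset.mem_filter.1 hx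
        have := h.ho_ok x (Finset.mem_range.1 h1) (ho x - 1) (by omega)
        simp [this.2]
      · intro u hu
        obtain ⟨h1, h2⟩ := Finset.mem_filter.1 hu
        have := h.ob_ok u (Finset.mem_range.1 h1) (ob u - 1) (by omega)
        simp [this.2.1]
      · intro x hx
        obtain ⟨h1, h2⟩ := Finset.mem_filter.1 hx
        have := h.ho_ok x (Finset.mem_range.1 h1) (ho x - 1) (by omega)
        simp [this.2]
    have hdead : total N (fun v => if dd v ≠ 0 then 2 * B else (B - lv v) + p v) ≤
        ∑ v ∈ Finset.range N, ((B - lv v) + p v) + support N dd * (2 * B) := by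
      rw [total, support, Finset.card_filter, Finset.sum_mul, ← Finset.sum_add_distrib]
      refine Finset.sum_le_sum fun v _ => ?_
      split_ifs <;> omega
    refine hdead.trans (Nat.add_le_add_right ?_ _)
    rw [Finset.sum_add_distrib, hsum, ← Finset.sum_add_distrib, support, unhappy,
      Finset.card_filter, Finset.card_filter, Finset.sum_mul, Finset.sum_mul,
      ← Finset.sum_add_distrib]
    refine Finset.sum_le_sum fun u hu => ?_
    have huN := Finset.mem_range.1 hu
    have hle := hl.le u huN
    by_cases h0 : ob u = 0
    · by_cases h1 : lv u < B
      · simp [h0, h1]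
      · simp [h0, h1]
        omega
    · have e : ob u = (ob u - 1) + 1 := by omega
      obtain ⟨h1, h2, h3⟩ := h.ob_ok u huN _ e
      have hp : p (ob u - 1) ≤ lv u + 1 := by
        rcases hl.attained u huN with e' | ⟨v, hv, e'⟩
        · have := h.price _ h1
          omega
        · rw [e']
          exact h.happy u huN _ v e hv
      simp [h0]
      omega

section Specs

variable {W L n k m : ℕ} {s : Store}

theorem Prog.lower_spec {a b : ℕ} (ha : a < 21) (hb : b < 21) (hua : s.v a < L) (hub : s.v b < L) :
    Wp W L (Prog.lower a b) (fun s' =>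
      s'.A aL = Function.update (s.A aL) (s.v a) (min (s.A aL (s.v a)) (s.A aP (s.v b))) ∧
      s'.clk ≤ s.clk + 9) s := by
  have h1 : a ≠ 21 := by omega
  have h2 : a ≠ 22 := by omega
  have h3 : b ≠ 21 := by omega
  simp [Prog.lower, h1, h2, h3, hua, hub]
  exact fun hlt => by rw [min_eq_right hlt.le]

/-- Lowering the level of `u` to the price of its neighbour `v`. -/
theorem Levels.lower {N B : ℕ} {dd eu ev p lv : ℕ → ℕ} {j : ℕ} {D : ℕ → ℕ → Prop} {u v : ℕ}
    (huv : Joins dd eu ev j u v)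
    (hle : ∀ u < N, lv u ≤ B) (hD : ∀ a b, D a b → lv a ≤ p b)
    (hat : ∀ u < N, lv u = B ∨ ∃ v, Joins dd eu ev j u v ∧ lv u = p v) :
    (∀ a < N, Function.update lv u (min (lv u) (p v)) a ≤ B) ∧
    (∀ a b, (D a b ∨ (a = u ∧ b = v)) → Function.update lv u (min (lv u) (p v)) a ≤ p b) ∧
    ∀ a < N, Function.update lv u (min (lv u) (p v)) a = B ∨
      ∃ b, Joins dd eu ev j a b ∧ Function.update lv u (min (lv u) (p v)) a = p b := by
  have hle' : ∀ a, Function.update lv u (min (lv u) (p v)) a ≤ lv a := by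
    intro a
    by_cases h : a = u
    · subst h; simp
    · rw [Function.update_of_ne h]
  refine ⟨fun a ha => (hle' a).trans (hle a ha), ?_, ?_⟩
  · rintro a b (h | ⟨rfl, rfl⟩)
    · exact (hle' a).trans (hD a b h)
    · simp
  · intro a ha
    by_cases h : a = u
    · subst h
      rw [Function.update_self]
      rcases le_total (lv a) (p v) with h' | h'
      · rw [min_eq_left h']; exact hat a ha
      · rw [min_eq_right h']; exact .inr ⟨v, huv, rfl⟩
    · rw [Function.update_of_ne h]; exact hat a ha

theorem Prog.levels_spec (hW : Sizes W L n k) (hs : Ready n k m s)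
    (hE : EdgesOk n m L (s.A aX) (s.A aU) (s.A aV)) :
    Wp W L Prog.levels (fun s' => Levels (2 * n) (8 * k) m (s.A aX) (s.A aU) (s.A aV) (s.A aP) (s'.A aL) ∧
      s'.clk ≤ s.clk + 50 * (2 * n + m) + 10) s := by
  have hWW := hW
  obtain ⟨_, _, _, _, _⟩ := hW
  have hlt := hE.lt
  rw [Prog.levels, wp_seq]
  refine wp_for (fun j s' => (∀ v < j, s'.A aL v = 8 * k) ∧ s'.clk ≤ s.clk + 20 * j + 2) hs.one ?_
    (by decide) ?_ ?_ ?_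
  · rw [hs.vN]; omega
  · simp
  · rintro j s' ⟨h1, h2⟩ hf hj hjN
    have hs' := hs.frame hf (by decide)
    rw [hs.vN] at hjN
    simp [hj, hs'.vB]
    refine ⟨by omega, ?_, by omega⟩
    intro v hv
    by_cases hvj : v = j
    · simp [hvj]
    · rw [Function.update_of_ne hvj]
      exact h1 v (by omega)
  · rintro s₁ ⟨h1, h2⟩ hf₁
    rw [hs.vN] at h1 h2
    have hs₁ := hs.frame hf₁ (by decide)
    refine wp_for (fun j s' => Levels (2 * n) (8 * k) j (s.A aX) (s.A aU) (s.A aV) (s.A aP) (s'.A aL) ∧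
      s'.clk ≤ s₁.clk + 5 + 50 * j) (by simpa using hs₁.one) ?_ (by decide) ?_ ?_ ?_
    · simp [hs₁.vm]; omega
    · refine ⟨⟨?_, ?_, ?_⟩, by simp⟩
      · intro u hu; simp [h1 u hu]
      · rintro u v ⟨i, hi, -⟩; omega
      · intro u hu; simp [h1 u hu]
    · rintro j s' ⟨h3, h4⟩ hf hj hjm
      rw [Store.tick_v, hs₁.vm] at hjm
      have hs' : Ready n k m s' := Ready.frame (s := s₁) hs₁
        (c := .for ri rm rO (onEdge (lower ru rv ;; lower rv ru))) ⟨hf.1, hf.2⟩ (by decide)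
      have f1 : s'.A aU = s.A aU := (hf.arr (by decide)).trans (hf₁.arr (by decide))
      have f2 : s'.A aV = s.A aV := (hf.arr (by decide)).trans (hf₁.arr (by decide))
      have f3 : s'.A aP = s.A aP := (hf.arr (by decide)).trans (hf₁.arr (by decide))
      have f4 : s'.A aX = s.A aX := (hf.arr (by decide)).trans (hf₁.arr (by decide))
      have g1 := hE.u j hjm
      have g2 := hE.v j hjm
      refine wp_onEdge hWW hs'.tick (by simpa [f1, f2, f4] using hE) (by simpa using hj) hjm
        (fun d1 d2 s₀ hL => ?_) (fun hd s₀ hL => ?_)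
      · have hLu : s₀.v ru = s.A aU j := by rw [hL.u]; simp [f1]
        have hLv : s₀.v rv = s.A aV j := by rw [hL.v]; simp [f2]
        have hLA : s₀.A = s'.A := hL.arr
        have hLc : s₀.clk ≤ s'.clk + 3 + 14 := hL.clk
        simp [f1, f2, f4] at d1 d2
        rw [wp_seq]
        refine (Prog.lower_spec (by omega) (by omega) (by omega) (by omega)).conseq ?_
        rintro s₂ ⟨l1, l2⟩ hf₂
        have e1 : s₂.v ru = s.A aU j := by rw [hf₂.v (by decide)]; exact hLu
        have e2 : s₂.v rv = s.A aV j := by rw [hf₂.v (by decide)]; exact hLv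
        have e3 : s₂.A aP = s.A aP := by rw [hf₂.arr (by decide), hLA]; exact f3
        refine (Prog.lower_spec (by omega) (by omega) (by omega) (by omega)).mono ?_
        rintro s₃ ⟨l3, l4⟩
        rw [hLu, hLv, hLA, f3] at l1
        rw [e1, e2, e3, l1] at l3
        have j1 : Joins (s.A aX) (s.A aU) (s.A aV) (j + 1) (s.A aU j) (s.A aV j) :=
          ⟨j, by omega, d1, d2, .inl ⟨rfl, rfl⟩⟩
        obtain ⟨b1, b2, b3⟩ := Levels.lower (D := Joins (s.A aX) (s.A aU) (s.A aV) j) j1 h3.le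
          h3.joins
          (fun u hu => (h3.attained u hu).imp_right fun ⟨v, hv, e⟩ => ⟨v, hv.mono (by omega), e⟩)
        obtain ⟨b4, b5, b6⟩ := Levels.lower j1.symm b1 b2 b3
        rw [← l3] at b4 b5 b6
        refine ⟨⟨b4, fun a b hab => b5 a b ?_, b6⟩, by simp; omega⟩
        rcases joins_succ.1 hab with h | ⟨-, -, ⟨h, h'⟩ | ⟨h, h'⟩⟩
        · exact .inl (.inl h)
        · exact .inl (.inr ⟨h.symm, h'.symm⟩)
        · exact .inr ⟨h'.symm, h.symm⟩
      · have hLA : s₀.A = s'.A := hL.arr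
        have hLc : s₀.clk ≤ s'.clk + 3 + 14 := hL.clk
        simp only [Store.tick_A, f1, f2, f4] at hd
        refine ⟨⟨?_, ?_, ?_⟩, by simp; omega⟩
        · simpa [hLA] using h3.le
        · intro u v huv
          simp only [Store.set_A, hLA]
          exact h3.joins u v ((joins_succ.1 huv).resolve_right fun h => hd ⟨h.1, h.2.1⟩)
        · intro u hu
          simp only [Store.set_A, hLA]
          exact (h3.attained u hu).imp_right fun ⟨v, hv, e⟩ => ⟨v, hv.mono (by omega), e⟩
    · rintro s' ⟨h3, h4⟩ hf
      rw [Store.tick_v, hs₁.vm] at h3 h4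
      refine ⟨h3, ?_⟩
      simp; omega

theorem Prog.count_spec (hW : Sizes W L n k) (hs : Ready n k m s) :
    Wp W L Prog.count (fun s' => s'.v rb = unhappy (2 * n) (8 * k) (s.A aO) (s.A aL) ∧
      s'.clk ≤ s.clk + 20 * (2 * n) + 10) s := by
  obtain ⟨_, _, _, _, _⟩ := hW
  rw [Prog.count, wp_seq, wp_move]
  have hs₀ : Ready n k m (s.set rb (s.v rZ)) := hs.set (by omega)
  refine wp_for (fun j s' => s'.v rb = unhappy j (8 * k) (s.A aO) (s.A aL) ∧
    s'.clk ≤ s.clk + 4 + 20 * j) hs₀.one ?_ (by decide) ?_ ?_ ?_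
  · rw [hs₀.vN]; omega
  · simp [unhappy, hs.zero]
  · rintro j s' ⟨h1, h2⟩ hf hj hjN
    rw [hs₀.vN] at hjN
    have hs' := hs₀.frame hf (by decide)
    have f1 : s'.A aO = s.A aO := hf.arr (by decide)
    have f2 : s'.A aL = s.A aL := hf.arr (by decide)
    have hub : unhappy j (8 * k) (s.A aO) (s.A aL) ≤ j := by
      have := Finset.card_filter_le (Finset.range j) (fun u => s.A aO u = 0 ∧ s.A aL u < 8 * k)
      simpa [unhappy] using this
    have hsucc : unhappy (j + 1) (8 * k) (s.A aO) (s.A aL) =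
        unhappy j (8 * k) (s.A aO) (s.A aL) + if s.A aO j = 0 ∧ s.A aL j < 8 * k then 1 else 0 := by
      unfold unhappy
      rw [Finset.range_add_one, Finset.filter_insert]
      split_ifs
      · rw [Finset.card_insert_of_notMem (by simp)]
      · rfl
    simp [hj, f1, f2, hs'.zero, hs'.one, hs'.vB, h1, hsucc]
    refine ⟨by omega, fun h0 => ⟨by omega, fun h3 => ⟨by omega, by simp [h0, h3], by omega⟩,
      fun h3 => ⟨by omega, by omega⟩⟩, fun h0 => ⟨fun h => absurd h h0, by omega⟩⟩
  · rintro s' ⟨h1, h2⟩ hf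
    rw [hs₀.vN] at h1 h2
    refine ⟨h1, ?_⟩
    simp; omega

/-- The effect of one bid. -/
theorem Prog.bid_spec (hW : Sizes W L n k) (hs : Ready n k m s) {a b c : ℕ} (ha : a < 21)
    (hb : b < 21) {D : ℕ → ℕ → Prop} {dd eu ev : ℕ → ℕ} (hua : s.v a < 2 * n) (hub : s.v b < 2 * n)
    (hj : Joins dd eu ev m (s.v a) (s.v b))
    (h : Bidding (2 * n) (8 * k) m c dd eu ev (s.A aL) D (s.A aP) (s.A aO) (s.A aH)) :
    Wp W L (Prog.bid a b) (fun s' =>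
      Bidding (2 * n) (8 * k) m c dd eu ev (s.A aL) (fun x y => D x y ∨ (x = s.v a ∧ y = s.v b))
        (s'.A aP) (s'.A aO) (s'.A aH) ∧ s'.clk ≤ s.clk + 45) s := by
  obtain ⟨_, _, _, _, _⟩ := hW
  have a1 : a ≠ 21 := by omega
  have a2 : a ≠ 22 := by omega
  have a3 : a ≠ 23 := by omega
  have b1 : b ≠ 21 := by omega
  have b2 : b ≠ 22 := by omega
  have b3 : b ≠ 23 := by omega
  simp [Prog.bid, a1, a2, a3, b1, b2, b3, hs.zero, hs.one, hs.vB]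
  refine ⟨by omega, fun h0 => ⟨by omega, fun h1 => ⟨by omega, fun h2 => ⟨by omega, ?_, ?_⟩, ?_⟩, ?_⟩,
    ?_⟩
  · intro h3
    obtain ⟨c1, c2⟩ := h.auction.ho_ok _ hub (s.A aH (s.v b) - 1) (by omega)
    refine ⟨by omega, by omega, by omega, by omega, by omega, by omega, by omega, by omega, ?_⟩
    have key := h.take hua hub hj h0 h1 h2
    rwa [if_neg (by omega)] at key
  · intro h3
    refine ⟨by omega, by omega, by omega, by omega, by omega, by omega, ?_⟩
    have key := h.take hua hub hj h0 h1 h2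
    rwa [if_pos h3] at key
  · intro h2
    exact h.skip hj fun _ _ => h2
  · intro h2
    exact h.skip hj fun _ h3 => absurd h3 (by omega)
  · intro h2
    exact h.skip hj fun h3 => absurd h3 h2

theorem Prog.bids_spec (hW : Sizes W L n k) (hs : Ready n k m s)
    (hE : EdgesOk n m L (s.A aX) (s.A aU) (s.A aV))
    (hA : Auction (2 * n) (8 * k) m (s.A aX) (s.A aU) (s.A aV) (s.A aP) (s.A aO) (s.A aH))
    (hl : Levels (2 * n) (8 * k) m (s.A aX) (s.A aU) (s.A aV) (s.A aP) (s.A aL)) :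
    Wp W L Prog.bids (fun s' =>
      Bidding (2 * n) (8 * k) m
        (unhappy (2 * n) (8 * k) (s.A aO) (s.A aL) + total (2 * n) (s.A aP))
        (s.A aX) (s.A aU) (s.A aV) (s.A aL) (Joins (s.A aX) (s.A aU) (s.A aV) m) (s'.A aP) (s'.A aO) (s'.A aH) ∧
      s'.clk ≤ s.clk + 120 * m + 5) s := by
  have hWW := hW
  obtain ⟨_, _, _, _, _⟩ := hW
  have hlt := hE.lt
  refine wp_for (fun j s' => Bidding (2 * n) (8 * k) m
        (unhappy (2 * n) (8 * k) (s.A aO) (s.A aL) + total (2 * n) (s.A aP))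
        (s.A aX) (s.A aU) (s.A aV) (s.A aL) (Joins (s.A aX) (s.A aU) (s.A aV) j) (s'.A aP) (s'.A aO) (s'.A aH) ∧
      s'.clk ≤ s.clk + 120 * j + 2) hs.one ?_ (by decide) ?_ ?_ ?_
  · rw [hs.vm]; omega
  · refine ⟨⟨hA, hl.joins, (Finset.range (2 * n)).filter
      (fun u => s.A aO u = 0 ∧ s.A aL u < 8 * k), fun u hu => ?_, le_rfl⟩, by simp⟩
    obtain ⟨h1, h2, h3⟩ := Finset.mem_filter.1 hu
    refine ⟨Finset.mem_range.1 h1, h2, h3, ?_⟩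
    rintro v ⟨i, hi, -⟩
    omega
  · rintro j s' ⟨h1, h2⟩ hf hj hjm
    rw [hs.vm] at hjm
    have hs' := hs.frame hf (by decide)
    have f1 : s'.A aU = s.A aU := hf.arr (by decide)
    have f2 : s'.A aV = s.A aV := hf.arr (by decide)
    have f3 : s'.A aL = s.A aL := hf.arr (by decide)
    have f4 : s'.A aX = s.A aX := hf.arr (by decide)
    have g1 := hE.u j hjm
    have g2 := hE.v j hjm
    refine wp_onEdge hWW hs'.tick (by simpa [f1, f2, f4] using hE) (by simpa using hj) hjm
      (fun d1 d2 s₁ hL => ?_) (fun hd s₁ hL => ?_)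
    · have hLu : s₁.v ru = s.A aU j := by rw [hL.u]; simp [f1]
      have hLv : s₁.v rv = s.A aV j := by rw [hL.v]; simp [f2]
      have hLA : s₁.A = s'.A := hL.arr
      have hLc : s₁.clk ≤ s'.clk + 3 + 14 := hL.clk
      have hs₁ := hL.ready hs'.tick
      simp [f1, f2, f4] at d1 d2
      have j1 : Joins (s.A aX) (s.A aU) (s.A aV) m (s.A aU j) (s.A aV j) :=
        ⟨j, hjm, d1, d2, .inl ⟨rfl, rfl⟩⟩
      rw [wp_seq]
      refine (Prog.bid_spec (dd := s.A aX) (eu := s.A aU) (ev := s.A aV) hWW hs₁ (by omega)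
        (by omega) (D := Joins (s.A aX) (s.A aU) (s.A aV) j)
        (c := unhappy (2 * n) (8 * k) (s.A aO) (s.A aL) + total (2 * n) (s.A aP))
        (by rw [hLu]; exact g1) (by rw [hLv]; exact g2) (by rw [hLu, hLv]; exact j1)
        (by rw [hLA, f3]; exact h1)).conseq ?_
      rintro s₂ ⟨l1, l2⟩ hf₂
      have e1 : s₂.v ru = s.A aU j := by rw [hf₂.v (by decide)]; exact hLu
      have e2 : s₂.v rv = s.A aV j := by rw [hf₂.v (by decide)]; exact hLv
      have e3 : s₂.A aL = s.A aL := by rw [hf₂.arr (by decide), hLA]; exact f3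
      rw [hLu, hLv, hLA, f3] at l1
      refine (Prog.bid_spec (dd := s.A aX) (eu := s.A aU) (ev := s.A aV) hWW
        (hs₁.frame hf₂ (by decide)) (by omega) (by omega)
        (c := unhappy (2 * n) (8 * k) (s.A aO) (s.A aL) + total (2 * n) (s.A aP))
        (by rw [e2]; exact g2) (by rw [e1]; exact g1)
        (by rw [e1, e2]; exact j1.symm) (by rw [e3]; exact l1)).mono ?_
      rintro s₃ ⟨l3, l4⟩
      rw [e1, e2, e3] at l3
      refine ⟨?_, by simp; omega⟩
      obtain ⟨b1, b2, Y, hY, hc⟩ := l3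
      refine ⟨b1, b2, Y, fun u hu => ?_, hc⟩
      obtain ⟨y1, y2, y3, y4⟩ := hY u hu
      refine ⟨y1, y2, y3, fun v hv => y4 v ?_⟩
      rcases joins_succ.1 hv with h | ⟨-, -, ⟨h, h'⟩ | ⟨h, h'⟩⟩
      · exact .inl (.inl h)
      · exact .inl (.inr ⟨h.symm, h'.symm⟩)
      · exact .inr ⟨h'.symm, h.symm⟩
    · have hLA : s₁.A = s'.A := hL.arr
      have hLc : s₁.clk ≤ s'.clk + 3 + 14 := hL.clk
      simp only [Store.tick_A, f1, f2, f4] at hd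
      obtain ⟨b1, b2, Y, hY, hc⟩ := h1
      refine ⟨⟨?_, ?_, Y, ?_, ?_⟩, by simp; omega⟩
      · simpa [hLA] using b1
      · simpa [hLA] using b2
      · intro u hu
        obtain ⟨y1, y2, y3, y4⟩ := hY u hu
        simp only [Store.set_A, hLA]
        exact ⟨y1, y2, y3, fun v hv =>
          y4 v ((joins_succ.1 hv).resolve_right fun h => hd ⟨h.1, h.2.1⟩)⟩
      · simpa [hLA] using hc
  · rintro s' ⟨h3, h4⟩ hf
    rw [hs.vm] at h3 h4
    refine ⟨h3, ?_⟩
    simp; omega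

/-- The auction ends with few unhappy bidders. Each round raises the sum of prices and levels,
which is at most `32 * (n * k)`, by more than `n / k`. -/
theorem Prog.auction_spec (hW : Sizes W L n k) (hs : Ready n k m s)
    (hE : EdgesOk n m L (s.A aX) (s.A aU) (s.A aV)) :
    Wp W L Prog.auction (fun s' =>
      Auction (2 * n) (8 * k) m (s.A aX) (s.A aU) (s.A aV) (s'.A aP) (s'.A aO) (s'.A aH) ∧
      (∃ z : ℕ → ℕ, (∀ v < 2 * n, z v ≤ 16 * k) ∧ Covers (s.A aU) (s.A aV) m (16 * k) z ∧
        total (2 * n) z ≤ support (2 * n) (s'.A aO) * (8 * k) + 10 * n +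
          support (2 * n) (s.A aX) * (16 * k)) ∧
      s'.clk ≤ s.clk + 300 * (2 * n + m) * (32 * (k * k) + 1)) s := by
  have hWW := hW
  obtain ⟨hn, hk, _, _, hbig⟩ := hW
  have hlt := hE.lt
  have unhappy_le : ∀ ob lv, unhappy (2 * n) (8 * k) ob lv ≤ 2 * n := by
    intro ob lv
    have := Finset.card_filter_le (Finset.range (2 * n)) (fun u => ob u = 0 ∧ lv u < 8 * k)
    simpa [unhappy] using this
  have hmulk : ∀ b, b ≤ 2 * n → b * k < W := by
    intro b hb
    have := Nat.mul_le_mul_right k hb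
    rw [mul_assoc] at this
    omega
  rw [Prog.auction, wp_seq]
  refine wp_for (fun j s' => (∀ v < j, s'.A aP v = 0 ∧ s'.A aO v = 0 ∧ s'.A aH v = 0) ∧
    s'.clk ≤ s.clk + 20 * j + 2) hs.one ?_ (by decide) ?_ ?_ ?_
  · rw [hs.vN]; omega
  · simp
  · rintro j s' ⟨h1, h2⟩ hf hj hjN
    have hs' := hs.frame hf (by decide)
    rw [hs.vN] at hjN
    simp [hj, hs'.zero, Function.update_apply]
    refine ⟨by omega, fun v hv => ?_, by omega⟩
    by_cases hvj : v = j
    · simp [hvj]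
    · have := h1 v (by omega)
      simpa [hvj] using this
  rintro s₁ ⟨h1, h2⟩ hf₁
  rw [hs.vN] at h1 h2
  have hs₁ : Ready n k m s₁.tick := (hs.frame hf₁ (by decide)).tick
  have u1 : s₁.tick.A aU = s.A aU := hf₁.arr (by decide)
  have v1 : s₁.tick.A aV = s.A aV := hf₁.arr (by decide)
  have x1 : s₁.tick.A aX = s.A aX := hf₁.arr (by decide)
  have hA₁ : Auction (2 * n) (8 * k) m (s.A aX) (s.A aU) (s.A aV) (s₁.A aP) (s₁.A aO) (s₁.A aH) := by
    refine ⟨?_, ?_, ?_, ?_, ?_⟩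
    · intro u hu x hx
      have := (h1 u hu).2.1
      omega
    · intro x hx u hu
      have := (h1 x hx).2.2
      omega
    · intro x hx _
      exact (h1 x hx).1
    · intro x hx
      have := (h1 x hx).1
      omega
    · intro u hu x v hx
      have := (h1 u hu).2.1
      omega
  rw [wp_seq]
  refine (Prog.levels_spec hWW hs₁ (by rw [x1, u1, v1]; exact hE)).conseq ?_
  rintro s₂ ⟨l2, c2⟩ hf₂
  have hs₂ := hs₁.frame hf₂ (by decide)
  rw [wp_seq]
  refine (Prog.count_spec hWW hs₂).conseq ?_
  rintro s₃ ⟨b3, c3⟩ hf₃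
  have hs₃ := hs₂.frame hf₃ (by decide)
  rw [wp_seq, wp_mul]
  refine ⟨by rw [b3, hs₃.vk]; exact hmulk _ (unhappy_le _ _), ?_⟩
  have p3 : s₃.A aP = s₁.A aP := (hf₃.arr (by decide)).trans (hf₂.arr (by decide))
  have o3 : s₃.A aO = s₁.A aO := (hf₃.arr (by decide)).trans (hf₂.arr (by decide))
  have h3 : s₃.A aH = s₁.A aH := (hf₃.arr (by decide)).trans (hf₂.arr (by decide))
  have l3 : s₃.A aL = s₂.A aL := hf₃.arr (by decide)
  have u3 : s₃.A aU = s.A aU := (hf₃.arr (by decide)).trans ((hf₂.arr (by decide)).trans u1)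
  have v3 : s₃.A aV = s.A aV := (hf₃.arr (by decide)).trans ((hf₂.arr (by decide)).trans v1)
  have x3 : s₃.A aX = s.A aX := (hf₃.arr (by decide)).trans ((hf₂.arr (by decide)).trans x1)
  set s₄ := s₃.set rt₁ (s₃.v rb * s₃.v rk) with hs₄def
  have hs₄ : Ready n k m s₄ := hs₃.set (by omega)
  rw [x1, u1, v1] at l2
  set C := 2 * n + m with hC
  -- `r` is the number of rounds of bidding so far
  refine wp_while (fun s' =>
      Auction (2 * n) (8 * k) m (s.A aX) (s.A aU) (s.A aV) (s'.A aP) (s'.A aO) (s'.A aH) ∧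
      Levels (2 * n) (8 * k) m (s.A aX) (s.A aU) (s.A aV) (s'.A aP) (s'.A aL) ∧
      s'.v rt₁ = unhappy (2 * n) (8 * k) (s'.A aO) (s'.A aL) * k ∧
      ∃ r, s'.clk ≤ s.clk + 200 * C + 30 + (300 * C) * r ∧
        r * n ≤ k * (total (2 * n) (s'.A aP) + total (2 * n) (s'.A aL)))
    (fun s' => 32 * (n * k) - (total (2 * n) (s'.A aP) + total (2 * n) (s'.A aL)))
    ?_ ?_ ?_
  · refine ⟨?_, ?_, ?_, 0, ?_, by simp⟩
    · simp only [hs₄def, Store.set_A, p3, o3, h3]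
      exact hA₁
    · simp only [hs₄def, Store.set_A, p3, l3]
      exact l2
    · simp [hs₄def, b3, hs₃.vk, o3, l3, hf₂.arr (j := aO) (by decide)]
    · simp [hs₄def] at c2 c3 ⊢
      omega
  · rintro s' ⟨hA, hl, ht, r, hr1, hr2⟩ hf hlt'
    have hs' := hs₄.frame hf (by decide)
    have hs't : Ready n k m s'.tick := hs'.tick
    have u' : s'.tick.A aU = s.A aU := (hf.arr (by decide)).trans u3
    have v' : s'.tick.A aV = s.A aV := (hf.arr (by decide)).trans v3
    have x' : s'.tick.A aX = s.A aX := (hf.arr (by decide)).trans x3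
    rw [hs'.vn, ht] at hlt'
    rw [wp_seq]
    refine (Prog.bids_spec hWW hs't (by rw [x', u', v']; exact hE) (by rw [x', u', v']; exact hA)
      (by rw [x', u', v']; exact hl)).conseq ?_
    rintro s₅ ⟨b5, c5⟩ hf₅
    have hs₅ := hs't.frame hf₅ (by decide)
    have u5 : s₅.A aU = s.A aU := (hf₅.arr (by decide)).trans u'
    have v5 : s₅.A aV = s.A aV := (hf₅.arr (by decide)).trans v'
    have x5 : s₅.A aX = s.A aX := (hf₅.arr (by decide)).trans x'
    rw [x', u', v'] at b5
    rw [wp_seq]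
    refine (Prog.levels_spec hWW hs₅ (by rw [x5, u5, v5]; exact hE)).conseq ?_
    rintro s₆ ⟨l6, c6⟩ hf₆
    have hs₆ := hs₅.frame hf₆ (by decide)
    rw [wp_seq]
    refine (Prog.count_spec hWW hs₆).conseq ?_
    rintro s₇ ⟨b7, c7⟩ hf₇
    have hs₇ := hs₆.frame hf₇ (by decide)
    rw [x5, u5, v5] at l6
    rw [wp_mul]
    have p7 : s₇.A aP = s₅.A aP := (hf₇.arr (by decide)).trans (hf₆.arr (by decide))
    have o7 : s₇.A aO = s₅.A aO := (hf₇.arr (by decide)).trans (hf₆.arr (by decide))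
    have h7 : s₇.A aH = s₅.A aH := (hf₇.arr (by decide)).trans (hf₆.arr (by decide))
    have l7 : s₇.A aL = s₆.A aL := hf₇.arr (by decide)
    have o6 : s₆.A aO = s₅.A aO := hf₆.arr (by decide)
    have grow := b5.total_le hl.le l6
    simp only [Store.tick_A] at grow
    have bp : total (2 * n) (s₅.A aP) ≤ 2 * n * (8 * k) := total_le b5.auction.price
    have bl : total (2 * n) (s₆.A aL) ≤ 2 * n * (8 * k) := total_le l6.le
    rw [show 2 * n * (8 * k) = 16 * (n * k) by ring] at bp bl
    refine ⟨by rw [b7, hs₇.vk]; exact hmulk _ (unhappy_le _ _), ⟨?_, ?_, ?_, r + 1, ?_, ?_⟩, ?_⟩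
    · simp only [Store.set_A, p7, o7, h7]
      exact b5.auction
    · simp only [Store.set_A, p7, l7]
      exact l6
    · simp [b7, hs₇.vk, o7, o6, l7]
    · have : 300 * C * (r + 1) = 300 * C * r + 300 * C := by ring
      simp at c5 c6 c7 ⊢
      omega
    · simp only [Store.set_A, p7, l7]
      have h9 := Nat.mul_le_mul_left k grow
      simp only [mul_add] at h9 hr2 ⊢
      rw [mul_comm _ k] at hlt'
      have : (r + 1) * n = r * n + n := by ring
      omega
    · simp only [Store.set_A, p7, l7]
      have : 1 ≤ unhappy (2 * n) (8 * k) (s'.A aO) (s'.A aL) := by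
        rcases Nat.eq_zero_or_pos (unhappy (2 * n) (8 * k) (s'.A aO) (s'.A aL)) with h0 | h0
        · rw [h0] at hlt'; omega
        · exact h0
      omega
  · rintro s' ⟨hA, hl, ht, r, hr1, hr2⟩ hf hlt'
    have hs' := hs₄.frame hf (by decide)
    rw [hs'.vn, ht, not_lt] at hlt'
    refine ⟨hA, ?_, ?_⟩
    · obtain ⟨z, z1, z2, z3⟩ := hA.exists_cover hl
      rw [show 2 * (8 * k) = 16 * k by ring] at z1 z2 z3
      refine ⟨z, z1, z2, z3.trans ?_⟩
      have hsup : support (2 * n) (s'.A aO) ≤ 2 * n := by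
        have := Finset.card_filter_le (Finset.range (2 * n)) (fun u => s'.A aO u ≠ 0)
        simpa [support] using this
      have : unhappy (2 * n) (8 * k) (s'.A aO) (s'.A aL) * (8 * k) =
        8 * (unhappy (2 * n) (8 * k) (s'.A aO) (s'.A aL) * k) := by ring
      simp only [Store.tick_A]
      rw [mul_add, mul_one]
      omega
    · have bp : total (2 * n) (s'.A aP) ≤ 2 * n * (8 * k) := total_le hA.price
      have bl : total (2 * n) (s'.A aL) ≤ 2 * n * (8 * k) := total_le hl.le
      have h9 : r * n ≤ 32 * (k * k) * n := by
        refine hr2.trans ((Nat.mul_le_mul_left k (add_le_add bp bl)).trans (le_of_eq ?_))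
        ring
      have h10 : r ≤ 32 * (k * k) := Nat.le_of_mul_le_mul_right h9 (by omega)
      have h11 := Nat.mul_le_mul_left (300 * C) h10
      rw [mul_add]
      simp
      omega

end Specs

/-! ### Extracting a matching from the double cover -/

theorem support_update {N u : ℕ} (hu : u < N) (f : ℕ → ℕ) (x : ℕ) :
    support N (Function.update f u x) + (if f u ≠ 0 then 1 else 0) =
      support N f + if x ≠ 0 then 1 else 0 := by
  have e : ∀ g : ℕ → ℕ, support N g = total N (fun v => if g v ≠ 0 then 1 else 0) := by
    intro g
    rw [support, Finset.card_filter, total]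
  rw [e, e]
  have := total_update hu (fun v => if f v ≠ 0 then 1 else 0) (if x ≠ 0 then 1 else 0)
  rw [← this]
  congr 2
  funext v
  simp only [Function.update_apply]
  split_ifs <;> simp_all

theorem support_le (N : ℕ) (f : ℕ → ℕ) : support N f ≤ N := by
  have := Finset.card_filter_le (Finset.range N) (fun u => f u ≠ 0)
  simpa [support] using this

theorem support_mono {N : ℕ} {f g : ℕ → ℕ} (h : ∀ v < N, f v ≠ 0 → g v ≠ 0) :
    support N f ≤ support N g := by
  refine Finset.card_le_card fun v hv => ?_
  obtain ⟨h1, h2⟩ := Finset.mem_filter.1 hv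
  exact Finset.mem_filter.2 ⟨h1, h v (Finset.mem_range.1 h1) h2⟩

/-- The matching of the double cover, seen as a graph with arcs from `u` to `x` for `ob u = x + 1`:
a union of disjoint paths and cycles, properly colored by `χ`. -/
structure Trails (N : ℕ) (χ : ℕ → Bool) (ob : ℕ → ℕ) : Prop where
  lt : ∀ u < N, ∀ x, ob u = x + 1 → x < N
  inj : ∀ u < N, ∀ w < N, ∀ x, ob u = x + 1 → ob w = x + 1 → u = w
  bip : ∀ u < N, ∀ x, ob u = x + 1 → χ u ≠ χ x

theorem Trails.ne {N : ℕ} {χ : ℕ → Bool} {ob : ℕ → ℕ} (h : Trails N χ ob) {u x : ℕ} (hu : u < N)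
    (hx : ob u = x + 1) : u ≠ x := fun e => h.bip u hu x hx (by rw [e])

/-- The array `mt` of mates describes a matching whose edges belong to the relation `r`. -/
def Mates (N : ℕ) (r : ℕ → ℕ → Prop) (mt : ℕ → ℕ) : Prop :=
  ∀ u < N, mt u = 0 ∨ ∃ x < N, mt u = x + 1 ∧ mt x = u + 1 ∧ r u x

/-- Match `c` and `x`. -/
def pairUp (mt : ℕ → ℕ) (c x : ℕ) : ℕ → ℕ :=
  Function.update (Function.update mt c (x + 1)) x (c + 1)

theorem pairUp_ne_zero {mt : ℕ → ℕ} {c x v : ℕ} :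
    pairUp mt c x v ≠ 0 ↔ v = c ∨ v = x ∨ mt v ≠ 0 := by
  simp only [pairUp, Function.update_apply]
  split_ifs <;> simp_all

theorem Mates.pairUp {N : ℕ} {r : ℕ → ℕ → Prop} {mt : ℕ → ℕ} (h : Mates N r mt) {c x : ℕ}
    (hc : c < N) (hx : x < N) (hcx : c ≠ x) (h1 : mt c = 0) (h2 : mt x = 0) (hr : r c x)
    (hr' : r x c) : Mates N r (pairUp mt c x) := by
  intro u hu
  by_cases huc : u = c
  · subst huc
    exact .inr ⟨x, hx, by simp [DynMatching.pairUp, hcx], by simp [DynMatching.pairUp], hr⟩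
  by_cases hux : u = x
  · subst hux
    exact .inr ⟨c, hc, by simp [DynMatching.pairUp], by simp [DynMatching.pairUp, hcx], hr'⟩
  rcases h u hu with h0 | ⟨y, hy, e1, e2, e3⟩
  · exact .inl (by simp [DynMatching.pairUp, huc, hux, h0])
  · have hyc : y ≠ c := by rintro rfl; omega
    have hyx : y ≠ x := by rintro rfl; omega
    exact .inr ⟨y, hy, by simp [DynMatching.pairUp, huc, hux, e1],
      by simp [DynMatching.pairUp, hyc, hyx, e2], e3⟩

/-- Invariant of a walk that starts from a vertex `r` without incoming arc. The next vertex of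
the walk is `cur - 1`, unless `cur = 0`. -/
structure PathWalk (N : ℕ) (ob mt₀ : ℕ → ℕ) (r : ℕ) (mt : ℕ → ℕ) (cur : ℕ) : Prop where
  mates : Mates N (fun u x => ob u = x + 1 ∨ ob x = u + 1) mt
  back : ∀ u < N, ∀ x, ob u = x + 1 → mt x ≠ 0 → mt u ≠ 0
  fwd : ∀ u < N, ∀ x, ob u = x + 1 → mt u ≠ 0 → ob x ≠ 0 → mt x ≠ 0 ∨ x + 1 = cur
  pred : ∀ w < N, ∀ c, cur = c + 1 → ob w = c + 1 → mt w ≠ 0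
  mono : ∀ v, mt₀ v ≠ 0 → mt v ≠ 0
  start : mt r ≠ 0 ∨ ob r = 0 ∨ cur = r + 1

theorem PathWalk.finish {N : ℕ} {ob mt₀ mt : ℕ → ℕ} {r c : ℕ} (h : PathWalk N ob mt₀ r mt (c + 1))
    (hc : mt c ≠ 0 ∨ ob c = 0) : PathWalk N ob mt₀ r mt 0 := by
  obtain ⟨h1, h2, h3, h4, h5, h6⟩ := h
  refine ⟨h1, h2, ?_, by simp, h5, ?_⟩
  · intro u hu x hx hm ho
    rcases h3 u hu x hx hm ho with h | h
    · exact .inl h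
    · obtain rfl : x = c := by omega
      exact .inl (hc.resolve_right ho)
  · rcases h6 with h | h | h
    · exact .inl h
    · exact .inr (.inl h)
    · obtain rfl : c = r := by omega
      exact hc.imp_right .inl

theorem PathWalk.step {N : ℕ} {χ : ℕ → Bool} {ob mt₀ mt : ℕ → ℕ} (ht : Trails N χ ob) {r c x : ℕ}
    (h : PathWalk N ob mt₀ r mt (c + 1)) (hcN : c < N) (hc : mt c = 0) (hx : ob c = x + 1) :
    PathWalk N ob mt₀ r (pairUp mt c x) (ob x) := by
  obtain ⟨h1, h2, h3, h4, h5, h6⟩ := h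
  have hxN := ht.lt c hcN x hx
  have hne := ht.ne hcN hx
  have hmx : mt x = 0 := by
    by_contra h0
    exact h2 c hcN x hx h0 hc
  refine ⟨h1.pairUp hcN hxN hne hc hmx (.inl hx) (.inr hx), ?_, ?_, ?_, ?_, ?_⟩
  · intro u hu y hy hm
    rw [pairUp_ne_zero] at hm ⊢
    rcases hm with rfl | rfl | hm
    · exact .inr (.inr (h4 u hu _ rfl hy))
    · exact .inl (ht.inj u hu c hcN _ hy hx)
    · exact .inr (.inr (h2 u hu y hy hm))
  · intro u hu y hy hm ho
    rw [pairUp_ne_zero] at hm ⊢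
    rcases hm with rfl | rfl | hm
    · exact .inl (.inr (.inl (by omega)))
    · exact .inr hy.symm
    · rcases h3 u hu y hy hm ho with h | h
      · exact .inl (.inr (.inr h))
      · exact .inl (.inl (by omega))
  · intro w hw d hd hwd
    rw [pairUp_ne_zero]
    exact .inr (.inl (ht.inj w hw x hxN d hwd hd))
  · intro v hv
    rw [pairUp_ne_zero]
    exact .inr (.inr (h5 v hv))
  · rw [pairUp_ne_zero]
    rcases h6 with h | h | h
    · exact .inl (.inr (.inr h))
    · exact .inr (.inl h)
    · exact .inl (.inl (by omega))

/-- Invariant of a walk along a cycle through `r` (or of a walk that stops at once). The walk moves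
by two arcs at a time, hence stays in the color class of `r`. It can therefore only end in `r`, and
leaves no vertex of the cycle out. -/
structure CycleWalk (N : ℕ) (χ : ℕ → Bool) (ob mt₀ : ℕ → ℕ) (r : ℕ) (mt : ℕ → ℕ) (cur : ℕ) : Prop
    where
  mates : Mates N (fun u x => ob u = x + 1 ∨ ob x = u + 1) mt
  back : ∀ u < N, ∀ x, ob u = x + 1 → mt x ≠ 0 → (x = r ∧ cur ≠ 0) ∨ mt u ≠ 0
  color : ∀ c, cur = c + 1 → χ c = χ r
  pred : ∀ c, cur = c + 1 → (∀ w < N, ob w = c + 1 → mt w ≠ 0) ∨ (c = r ∧ mt r = 0)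
  closed : ∀ c, cur = c + 1 → mt c ≠ 0 → c = r
  tail : ∀ c, cur = c + 1 → c = r ∨ ob c ≠ 0
  next : ∀ u < N, ∀ x, mt u = 0 → ob u = x + 1 → ob x ≠ 0
  mono : ∀ v, mt₀ v ≠ 0 → mt v ≠ 0
  start : mt r ≠ 0 ∨ ob r = 0 ∨ cur = r + 1

theorem CycleWalk.finish {N : ℕ} {χ : ℕ → Bool} {ob mt₀ mt : ℕ → ℕ} {r c : ℕ}
    (h : CycleWalk N χ ob mt₀ r mt (c + 1)) (hc : mt c ≠ 0 ∨ ob c = 0) :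
    CycleWalk N χ ob mt₀ r mt 0 := by
  have hcr : c = r := by
    rcases hc with h0 | h0
    · exact h.closed c rfl h0
    · exact (h.tail c rfl).resolve_right (not_not.2 h0)
  subst hcr
  refine ⟨h.mates, ?_, by simp, by simp, by simp, by simp, h.next, h.mono, ?_⟩
  · intro u hu x hx hm
    right
    rcases h.back u hu x hx hm with ⟨rfl, -⟩ | h'
    · rcases h.pred x rfl with h' | h'
      · exact h' u hu hx
      · exact absurd h'.2 hm
    · exact h'
  · exact hc.imp_right .inl

theorem CycleWalk.step {N : ℕ} {χ : ℕ → Bool} {ob mt₀ mt : ℕ → ℕ} (ht : Trails N χ ob) {r c x : ℕ}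
    (h : CycleWalk N χ ob mt₀ r mt (c + 1)) (hcN : c < N) (hc : mt c = 0) (hx : ob c = x + 1) :
    CycleWalk N χ ob mt₀ r (pairUp mt c x) (ob x) := by
  have hxN := ht.lt c hcN x hx
  have hne := ht.ne hcN hx
  have hχ := h.color c rfl
  have hxr : x ≠ r := by
    rintro rfl
    exact ht.bip c hcN x hx hχ
  have hmx : mt x = 0 := by
    by_contra h0
    rcases h.back c hcN x hx h0 with h' | h'
    · exact hxr h'.1
    · exact h' hc
  have hox := h.next c hcN x hc hx
  refine ⟨h.mates.pairUp hcN hxN hne hc hmx (.inl hx) (.inr hx), ?_, ?_, ?_, ?_, ?_, ?_, ?_, ?_⟩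
  · intro u hu y hy hm
    rw [pairUp_ne_zero] at hm ⊢
    rcases hm with rfl | rfl | hm
    · rcases h.pred y rfl with h' | h'
      · exact .inr (.inr (.inr (h' u hu hy)))
      · exact .inl ⟨h'.1, hox⟩
    · exact .inr (.inl (ht.inj u hu c hcN _ hy hx))
    · rcases h.back u hu y hy hm with h' | h'
      · exact .inl ⟨h'.1, hox⟩
      · exact .inr (.inr (.inr h'))
  · intro d hd
    have h1 := ht.bip c hcN x hx
    have h2 := ht.bip x hxN d hd
    rw [← hχ]
    revert h1 h2
    cases χ c <;> cases χ x <;> cases χ d <;> simp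
  · intro d hd
    left
    intro w hw hwd
    rw [pairUp_ne_zero]
    exact .inr (.inl (ht.inj w hw x hxN d hwd hd))
  · intro d hd hm
    rw [pairUp_ne_zero] at hm
    rcases hm with rfl | rfl | hm
    · rcases h.pred d rfl with h' | h'
      · exact absurd hmx (h' x hxN hd)
      · exact h'.1
    · exact absurd rfl (ht.ne hxN hd)
    · rcases h.back x hxN d hd hm with h' | h'
      · exact h'.1
      · exact absurd hmx h'
  · intro d hd
    exact .inr (h.next x hxN d hmx hd)
  · intro u hu y hm hy
    refine h.next u hu y ?_ hy
    by_contra h0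
    exact (pairUp_ne_zero.2 (.inr (.inr h0))) hm
  · intro v hv
    rw [pairUp_ne_zero]
    exact .inr (.inr (h.mono v hv))
  · rw [pairUp_ne_zero]
    rcases h.start with h | h | h
    · exact .inl (.inr (.inr h))
    · exact .inr (.inl h)
    · exact .inl (.inl (by omega))

/-- After all paths have been dealt with, every unmatched vertex with an outgoing arc lies on a
cycle: predecessors of such vertices are of the same kind, hence so are successors. -/
theorem next_of_sources {N : ℕ} {ob ho mt : ℕ → ℕ}
    (hho : ∀ x < N, ∀ u, ho x = u + 1 → u < N ∧ ob u = x + 1)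
    (fwd : ∀ u < N, ∀ x, ob u = x + 1 → mt u ≠ 0 → ob x ≠ 0 → mt x ≠ 0)
    (src : ∀ j < N, ho j = 0 → mt j ≠ 0 ∨ ob j = 0) :
    ∀ u < N, ∀ x, mt u = 0 → ob u = x + 1 → ob x ≠ 0 := by
  set U := (Finset.range N).filter fun u => ob u ≠ 0 ∧ mt u = 0 with hU
  have mem : ∀ u, u ∈ U ↔ u < N ∧ ob u ≠ 0 ∧ mt u = 0 := by
    intro u; simp [hU]
  have pre : ∀ u ∈ U, ho u - 1 < N ∧ ob (ho u - 1) = u + 1 := by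
    intro u hu
    obtain ⟨h1, h2, h3⟩ := (mem u).1 hu
    have h4 : ho u ≠ 0 := by
      intro h0
      rcases src u h1 h0 with h | h
      · exact h h3
      · exact h2 h
    exact hho u h1 _ (by omega)
  have maps : Set.MapsTo (fun u => ho u - 1) (U : Set ℕ) U := by
    intro u hu
    obtain ⟨h1, h2, h3⟩ := (mem u).1 hu
    obtain ⟨h4, h5⟩ := pre u hu
    refine (mem _).2 ⟨h4, by show ob (ho u - 1) ≠ 0; omega, ?_⟩
    by_contra h0
    exact fwd _ h4 u h5 h0 h2 h3
  have inj : Set.InjOn (fun u => ho u - 1) (U : Set ℕ) := by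
    intro u hu w hw e
    have h1 := (pre u hu).2
    have h2 := (pre w hw).2
    simp only at e
    rw [e] at h1
    omega
  have surj := Finset.surjOn_of_injOn_of_card_le _ maps inj le_rfl
  intro u hu x hm hx
  obtain ⟨z, hz, e⟩ := surj ((mem u).2 ⟨hu, by omega, hm⟩ : u ∈ (U : Set ℕ))
  have h1 := (pre z hz).2
  simp only at e
  rw [e] at h1
  obtain rfl : x = z := by omega
  exact ((mem x).1 hz).2.1

section Specs

variable {W L n k m : ℕ} {s : Store}

/-- A walk preserves every invariant that is preserved by its two kinds of steps. -/
theorem Prog.trail_spec (hW : Sizes W L n k) (hs : Ready n k m s) {χ : ℕ → Bool}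
    (ht : Trails (2 * n) χ (s.A aO)) (J : (ℕ → ℕ) → ℕ → Prop)
    (hstep : ∀ mt c x, J mt (c + 1) → c < 2 * n → mt c = 0 → s.A aO c = x + 1 →
      J (pairUp mt c x) (s.A aO x))
    (h_end : ∀ mt c, J mt (c + 1) → (mt c ≠ 0 ∨ s.A aO c = 0) → J mt 0)
    (hcur : s.v rwk ≤ 2 * n) (h0 : J (s.A aM) (s.v rwk)) :
    Wp W L Prog.trail (fun s' => J (s'.A aM) 0 ∧
      s'.clk + 50 * support (2 * n) (s.A aM) ≤
        s.clk + 50 * support (2 * n) (s'.A aM) + 60) s := by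
  obtain ⟨_, _, _, _, _⟩ := hW
  -- Each step but the last one matches a vertex that was unmatched.
  refine wp_while (fun s' => J (s'.A aM) (s'.v rwk) ∧ s'.v rwk ≤ 2 * n ∧
      s'.clk + 50 * support (2 * n) (s.A aM) ≤
        s.clk + 50 * support (2 * n) (s'.A aM) + if s'.v rwk = 0 then 50 else 0)
    (fun s' => 2 * (2 * n - support (2 * n) (s'.A aM)) + if s'.v rwk = 0 then 0 else 1)
    ⟨h0, hcur, by omega⟩ ?_ ?_
  · rintro s' ⟨hJ, hle, hc⟩ hf hlt
    have hs' := hs.frame hf (by decide)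
    have fo : s'.A aO = s.A aO := hf.arr (by decide)
    rw [hs'.zero] at hlt
    obtain ⟨c, hcc⟩ : ∃ c, s'.v rwk = c + 1 := ⟨s'.v rwk - 1, by omega⟩
    rw [hcc] at hJ
    rw [if_neg (by omega)] at hc
    simp [hcc, hs'.one, hs'.zero, fo]
    refine ⟨by omega, fun hm => ⟨fun hpos => ?_, fun hz => ?_⟩, fun hm => ⟨?_, by omega⟩⟩
    · obtain ⟨x, hx⟩ : ∃ x, s.A aO c = x + 1 := ⟨s.A aO c - 1, by omega⟩
      have hxN := ht.lt c (by omega) x hx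
      have hne := ht.ne (by omega) hx
      have hJ' := hstep _ c x hJ (by omega) hm hx
      have hox : s.A aO x ≤ 2 * n := by
        rcases Nat.eq_zero_or_pos (s.A aO x) with h | h
        · omega
        · have := ht.lt x hxN (s.A aO x - 1) (by omega)
          omega
      have sup1 := support_update (N := 2 * n) (u := c) (by omega) (s'.A aM) (x + 1)
      have sup2 := support_update hxN (Function.update (s'.A aM) c (x + 1)) (c + 1)
      rw [if_neg (by simpa using hm), if_pos (by simp)] at sup1
      rw [if_pos (by simp : c + 1 ≠ 0)] at sup2
      have sup3 : support (2 * n) (s'.A aM) + 1 ≤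
          support (2 * n) (Function.update (Function.update (s'.A aM) c (x + 1)) x (c + 1)) := by
        split_ifs at sup2 <;> omega
      have := support_le (2 * n)
        (Function.update (Function.update (s'.A aM) c (x + 1)) x (c + 1))
      simp [hx]
      refine ⟨by omega, by omega, by omega, ⟨hJ', hox, ?_⟩, ?_⟩
      · split_ifs <;> omega
      · split_ifs <;> omega
    · exact ⟨h_end _ c hJ (.inr hz), by omega⟩
    · exact h_end _ c hJ (.inl hm)
  · rintro s' ⟨hJ, hle, hc⟩ hf hlt
    have hs' := hs.frame hf (by decide)
    rw [hs'.zero] at hlt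
    have h0 : s'.v rwk = 0 := by omega
    rw [h0] at hJ hc
    refine ⟨hJ, ?_⟩
    simp at hc ⊢
    omega

/-- The extracted matching has at least half as many edges as the matching of the double cover. -/
theorem Prog.extract_spec (hW : Sizes W L n k) (hs : Ready n k m s) {r : ℕ → ℕ → Prop}
    {χ : ℕ → Bool} (ht : Trails (2 * n) χ (s.A aO))
    (hho : ∀ x < 2 * n, ∀ u, s.A aH x = u + 1 → u < 2 * n ∧ s.A aO u = x + 1)
    (hoh : ∀ u < 2 * n, ∀ x, s.A aO u = x + 1 → s.A aH x = u + 1)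
    (hr : ∀ u < 2 * n, ∀ x, s.A aO u = x + 1 → r u x ∧ r x u) :
    Wp W L Prog.extract (fun s' => Mates (2 * n) r (s'.A aM) ∧
      support (2 * n) (s.A aO) ≤ support (2 * n) (s'.A aM) ∧
      s'.clk ≤ s.clk + 300 * (2 * n) + 20) s := by
  have hWW := hW
  obtain ⟨_, _, _, _, _⟩ := hW
  rw [Prog.extract, wp_seq]
  refine wp_for (fun j s' => (∀ v < j, s'.A aM v = 0) ∧ s'.clk ≤ s.clk + 20 * j + 2) hs.one ?_
    (by decide) ?_ ?_ ?_
  · rw [hs.vN]; omega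
  · simp
  · rintro j s' ⟨h1, h2⟩ hf hj hjN
    have hs' := hs.frame hf (by decide)
    rw [hs.vN] at hjN
    simp [hj, hs'.zero, Function.update_apply]
    refine ⟨by omega, fun v hv hne => h1 v (by omega), by omega⟩
  rintro s₁ ⟨h1, h2⟩ hf₁
  rw [hs.vN] at h1 h2
  have hs₁ : Ready n k m s₁.tick := (hs.frame hf₁ (by decide)).tick
  have o1 : s₁.tick.A aO = s.A aO := hf₁.arr (by decide)
  have k1 : s₁.tick.A aH = s.A aH := hf₁.arr (by decide)
  have n1 : s₁.tick.v rN = 2 * n := hs₁.vN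
  set r₀ : ℕ → ℕ → Prop := fun u x => s.A aO u = x + 1 ∨ s.A aO x = u + 1 with hr₀
  have sup0 : support (2 * n) (s₁.A aM) = 0 := by
    rw [support, Finset.card_eq_zero, Finset.filter_eq_empty_iff]
    intro v hv
    simp [h1 v (Finset.mem_range.1 hv)]
  rw [wp_seq]
  refine wp_for (fun j s' => Mates (2 * n) r₀ (s'.A aM) ∧
      (∀ u < 2 * n, ∀ x, s.A aO u = x + 1 → s'.A aM x ≠ 0 → s'.A aM u ≠ 0) ∧
      (∀ u < 2 * n, ∀ x, s.A aO u = x + 1 → s'.A aM u ≠ 0 → s.A aO x ≠ 0 → s'.A aM x ≠ 0) ∧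
      (∀ i < j, s.A aH i = 0 → s'.A aM i ≠ 0 ∨ s.A aO i = 0) ∧
      s'.clk ≤ s₁.clk + 5 + 80 * j + 50 * support (2 * n) (s'.A aM)) hs₁.one ?_
    (by decide) ?_ ?_ ?_
  · rw [n1]; omega
  · refine ⟨fun u hu => .inl (h1 u hu), fun u hu x hx hm => absurd (h1 x (ht.lt u hu x hx)) hm,
      fun u hu x hx hm => absurd (h1 u hu) hm, by simp, by simp⟩
  · rintro j s' ⟨i1, i2, i3, i4, i5⟩ hf hj hjN
    rw [n1] at hjN
    have hs' := hs₁.frame hf (by decide)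
    have o' : s'.A aO = s.A aO := (hf.arr (by decide)).trans o1
    have k' : s'.A aH = s.A aH := (hf.arr (by decide)).trans k1
    simp only [wp_seq, wp_read, wp_ifEq, wp_add, wp_skip]
    simp [hj, k', hs'.zero, hs'.one]
    refine ⟨by omega, fun hz => ⟨by omega, ?_⟩, fun hnz => ⟨i1, i2, i3, ?_, by omega⟩⟩
    · have hs₂ : Ready n k m ((s'.tick.set rt₁ 0).tick.set rwk (j + 1)) :=
        (hs'.tick.set (by omega)).tick.set (by omega)
      rw [hz]
      refine (Prog.trail_spec hWW hs₂ (χ := χ) (by simpa [o'] using ht)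
        (PathWalk (2 * n) (s.A aO) (s'.A aM) j) ?_ ?_ (by simp; omega) ?_).mono ?_
      · intro mt c x hJ hcN hc hx
        simp only [Store.set_A, Store.tick_A, o'] at hx ⊢
        exact hJ.step ht hcN hc hx
      · intro mt c hJ hc
        simp only [Store.set_A, Store.tick_A, o'] at hc
        exact hJ.finish hc
      · refine ⟨i1, i2, fun u hu x hx hm ho => .inl (i3 u hu x hx hm ho), ?_, fun _ h => h, ?_⟩
        · intro w hw c hc hwc
          simp at hc
          subst hc
          have := hoh w hw j hwc
          omega
        · simp
      · rintro s₃ ⟨q, hc⟩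
        simp at hc
        refine ⟨q.mates, q.back, ?_, ?_, ?_⟩
        · intro u hu x hx hm ho
          rcases q.fwd u hu x hx hm ho with h | h
          · exact h
          · omega
        · intro i hi h0
          by_cases hij : i = j
          · subst hij
            rcases q.start with h | h | h
            · exact .inl h
            · exact .inr h
            · omega
          · exact (i4 i (by omega) h0).imp_left (q.mono i)
        · show s₃.clk + 2 ≤ _
          omega
    · intro i hi h0
      by_cases hij : i = j
      · subst hij
        exact absurd h0 hnz
      · have := i4 i (by omega) h0
        tauto
  rintro s₂ ⟨i1, i2, i3, i4, i5⟩ hf₂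
  rw [n1] at i4 i5
  have hs₂ : Ready n k m s₂.tick := (hs₁.frame hf₂ (by decide)).tick
  have o2 : s₂.tick.A aO = s.A aO := (hf₂.arr (by decide)).trans o1
  have n2 : s₂.tick.v rN = 2 * n := hs₂.vN
  refine wp_for (fun j s' => Mates (2 * n) r₀ (s'.A aM) ∧
      (∀ u < 2 * n, ∀ x, s.A aO u = x + 1 → s'.A aM x ≠ 0 → s'.A aM u ≠ 0) ∧
      (∀ u < 2 * n, ∀ x, s'.A aM u = 0 → s.A aO u = x + 1 → s.A aO x ≠ 0) ∧
      (∀ i < j, s'.A aM i ≠ 0 ∨ s.A aO i = 0) ∧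
      s'.clk ≤ s₁.clk + 10 + 80 * (2 * n) + 80 * j + 50 * support (2 * n) (s'.A aM)) hs₂.one ?_
    (by decide) ?_ ?_ ?_
  · rw [n2]; omega
  · refine ⟨i1, i2, next_of_sources hho i3 i4, by simp, by simp; omega⟩
  · rintro j s' ⟨i1, i2, i3, i4, i5⟩ hf hj hjN
    rw [n2] at hjN
    have hs' := hs₂.frame hf (by decide)
    have o' : s'.A aO = s.A aO := (hf.arr (by decide)).trans o2
    simp only [wp_seq, wp_add]
    simp [hj, hs'.one]
    refine ⟨by omega, ?_⟩
    have hs₂ : Ready n k m (s'.tick.set rwk (j + 1)) := hs'.tick.set (by omega)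
    refine (Prog.trail_spec hWW hs₂ (χ := χ) (by simpa [o'] using ht)
      (CycleWalk (2 * n) χ (s.A aO) (s'.A aM) j) ?_ ?_ (by simp; omega) ?_).mono ?_
    · intro mt c x hJ hcN hc hx
      simp only [Store.set_A, Store.tick_A, o'] at hx ⊢
      exact hJ.step ht hcN hc hx
    · intro mt c hJ hc
      simp only [Store.set_A, Store.tick_A, o'] at hc
      exact hJ.finish hc
    · refine ⟨i1, fun u hu x hx hm => .inr (i2 u hu x hx hm), ?_, ?_, ?_, ?_, i3, fun _ h => h, ?_⟩
      · intro c hc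
        simp at hc
        rw [hc]
      · intro c hc
        simp at hc
        subst hc
        by_cases h0 : s'.A aM j = 0
        · exact .inr ⟨rfl, h0⟩
        · exact .inl fun w hw hx => i2 w hw j hx h0
      · intro c hc _
        simp at hc
        exact hc.symm
      · intro c hc
        simp at hc
        exact .inl hc.symm
      · simp
    · rintro s₃ ⟨q, hc⟩
      simp at hc
      refine ⟨q.mates, ?_, q.next, ?_, ?_⟩
      · intro u hu x hx hm
        rcases q.back u hu x hx hm with h | h
        · exact absurd rfl h.2
        · exact h
      · intro i hi
        by_cases hij : i = j
        · subst hij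
          rcases q.start with h | h | h
          · exact .inl h
          · exact .inr h
          · omega
        · exact (i4 i (by omega)).imp_left (q.mono i)
      · show s₃.clk + 2 ≤ _
        omega
  · rintro s₃ ⟨i1, i2, i3, i4, i5⟩ hf₃
    rw [n2] at i4 i5
    refine ⟨?_, ?_, ?_⟩
    · intro u hu
      rcases i1 u hu with h | ⟨x, hx, e1, e2, e3⟩
      · exact .inl h
      · refine .inr ⟨x, hx, e1, e2, ?_⟩
        rcases e3 with e3 | e3
        · exact (hr u hu x e3).1
        · exact (hr x hx u e3).2
    · exact support_mono fun v hv h0 => (i4 v hv).resolve_right h0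
    · have := support_le (2 * n) (s₃.A aM)
      simp
      omega

theorem Prog.unmatch_spec {a : ℕ} (ha : a < 21) (hW : Sizes W L n k) (hs : Ready n k m s)
    {r : ℕ → ℕ → Prop} (hM : Mates (2 * n) r (s.A aM)) (hv : s.v a < 2 * n) :
    Wp W L (Prog.unmatch a) (fun s' => Mates (2 * n) r (s'.A aM) ∧ s'.A aM (s.v a) = 0 ∧
      (∀ v, s.A aM v = 0 → s'.A aM v = 0) ∧
      support (2 * n) (s.A aM) ≤ support (2 * n) (s'.A aM) + 2 ∧ s'.clk ≤ s.clk + 15) s := by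
  obtain ⟨_, _, _, _, _⟩ := hW
  have a1 : a ≠ 21 := by omega
  simp [Prog.unmatch, hs.zero, hs.one, a1]
  refine ⟨by omega, fun hpos => ?_, fun h0 => ⟨hM, h0⟩⟩
  rcases hM _ hv with h0 | ⟨x, hx, e1, e2, e3⟩
  · omega
  simp [e1]
  refine ⟨by omega, by omega, ?_, ?_, ?_⟩
  · intro u hu
    by_cases huv : u = s.v a
    · exact .inl (by simp [huv])
    by_cases hux : u = x
    · exact .inl (by simp [hux, Function.update_apply])
    rcases hM u hu with h | ⟨y, hy, f1, f2, f3⟩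
    · exact .inl (by simp [huv, hux, h])
    · have hyv : y ≠ s.v a := by rintro rfl; omega
      have hyx : y ≠ x := by rintro rfl; omega
      exact .inr ⟨y, hy, by simp [huv, hux, f1], by simp [hyv, hyx, f2], f3⟩
  · intro v h0
    simp only [Function.update_apply]
    split_ifs <;> simp_all
  · have sup1 := support_update hx (s.A aM) 0
    have sup2 := support_update hv (Function.update (s.A aM) x 0) 0
    simp only [ne_eq, not_true_eq_false, if_false] at sup1 sup2
    split_ifs at sup1 sup2 <;> omega

end Specs

/-! ### Updates -/

section Specs

variable {W L n k m : ℕ} {s : Store}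

theorem Prog.rebuild_spec (hW : Sizes W L n k) (hs : Ready n k m s)
    (hE : EdgesOk n m L (s.A aX) (s.A aU) (s.A aV)) :
    Wp W L Prog.rebuild (fun s' => Mates (2 * n) (Joins (s.A aX) (s.A aU) (s.A aV) m) (s'.A aM) ∧
      (∃ z : ℕ → ℕ, (∀ v < 2 * n, z v ≤ 16 * k) ∧ Covers (s.A aU) (s.A aV) m (16 * k) z ∧
        total (2 * n) z ≤
          (support (2 * n) (s'.A aM) + 2 * support (2 * n) (s.A aX)) * (8 * k) + 10 * n) ∧
      s'.clk ≤ s.clk + (2 * n + m) * (800 * (32 * (k * k) + 1))) s := by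
  have hn := hW.n_pos
  rw [Prog.rebuild, wp_seq]
  refine (Prog.auction_spec hW hs hE).conseq ?_
  rintro s₁ ⟨hA, ⟨z, z1, z2, z3⟩, c1⟩ hf₁
  have hs₁ := hs.frame hf₁ (by decide)
  obtain ⟨χ, hχ⟩ := hE.joins_bip
  have ht : Trails (2 * n) χ (s₁.A aO) := by
    refine ⟨fun u hu x hx => (hA.ob_ok u hu x hx).1, fun u hu w hw x h1 h2 => ?_,
      fun u hu x hx => hχ _ _ (hA.ob_ok u hu x hx).2.2⟩
    have e1 := (hA.ob_ok u hu x h1).2.1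
    have e2 := (hA.ob_ok w hw x h2).2.1
    omega
  refine (Prog.extract_spec hW hs₁ (r := Joins (s.A aX) (s.A aU) (s.A aV) m) ht hA.ho_ok
    (fun u hu x hx => (hA.ob_ok u hu x hx).2.1)
    (fun u hu x hx => ⟨(hA.ob_ok u hu x hx).2.2, (hA.ob_ok u hu x hx).2.2.symm⟩)).mono ?_
  rintro s₂ ⟨hM, hsup, c2⟩
  refine ⟨hM, ⟨z, z1, z2, z3.trans ?_⟩, ?_⟩
  · have e := Nat.mul_le_mul_right (8 * k) hsup
    rw [add_mul, show ∀ a, 2 * a * (8 * k) = a * (16 * k) by intro a; ring]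
    omega
  · have e1 : 300 * (2 * n + m) * (32 * (k * k) + 1) =
        300 * ((2 * n + m) * (32 * (k * k)) + (2 * n + m)) := by ring
    have e2 : (2 * n + m) * (800 * (32 * (k * k) + 1)) =
        800 * ((2 * n + m) * (32 * (k * k)) + (2 * n + m)) := by ring
    omega

/-- The invariant of the data structure. There have been `ph` changes of the threshold. The field
`size` says that the matching is large enough as long as the sum of the cover does not exceed the
threshold; there, a deleted vertex counts as much as two matched ones. The field `pot` bounds the number of rounds since the last of them: every cover that is smaller than the
threshold by `2 * n` has come closer by `2 * n` in each of these rounds. -/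
structure Good (L n k m ph : ℕ) (s : Store) : Prop where
  ready : Ready n k m s
  edges : EdgesOk n m L (s.A aX) (s.A aU) (s.A aV)
  le : ∀ v < 2 * n, s.A aY v ≤ 16 * k
  sum : s.v rS = total (2 * n) (s.A aY)
  cover : Covers (s.A aU) (s.A aV) m (16 * k) (s.A aY)
  mates : Mates (2 * n) (Joins (s.A aX) (s.A aU) (s.A aV) m) (s.A aM)
  size : 2 * s.v rT ≤
    16 * k * (support (2 * n) (s.A aM) + 2 * support (2 * n) (s.A aX)) + 32 * n
  count : s.v rc ≤ 16 * k * (16 * k)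
  pot : ∀ z : ℕ → ℕ, (∀ v < 2 * n, z v ≤ 16 * k) → Covers (s.A aU) (s.A aV) m (16 * k) z →
    total (2 * n) z + 2 * n ≤ s.v rT + 1 →
    dist2 (2 * n) (s.A aY) z + (s.v rc * (2 * n) : ℕ) ≤ (2 * n : ℕ) * ((16 * k : ℕ) * (16 * k : ℕ))
  phase : s.v rT = 4 * n * ph
  phase_le : ph ≤ 8 * k

/-- The work, per vertex and edge, that is charged to `ph` complete phases and `c` further
rounds. -/
def charge (k ph c : ℕ) : ℕ :=
  100 * (ph * (16 * k * (16 * k) + 1) + c) + 800 * (32 * (k * k) + 1) * ph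

/-- The sum of the cover is brought below the threshold. The clock is compared with the charge, so
that the running time telescopes over all updates. -/
theorem Prog.rounds_spec (hW : Sizes W L n k) {ph : ℕ} (hG : Good L n k m ph s) :
    Wp W L Prog.rounds (fun s' => ∃ ph', Good L n k m ph' s' ∧ s'.v rT ≥ s'.v rS ∧
      s'.clk + (2 * n + m) * charge k ph (s.v rc) ≤
        s.clk + (2 * n + m) * charge k ph' (s'.v rc) + 10) s := by
  have hn := hW.n_pos
  have hk := hW.k_pos
  have hbig := hW.big
  set R := 16 * k * (16 * k) with hR
  have hRk : R = 256 * (k * k) := by rw [hR]; ring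
  -- The threshold never exceeds `32 * (n * k)`, and at most `R` rounds are counted between two of its
  -- changes.
  refine wp_while (fun s' => ∃ ph', Good L n k m ph' s' ∧
      s'.clk + (2 * n + m) * charge k ph (s.v rc) ≤
        s.clk + (2 * n + m) * charge k ph' (s'.v rc))
    (fun s' => (32 * (n * k) - s'.v rT) * (R + 2) + (R - s'.v rc)) ⟨ph, hG, le_rfl⟩ ?_ ?_
  · rintro s' ⟨ph', hG', hc⟩ hf hlt
    have hS := hG'.sum
    have hSle := total_le hG'.le
    rw [show 2 * n * (16 * k) = 32 * (n * k) by ring] at hSle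
    rw [wp_seq]
    refine (Prog.decr_spec hW hG'.ready.tick hG'.sum).conseq ?_
    rintro s₁ ⟨d1, d2, d3⟩ hf₁
    have hs₁ := hG'.ready.tick.frame hf₁ (by decide)
    have u1 : s₁.A aU = s'.A aU := hf₁.arr (by decide)
    have v1 : s₁.A aV = s'.A aV := hf₁.arr (by decide)
    have x1 : s₁.A aX = s'.A aX := hf₁.arr (by decide)
    simp only [Store.tick_A, Store.tick_clk] at d1 d2 d3
    rw [wp_seq]
    refine (Prog.scan_spec hW hs₁ (by rw [x1, u1, v1]; exact hG'.edges)
      (fun v hv => by have := d1 v hv; have := hG'.le v hv; omega) d2).conseq ?_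
    rintro s₂ ⟨e1, e2, e3, e4, e5⟩ hf₂
    rw [u1, v1] at e2 e4
    have hs₂ := hs₁.frame hf₂ (by decide)
    have T2 : s₂.v rT = s'.v rT := (hf₂.v (by decide)).trans (hf₁.v (by decide))
    have C2 : s₂.v rc = s'.v rc := (hf₂.v (by decide)).trans (hf₁.v (by decide))
    have u2 : s₂.A aU = s'.A aU := (hf₂.arr (by decide)).trans u1
    have v2 : s₂.A aV = s'.A aV := (hf₂.arr (by decide)).trans v1
    have M2 : s₂.A aM = s'.A aM := (hf₂.arr (by decide)).trans (hf₁.arr (by decide))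
    have X2 : s₂.A aX = s'.A aX := (hf₂.arr (by decide)).trans (hf₁.arr (by decide))
    -- every small cover has come closer in this round
    have closer : ∀ z : ℕ → ℕ, (∀ v < 2 * n, z v ≤ 16 * k) →
        Covers (s'.A aU) (s'.A aV) m (16 * k) z → total (2 * n) z + 2 * n ≤ s'.v rT + 1 →
        dist2 (2 * n) (s₂.A aY) z + ((s'.v rc + 1) * (2 * n) : ℕ) ≤
          (2 * n : ℕ) * ((16 * k : ℕ) * (16 * k : ℕ)) := by
      intro z z1 z2 z3
      have a1 := hG'.pot z z1 z2 z3
      have a2 := dist2_decr (N := 2 * n) (s'.A aY) z (by omega)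
      have a3 : dist2 (2 * n) (s₁.A aY) z = dist2 (2 * n) (fun v => s'.A aY v - 1) z :=
        Finset.sum_congr rfl fun v hv => by rw [d1 v (Finset.mem_range.1 hv)]
      have a4 := e4 z z2
      push_cast at a1 a2 ⊢
      linarith
    have hcount := hG'.count
    rw [wp_seq, wp_add, wp_ifLt]
    rw [hs₂.one, C2]
    refine ⟨by omega, ?_, ?_⟩
    · simp only [Store.set_v]
      simp [hs₂.vR]
      intro hgt
      have hcR : s'.v rc = R := by omega
      have hs₃ : Ready n k m (s₂.set rc (s'.v rc + 1)).tick := (hs₂.set (by omega)).tick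
      simp [hs₂.zero, T2, hs₂.vD]
      refine ⟨by omega, ?_⟩
      have hs₄ : Ready n k m (((s₂.set rc (s'.v rc + 1)).tick.set rc 0).set rT
          (s'.v rT + 4 * n)) := (hs₃.set (by omega)).set (by omega)
      refine (Prog.rebuild_spec hW hs₄ (by simpa [u2, v2, X2] using hG'.edges)).conseq ?_
      rintro s₅ ⟨b1, ⟨z, z1, z2, z3⟩, b4⟩ hf₅
      simp [u2, v2, X2] at b1 z2 z3 b4
      have u5 : s₅.A aU = s'.A aU := (hf₅.arr (by decide)).trans u2
      have v5 : s₅.A aV = s'.A aV := (hf₅.arr (by decide)).trans v2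
      have y5 : s₅.A aY = s₂.A aY := hf₅.arr (by decide)
      have x5 : s₅.A aX = s'.A aX := (hf₅.arr (by decide)).trans X2
      have S5 : s₅.v rS = s₂.v rS := hf₅.v (by decide)
      have T5 : s₅.v rT = s'.v rT + 4 * n := by rw [hf₅.v (by decide)]; simp
      have C5 : s₅.v rc = 0 := by rw [hf₅.v (by decide)]; simp
      -- no cover is small, in particular not the one found by the auction
      have hz : s'.v rT + 2 ≤ total (2 * n) z + 2 * n := by
        by_contra hcon
        have := closer z z1 z2 (by omega)
        have h0 := dist2_nonneg (2 * n) (s₂.A aY) z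
        rw [hcR, hR] at this
        push_cast at this
        have : (0 : ℤ) < n := by exact_mod_cast hn
        nlinarith
      have hph : ph' + 1 ≤ 8 * k := by
        have h1 := hG'.phase
        have h2 : 4 * n * ph' < 4 * n * (8 * k) := by
          rw [← h1, show 4 * n * (8 * k) = 32 * (n * k) by ring]
          omega
        exact Nat.lt_of_mul_lt_mul_left h2
      have hphase : s'.v rT + 4 * n = 4 * n * (ph' + 1) := by rw [hG'.phase]; ring
      have hTle : s'.v rT + 4 * n ≤ 32 * (n * k) := by
        rw [hphase, show 32 * (n * k) = 4 * n * (8 * k) by ring]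
        exact Nat.mul_le_mul_left _ hph
      refine ⟨⟨ph' + 1, ⟨hs₄.frame hf₅ (by decide), by rw [x5, u5, v5]; exact hG'.edges,
        by rw [y5]; exact e1, by rw [S5, y5]; exact e3, by rw [u5, v5, y5]; exact e2,
        by rw [x5, u5, v5]; exact b1, ?_, by rw [C5]; omega, ?_,
        by rw [T5]; exact hphase, hph⟩, ?_⟩, ?_⟩
      · rw [T5, x5]
        rw [show ∀ a, 16 * k * a = 2 * (a * (8 * k)) by intro a; ring]
        omega
      · intro z z1 z2 z3
        rw [C5, y5]
        have := dist2_le e1 z1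
        push_cast at this ⊢
        linarith
      · rw [C5]
        have ch : charge k (ph' + 1) 0 = charge k ph' (s'.v rc) + 100 + 800 * (32 * (k * k) + 1) := by
          rw [charge, charge, hcR, ← hR]; ring
        rw [ch, mul_add (2 * n + m), mul_add (2 * n + m)]
        omega
      · rw [T5, C5]
        have : 32 * (n * k) - s'.v rT = (32 * (n * k) - (s'.v rT + 4 * n)) + 4 * n := by omega
        rw [this, add_mul]
        have := Nat.mul_le_mul_right (R + 2) (show 1 ≤ 4 * n by omega)
        omega
    · simp [hs₂.vR]
      intro hle
      refine ⟨⟨ph', ⟨(hs₂.set (by omega)).tick, by simpa [u2, v2, X2] using hG'.edges,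
        by simpa using e1, by simpa using e3, by simpa [u2, v2] using e2,
        by simpa [u2, v2, M2, X2] using hG'.mates,
        by simpa [T2, X2, M2] using hG'.size, by simpa using hle, ?_,
        by simpa [T2] using hG'.phase, hG'.phase_le⟩, ?_⟩, ?_⟩
      · intro z z1 z2 z3
        simp [T2] at z3
        simp [u2, v2] at z2
        have := closer z z1 z2 z3
        simpa using this
      · have ch : charge k ph' (s'.v rc + 1) = charge k ph' (s'.v rc) + 100 := by
          rw [charge, charge]; ring
        simp only [ch, mul_add (2 * n + m)]
        omega
      · rw [T2]
        omega
  · rintro s' ⟨ph', hG', hc⟩ hf hlt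
    refine ⟨ph', ⟨hG'.ready.tick, hG'.edges, hG'.le, hG'.sum, hG'.cover, hG'.mates,
      hG'.size, hG'.count, hG'.pot, hG'.phase, hG'.phase_le⟩, ?_, ?_⟩
    · simp; omega
    · simp; omega

theorem Joins.update {dd eu ev : ℕ → ℕ} {u v a b : ℕ} (h : Joins dd eu ev m a b) :
    Joins dd (Function.update eu m u) (Function.update ev m v) (m + 1) a b := by
  obtain ⟨i, hi, h⟩ := h
  exact ⟨i, by omega, by rwa [Function.update_of_ne (by omega), Function.update_of_ne (by omega)]⟩

theorem Mates.imp {N : ℕ} {r r' : ℕ → ℕ → Prop} {mt : ℕ → ℕ} (h : Mates N r mt)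
    (hr : ∀ a b, mt a ≠ 0 → mt b ≠ 0 → r a b → r' a b) : Mates N r' mt := by
  intro u hu
  rcases h u hu with h | ⟨x, hx, e1, e2, e3⟩
  · exact .inl h
  · exact .inr ⟨x, hx, e1, e2, hr _ _ (by omega) (by omega) e3⟩

/-- The new edge restricts the covers that occur in `Good.pot`, and the reflection does not move away
from any of the remaining ones. -/
theorem Prog.insert_spec (hW : Sizes W L n k) {ph : ℕ} (hG : Good L n k m ph s)
    (hE : EdgesOk n (m + 1) L (s.A aX) (Function.update (s.A aU) m (s.v rX))
      (Function.update (s.A aV) m (s.v rY))) :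
    Wp W L Prog.insert (fun s' => ∃ ph', Good L n k (m + 1) ph' s' ∧ s'.v rS ≤ s'.v rT ∧
      s'.A aU = Function.update (s.A aU) m (s.v rX) ∧
      s'.A aV = Function.update (s.A aV) m (s.v rY) ∧ s'.A aX = s.A aX ∧
      s'.clk + (2 * n + (m + 1)) * charge k ph (s.v rc) ≤
        s.clk + (2 * n + (m + 1)) * charge k ph' (s'.v rc) + 50) s := by
  have hs := hG.ready
  have hlt := hE.lt
  have hLW := hW.L_lt
  have hu : s.v rX < 2 * n := by simpa using hE.u m (by omega)
  have hv : s.v rY < 2 * n := by simpa using hE.v m (by omega)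
  have huv : s.v rX ≠ s.v rY := by simpa using hE.ne m (by omega)
  simp only [Prog.insert, wp_seq, wp_write, wp_add, wp_move]
  simp only [Store.set_v, Store.put_v, hs.vm, hs.one]
  refine ⟨by omega, by omega, by omega, ?_⟩
  set s₁ := (((((s.put aU m (s.v rX)).put aV m (s.v rY)).set rm (m + 1)).set ru
    (Function.update s.v rm (m + 1) rX)).set rv
    (Function.update (Function.update s.v rm (m + 1)) ru (Function.update s.v rm (m + 1) rX) rY))
    with hs₁def
  have U1 : s₁.A aU = Function.update (s.A aU) m (s.v rX) := by simp [hs₁def]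
  have V1 : s₁.A aV = Function.update (s.A aV) m (s.v rY) := by simp [hs₁def]
  have Y1 : s₁.A aY = s.A aY := by simp [hs₁def]
  have M1 : s₁.A aM = s.A aM := by simp [hs₁def]
  have X1 : s₁.A aX = s.A aX := by simp [hs₁def]
  have ru1 : s₁.v ru = s.v rX := by simp [hs₁def]
  have rv1 : s₁.v rv = s.v rY := by simp [hs₁def]
  have S1 : s₁.v rS = s.v rS := by simp [hs₁def]
  have T1 : s₁.v rT = s.v rT := by simp [hs₁def]
  have C1 : s₁.v rc = s.v rc := by simp [hs₁def]
  have clk1 : s₁.clk = s.clk + 10 := by simp [hs₁def]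
  have hs₁ : Ready n k (m + 1) s₁ := by
    constructor <;> simp [hs₁def, hs.zero, hs.one, hs.vn, hs.vk, hs.vN, hs.vB, hs.vQ, hs.vR, hs.vD]
  have old : ∀ z : ℕ → ℕ, Covers (s₁.A aU) (s₁.A aV) (m + 1) (16 * k) z →
      Covers (s.A aU) (s.A aV) m (16 * k) z ∧ 16 * k ≤ z (s.v rX) + z (s.v rY) := by
    intro z hz
    rw [U1, V1] at hz
    refine ⟨fun i hi => ?_, by simpa using hz m (by omega)⟩
    have := hz i (by omega)
    rwa [Function.update_of_ne (by omega), Function.update_of_ne (by omega)] at this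
  refine (Prog.reflect_spec hW hs₁ (by rw [ru1]; exact hu) (by rw [rv1]; exact hv)
    (by rw [ru1, rv1]; exact huv) (by rw [Y1]; exact hG.le) (by rw [S1, Y1]; exact hG.sum)).conseq
    ?_
  rintro s₂ ⟨e1, e2, e3, e4, e5, e6⟩ hf₂
  rw [ru1, rv1] at e3 e5
  rw [Y1] at e2 e5
  have U2 : s₂.A aU = s₁.A aU := hf₂.arr (by decide)
  have V2 : s₂.A aV = s₁.A aV := hf₂.arr (by decide)
  have M2 : s₂.A aM = s.A aM := (hf₂.arr (by decide)).trans M1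
  have X2 : s₂.A aX = s.A aX := (hf₂.arr (by decide)).trans X1
  have T2 : s₂.v rT = s.v rT := (hf₂.v (by decide)).trans T1
  have C2 : s₂.v rc = s.v rc := (hf₂.v (by decide)).trans C1
  have hG₂ : Good L n k (m + 1) ph s₂ := by
    refine ⟨hs₁.frame hf₂ (by decide), by rw [X2, U2, V2, U1, V1]; exact hE, e1, e4, ?_, ?_, ?_, ?_,
      ?_, by rw [T2]; exact hG.phase, hG.phase_le⟩
    · rw [U2, V2, U1, V1]
      intro i hi
      by_cases him : i = m
      · subst him; simpa using e3
      · rw [Function.update_of_ne him, Function.update_of_ne him]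
        have a1 := hG.cover i (by omega)
        have a2 := e2 (s.A aU i)
        have a3 := e2 (s.A aV i)
        omega
    · rw [X2, U2, V2, U1, V1, M2]
      exact hG.mates.imp fun a b _ _ h => h.update
    · rw [T2, M2, X2]; exact hG.size
    · rw [C2]; exact hG.count
    · intro z z1 z2 z3
      rw [U2, V2] at z2
      obtain ⟨z4, z5⟩ := old z z2
      rw [C2]
      rw [T2] at z3
      have := hG.pot z z1 z4 z3
      have := e5 z z5
      linarith
  refine (Prog.rounds_spec hW hG₂).conseq ?_
  rintro s₃ ⟨ph', hG₃, hTS, hc⟩ hf₃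
  refine ⟨ph', hG₃, hTS, ?_, ?_, ?_, ?_⟩
  · rw [hf₃.arr (by decide), U2, U1]
  · rw [hf₃.arr (by decide), V2, V1]
  · rw [hf₃.arr (by decide), X2]
  · rw [C2] at hc
    omega

/-- Flagging the vertex keeps the invariant: the matching loses at most two matched vertices, and
there is one more deleted vertex. The cover does not change, as the pendant edge is still to be
inserted. -/
theorem Prog.kill_spec (hW : Sizes W L n k) {ph : ℕ} (hG : Good L n k m ph s)
    (hv : s.v rX < n) (hX : s.A aX (s.v rX) = 0) :
    Wp W L Prog.kill (fun s' => Good L n k m ph s' ∧ s'.v rX = s.v rX ∧ s'.v rY = s.v rX + n ∧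
      s'.A aU = s.A aU ∧ s'.A aV = s.A aV ∧ s'.A aX = Function.update (s.A aX) (s.v rX) 1 ∧
      s'.v rc = s.v rc ∧ s'.clk ≤ s.clk + 25) s := by
  have hLn := hW.index
  have hLW := hW.L_lt
  rw [Prog.kill, wp_seq]
  refine (Prog.unmatch_spec (by omega) hW hG.ready hG.mates (by omega)).conseq ?_
  rintro s₁ ⟨m1, m2, m3, m4, m5⟩ hf₁
  have hs₁ := hG.ready.frame hf₁ (by decide)
  have x1 : s₁.v rX = s.v rX := hf₁.v (by decide)
  have U1 : s₁.A aU = s.A aU := hf₁.arr (by decide)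
  have V1 : s₁.A aV = s.A aV := hf₁.arr (by decide)
  have Y1 : s₁.A aY = s.A aY := hf₁.arr (by decide)
  have X1 : s₁.A aX = s.A aX := hf₁.arr (by decide)
  have S1 : s₁.v rS = s.v rS := hf₁.v (by decide)
  have T1 : s₁.v rT = s.v rT := hf₁.v (by decide)
  have C1 : s₁.v rc = s.v rc := hf₁.v (by decide)
  simp only [wp_seq, wp_write, wp_add]
  simp only [Store.put_v, x1, hs₁.one, hs₁.vn]
  have h04 : (0 : ℕ) ≠ 4 := by decide
  have h14 : (1 : ℕ) ≠ 4 := by decide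
  have h24 : (2 : ℕ) ≠ 4 := by decide
  have hsup := support_update (N := 2 * n) (u := s.v rX) (by omega) (s.A aX) 1
  rw [hX] at hsup
  simp at hsup
  refine ⟨by omega, by omega, ⟨?_, ?_,
    by simpa [Y1] using hG.le, by simpa [Y1, S1] using hG.sum,
    by simpa [U1, V1, Y1] using hG.cover, ?_, ?_,
    by simpa [C1] using hG.count, ?_, by simpa [T1] using hG.phase, hG.phase_le⟩, ?_⟩
  · constructor <;> simp [hs₁.zero, hs₁.one, hs₁.vn, hs₁.vk, hs₁.vN, hs₁.vB, hs₁.vQ, hs₁.vR, hs₁.vD,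
      hs₁.vm]
  · obtain ⟨χ, hχ⟩ := hG.edges.bip
    refine ⟨hG.edges.lt, by simpa [U1] using hG.edges.u, by simpa [V1] using hG.edges.v,
      by simpa [U1, V1] using hG.edges.ne, χ, fun i hi => ?_⟩
    simp only [Store.set_A, Store.put_A, Function.update_self,
      Function.update_of_ne h14, Function.update_of_ne h24, U1, V1, X1]
    intro h1 h2
    refine hχ i hi ?_ ?_
    · by_cases h : s.A aU i = s.v rX
      · rw [h]; exact hX
      · rwa [Function.update_of_ne h] at h1
    · by_cases h : s.A aV i = s.v rX
      · rw [h]; exact hX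
      · rwa [Function.update_of_ne h] at h2
  · simp only [Store.set_A, Store.put_A, Function.update_self, Function.update_of_ne h04,
      Function.update_of_ne h14, Function.update_of_ne h24, U1, V1, X1]
    refine m1.imp fun a b ha hb hab => ?_
    have ha' : a ≠ s.v rX := by rintro rfl; exact ha m2
    have hb' : b ≠ s.v rX := by rintro rfl; exact hb m2
    obtain ⟨i, hi, h1, h2, h3⟩ := hab
    refine ⟨i, hi, ?_, ?_, h3⟩
    · rw [Function.update_of_ne]
      · exact h1
      · rcases h3 with h | h <;> omega
    · rw [Function.update_of_ne]
      · exact h2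
      · rcases h3 with h | h <;> omega
  · have h1 := hG.size
    simp [X1, T1, hsup]
    refine h1.trans ?_
    have : support (2 * n) (s.A aM) + 2 * support (2 * n) (s.A aX) ≤
      support (2 * n) (s₁.A aM) + 2 * (support (2 * n) (s.A aX) + 1) := by omega
    have := Nat.mul_le_mul_left (16 * k) this
    omega
  · simpa [U1, V1, Y1, T1, C1] using hG.pot
  · simp [x1, U1, V1, X1, C1]
    omega

end Specs

/-! ### The machine program -/

section Machine

variable {w L n k m ph : ℕ} {h s : Store}

/-- Instructions executed at the beginning of each call. In the initial call, where register `0`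
holds zero and the jump is not taken, they compute the base
addresses `j * L` of the arrays, where `L = (2 * n + 2) ^ 2`. -/
def Prog.prelude : List Instr :=
  [.const 59 0, .jlt 59 0 15, .const 60 2, .add 61 1 1, .add 61 61 60, .mul 61 61 61, .const 40 0,
    .add 41 40 61, .add 42 41 61, .add 43 42 61, .add 44 43 61, .add 45 44 61, .add 46 45 61,
    .add 47 46 61, .add 48 47 61]

/-- The machine program. -/
def Prog.machine : Program := Prog.prelude ++ Prog.main.code 15

/-- Put a request into the variables `0`, `1`, `2`. The clock is charged for the two instructions of
the prelude that are executed in an update. -/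
def Store.call (h : Store) (op x y : ℕ) : Store :=
  ⟨Function.update (Function.update (Function.update h.v 0 op) 1 x) 2 y, h.A, h.clk + 2⟩

theorem Prog.prelude_getElem? {i : ℕ} {I : Instr} (h : Prog.prelude[i]? = some I) :
    Prog.machine[i]? = some I := by
  obtain ⟨hi, _⟩ := List.getElem?_eq_some_iff.1 h
  rw [Prog.machine, List.getElem?_append_left hi, h]

/-- From address `15` on, the machine simulates the structured program. -/
theorem Prog.run_main (hL : 9 * L ≤ 2 ^ w) {s : State} {Q : Store → Prop} (hpc : s.pc = 15)
    (hr : Represents w L h s) (hw : Wp (2 ^ w) L Prog.main Q h) :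
    ∃ t s' h', RunsTo Prog.machine w s t s' ∧ Represents w L h' s' ∧ Q h' ∧
      h.clk + t ≤ h'.clk := by
  obtain ⟨h', hb, hQ⟩ := hw
  obtain ⟨t, s', hs, hp, hr', ht⟩ := hb.simulate hL (P := Prog.machine) s Prog.main_ok
    (by rw [hpc]; exact ⟨Prog.prelude, [], by simp [Prog.machine], rfl⟩) hr
  refine ⟨t, s', h', ?_, hr', hQ, ht⟩
  have := hs 0 s' (RunsTo.halt s' ?_)
  · simpa using this
  · rw [hp, hpc, List.getElem?_eq_none_iff, Prog.machine, List.length_append,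
      show Prog.prelude.length = 15 from rfl]

/-- A call for an update: the prelude jumps to the simulation of the structured program. -/
theorem Prog.run_update (hL : 9 * L ≤ 2 ^ w) {s : State} {Q : Store → Prop} {op x y : ℕ}
    (hr : Represents w L h s) (hop : 0 < op) (hop' : op < 2 ^ w) (hx : x < 2 ^ w) (hy : y < 2 ^ w)
    (hw : Wp (2 ^ w) L Prog.main Q (h.call op x y)) :
    ∃ t s' h', RunsTo Prog.machine w (s.call op x y) t s' ∧ Represents w L h' s' ∧ Q h' ∧
      h.clk + t ≤ h'.clk := by
  have e1 : Prog.machine[(s.call op x y).pc]? = some (.const 59 0) := Prog.prelude_getElem? rfl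
  set s₁ := Instr.exec w (s.call op x y) (.const 59 0) with hs₁
  have e2 : Prog.machine[s₁.pc]? = some (.jlt 59 0 15) := Prog.prelude_getElem? rfl
  set s₂ := Instr.exec w s₁ (.jlt 59 0 15) with hs₂
  have hpc : s₂.pc = 15 := by
    simp [hs₂, hs₁, Instr.exec, State.setReg, State.call, hop]
  have hr₂ : Represents w L (h.call op x y) s₂ := by
    refine ⟨fun r hr' => ?_, fun j hj => ?_, hr.mem, fun r => ?_, hr.mem_lt⟩
    · have h59 : r ≠ 59 := by omega
      simp only [hs₂, hs₁, Instr.exec, State.setReg, State.call, Store.call,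
        Function.update_of_ne h59]
      simp only [Function.update_apply, hr.reg r hr']
    · simp only [hs₂, hs₁, Instr.exec, State.setReg, State.call]
      rw [Function.update_of_ne (by omega), Function.update_of_ne (by omega),
        Function.update_of_ne (by omega), Function.update_of_ne (by omega)]
      exact hr.base j hj
    · simp only [hs₂, hs₁, Instr.exec, State.setReg, State.call, Function.update_apply]
      have := hr.reg_lt r
      split_ifs <;> simp <;> assumption
  obtain ⟨t, s', h', hrun, hr', hQ, ht⟩ := Prog.run_main hL hpc hr₂ hw
  refine ⟨1 + 1 + t, s', h', ((Steps.single e1).trans (Steps.single e2)) t s' hrun, hr', hQ, ?_⟩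
  simp only [Store.call] at ht
  omega

/-- The store in the initial call, after the `15` instructions of the prelude. -/
def Store.start (n k : ℕ) : Store :=
  ⟨fun r => if r = 1 then n else if r = 2 then k else 0, fun _ _ => 0, 15⟩

/-- Extend an execution by an instruction that assigns a word to a register. -/
theorem Steps.setReg {P : Program} {s : State} {t d x : ℕ} {I : Instr} {g f : ℕ → ℕ} {p : ℕ}
    (hs : Steps P w s t ⟨g, f, p⟩ ∧ ∀ r, g r < 2 ^ w) (hI : P[p]? = some I)
    (he : I.exec w ⟨g, f, p⟩ = State.setReg ⟨g, f, p⟩ w d x) (hx : x < 2 ^ w) :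
    Steps P w s (t + 1) ⟨Function.update g d x, f, p + 1⟩ ∧
      ∀ r, Function.update g d x r < 2 ^ w := by
  have := Steps.single (w := w) (s := ⟨g, f, p⟩) hI
  rw [he, State.setReg, Nat.mod_eq_of_lt hx] at this
  refine ⟨hs.1.trans this, fun r => ?_⟩
  rw [Function.update_apply]
  split_ifs
  · exact hx
  · exact hs.2 r

/-- The initial call: the prelude lays out the arrays, then the structured program is simulated. -/
theorem Prog.run_start (hLn : L = (2 * n + 2) * (2 * n + 2)) (hL : 9 * L ≤ 2 ^ w) {Q : Store → Prop}
    (hn : n < 2 ^ w) (hk : k < 2 ^ w) (hw : Wp (2 ^ w) L Prog.main Q (Store.start n k)) :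
    ∃ t s' h', RunsTo Prog.machine w (State.start n k) t s' ∧ Represents w L h' s' ∧ Q h' ∧
      t ≤ h'.clk := by
  have hnL : 2 * n + 2 ≤ L := by rw [hLn]; exact Nat.le_mul_self _
  set g₀ : ℕ → ℕ := fun r => if r = 1 then n else if r = 2 then k else 0 with hg₀
  have eq0 : State.start n k = ⟨g₀, fun _ => 0, 0⟩ := by
    simp only [State.start, State.zero, State.call, State.mk.injEq, and_true]
    funext r
    simp only [Function.update_apply, hg₀]
    split_ifs <;> first | rfl | omega
  have s0 : Steps Prog.machine w (State.start n k) 0 ⟨g₀, fun _ => 0, 0⟩ ∧ ∀ r, g₀ r < 2 ^ w := by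
    refine ⟨by rw [eq0]; exact Steps.refl _ _ _, fun r => ?_⟩
    simp only [hg₀]
    split_ifs <;> omega
  have s1 := Steps.setReg (x := 0) (d := 59) s0 (Prog.prelude_getElem? rfl) rfl (by omega)
  have s2 := And.intro (s1.1.trans (Steps.single (I := .jlt 59 0 15) (Prog.prelude_getElem? rfl)))
    s1.2
  have s3 := Steps.setReg (x := 2) (d := 60) s2 (Prog.prelude_getElem? rfl) rfl (by omega)
  have s4 := Steps.setReg (x := n + n) (d := 61) s3 (Prog.prelude_getElem? rfl) (by simp [Instr.exec, hg₀])
    (by omega)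
  have s5 := Steps.setReg (x := n + n + 2) (d := 61) s4 (Prog.prelude_getElem? rfl)
    (by simp [Instr.exec]) (by omega)
  have s6 := Steps.setReg (x := L) (d := 61) s5 (Prog.prelude_getElem? rfl)
    (by simp [Instr.exec, hLn, two_mul]) (by omega)
  have s7 := Steps.setReg (x := 0) (d := 40) s6 (Prog.prelude_getElem? rfl) rfl (by omega)
  have s8 := Steps.setReg (x := L) (d := 41) s7 (Prog.prelude_getElem? rfl)
    (by simp [Instr.exec]) (by omega)
  have s9 := Steps.setReg (x := 2 * L) (d := 42) s8 (Prog.prelude_getElem? rfl)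
    (by simp [Instr.exec]; congr 1; ring) (by omega)
  have s10 := Steps.setReg (x := 3 * L) (d := 43) s9 (Prog.prelude_getElem? rfl)
    (by simp [Instr.exec]; congr 1; ring) (by omega)
  have s11 := Steps.setReg (x := 4 * L) (d := 44) s10 (Prog.prelude_getElem? rfl)
    (by simp [Instr.exec]; congr 1; ring) (by omega)
  have s12 := Steps.setReg (x := 5 * L) (d := 45) s11 (Prog.prelude_getElem? rfl)
    (by simp [Instr.exec]; congr 1; ring) (by omega)
  have s13 := Steps.setReg (x := 6 * L) (d := 46) s12 (Prog.prelude_getElem? rfl)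
    (by simp [Instr.exec]; congr 1; ring) (by omega)
  have s14 := Steps.setReg (x := 7 * L) (d := 47) s13 (Prog.prelude_getElem? rfl)
    (by simp [Instr.exec]; congr 1; ring) (by omega)
  have s15 := Steps.setReg (x := 8 * L) (d := 48) s14 (Prog.prelude_getElem? rfl)
    (by simp [Instr.exec]; congr 1; ring) (by omega)
  obtain ⟨g, hg, hg', hlt, hs⟩ : ∃ g : ℕ → ℕ, (∀ r < 40, g r = g₀ r) ∧
      (∀ j < 9, g (40 + j) = j * L) ∧ (∀ r, g r < 2 ^ w) ∧
      Steps Prog.machine w (State.start n k) 15 ⟨g, fun _ => 0, 15⟩ := by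
    refine ⟨_, fun r hr => ?_, fun j hj => ?_, s15.2, s15.1⟩
    · simp only [Function.update_apply]
      repeat rw [if_neg (by omega)]
    · interval_cases j <;> simp
  have hr : Represents w L (Store.start n k) ⟨g, fun _ => 0, 15⟩ :=
    ⟨hg, hg', fun _ _ _ _ => rfl, hlt, fun _ => Nat.two_pow_pos w⟩
  obtain ⟨t, s', h', hrun, hr', hQ, ht⟩ := Prog.run_main hL rfl hr hw
  exact ⟨15 + t, s', h', hs t s' hrun, hr', hQ, ht⟩

end Machine

/-! ### Specification of the program -/

section Main

variable {W L n k m ph : ℕ} {s : Store}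

theorem Ready.congr_of_le {s' : Store} (h : Ready n k m s) (hv : ∀ r, 3 ≤ r → s'.v r = s.v r) :
    Ready n k m s' := by
  constructor <;> rw [hv _ (by omega)]
  exacts [h.zero, h.one, h.vn, h.vk, h.vN, h.vB, h.vQ, h.vR, h.vD, h.vm]

/-- The invariant does not depend on the request. -/
theorem Good.congr {s' : Store} (h : Good L n k m ph s) (hv : ∀ r, 3 ≤ r → s'.v r = s.v r)
    (hA : s'.A = s.A) : Good L n k m ph s' := by
  obtain ⟨h1, h2, h3, h4, h5, h6, h7, h8, h9, h10, h11⟩ := h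
  refine ⟨h1.congr_of_le hv, ?_, ?_, ?_, ?_, ?_, ?_, ?_, ?_, ?_, h11⟩
  all_goals
    simp only [hA, hv rT (by omega), hv rS (by omega), hv rc (by omega)]
    assumption

/-- The effect of the two instructions at the beginning of the program. -/
theorem Good.prepare (h : Good L n k m ph s) (op x y : ℕ) :
    Good L n k m ph (((s.call op x y).set rZ 0).set rO 1) := by
  refine h.congr (fun r hr => ?_) rfl
  have h3 := h.ready.zero
  have h4 := h.ready.one
  simp only [Store.set_v, Store.call, Function.update_apply]
  split_ifs <;> first | omega | simp_all

theorem Prog.main_setup (hW : Sizes W L n k) :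
    Wp W L Prog.main (fun s' => Good L n k 0 0 s' ∧ s'.v rS ≤ s'.v rT ∧ s'.v rc = 0 ∧
      (∀ i, s'.A aX i = 0) ∧ (∀ i, s'.A aM i = 0) ∧ s'.clk ≤ 50) (Store.start n k) := by
  have hbig := hW.big
  have hLW := hW.L_lt
  have hn := hW.n_pos
  have hk := hW.k_pos
  have e1 : 16 * k * (16 * k) = 256 * (k * k) := by ring
  have e2 : (16 * k : ℤ) * (16 * k) = 256 * (k * k) := by ring
  simp only [Prog.main, wp_seq, wp_const]
  refine ⟨by omega, by omega, ?_⟩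
  rw [wp_ifEq]
  refine ⟨fun _ => ?_, fun h0 => absurd rfl h0⟩
  simp [Prog.setup, Store.start]
  refine ⟨by omega, by omega, by omega, by omega, by nlinarith, by omega, ?_⟩
  refine ⟨?_, ⟨by have := hW.index; omega, by simp, by simp, by simp, fun _ => false, by simp⟩, by simp,
    by simp [total], fun i hi => absurd hi (Nat.not_lt_zero i), fun u hu => .inl rfl, by simp, by simp,
    fun z hz _ _ => ?_, by simp, by simp⟩
  · constructor <;> simp <;> ring
  · have := dist2_le (N := 2 * n) (Q := 16 * k) (y := fun _ => 0) (z := z) (by simp) hz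
    simpa using this

theorem Prog.main_insert (hW : Sizes W L n k) (hG : Good L n k m ph s) {x y : ℕ}
    (hE : EdgesOk n (m + 1) L (s.A aX) (Function.update (s.A aU) m x)
      (Function.update (s.A aV) m y)) :
    Wp W L Prog.main (fun s' => ∃ ph', Good L n k (m + 1) ph' s' ∧ s'.v rS ≤ s'.v rT ∧
      s'.A aU = Function.update (s.A aU) m x ∧ s'.A aV = Function.update (s.A aV) m y ∧
      s'.A aX = s.A aX ∧ s'.clk + (2 * n + (m + 1)) * charge k ph (s.v rc) ≤
        s.clk + (2 * n + (m + 1)) * charge k ph' (s'.v rc) + 100) (s.call 1 x y) := by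
  have hLW := hW.L_lt
  have hLn := hW.index
  have hn := hW.n_pos
  simp only [Prog.main, wp_seq, wp_const]
  refine ⟨by omega, by omega, ?_⟩
  rw [wp_ifEq]
  refine ⟨fun h0 => by simp [Store.call] at h0, fun _ => ?_⟩
  rw [wp_ifEq]
  refine ⟨fun _ => ?_, fun h0 => by simp [Store.call] at h0⟩
  have hG₁ : Good L n k m ph (((s.call 1 x y).set rZ 0).set rO 1).tick.tick :=
    (hG.prepare 1 x y).congr (fun _ _ => rfl) rfl
  refine (Prog.insert_spec hW hG₁ (by simpa [Store.call] using hE)).mono ?_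
  rintro s' ⟨ph', g1, g2, g3, g4, g5, g6⟩
  refine ⟨ph', g1, g2, by simpa [Store.call] using g3, by simpa [Store.call] using g4,
    by simpa [Store.call] using g5, ?_⟩
  simp [Store.call] at g6
  omega

theorem Prog.main_kill (hW : Sizes W L n k) (hG : Good L n k m ph s) {x y : ℕ}
    (hx : x < n) (hX : s.A aX x = 0)
    (hE : EdgesOk n (m + 1) L (Function.update (s.A aX) x 1) (Function.update (s.A aU) m x)
      (Function.update (s.A aV) m (x + n))) :
    Wp W L Prog.main (fun s' => ∃ ph', Good L n k (m + 1) ph' s' ∧ s'.v rS ≤ s'.v rT ∧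
      s'.A aU = Function.update (s.A aU) m x ∧ s'.A aV = Function.update (s.A aV) m (x + n) ∧
      s'.A aX = Function.update (s.A aX) x 1 ∧
      s'.clk + (2 * n + (m + 1)) * charge k ph (s.v rc) ≤
        s.clk + (2 * n + (m + 1)) * charge k ph' (s'.v rc) + 100) (s.call 2 x y) := by
  have hLW := hW.L_lt
  have hLn := hW.index
  have hn := hW.n_pos
  simp only [Prog.main, wp_seq, wp_const]
  refine ⟨by omega, by omega, ?_⟩
  rw [wp_ifEq]
  refine ⟨fun h0 => by simp [Store.call] at h0, fun _ => ?_⟩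
  rw [wp_ifEq]
  refine ⟨fun h0 => by simp [Store.call] at h0, fun _ => ?_⟩
  rw [wp_seq]
  set s₁ := (((s.call 2 x y).set rZ 0).set rO 1).tick.tick with hs₁
  have hG₁ : Good L n k m ph s₁ := (hG.prepare 2 x y).congr (fun _ _ => rfl) rfl
  have eX : s₁.v rX = x := by simp [hs₁, Store.call]
  have eA : s₁.A = s.A := rfl
  have ec : s₁.v rc = s.v rc := by simp [hs₁, Store.call]
  have ek : s₁.clk = s.clk + 12 := by simp [hs₁, Store.call]
  refine (Prog.kill_spec hW hG₁ (by rw [eX]; exact hx) (by rw [eX, eA]; exact hX)).mono ?_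
  rintro s₂ ⟨g1, g2, g3, g4, g5, g6, g7, g8⟩
  rw [eX] at g2 g3
  rw [eX, eA] at g6
  rw [eA] at g4 g5
  refine (Prog.insert_spec hW g1 (by rw [g2, g3, g4, g5, g6]; exact hE)).mono ?_
  rintro s' ⟨ph', i1, i2, i3, i4, i5, i6⟩
  refine ⟨ph', i1, i2, by rw [i3, g2, g4], by rw [i4, g3, g5], by rw [i5, g6], ?_⟩
  rw [g7, ec] at i6
  omega

end Main

/-! ### Matchings of the current graph -/

section Graph

variable {n m k L ph : ℕ} {dd eu ev y mt : ℕ → ℕ}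

/-- The arrays of edges and deleted vertices describe the dynamic graph `D`. Every deleted vertex
`v` has got a pendant edge to the extra vertex `v + n`, and no edge is stored twice. -/
structure Linked (D : DynGraph n) (m : ℕ) (dd eu ev : ℕ → ℕ) : Prop where
  alive : ∀ v : Fin n, v ∈ D.alive ↔ dd v = 0
  adj : ∀ u v : Fin n, D.graph.Adj u v ↔ Joins dd eu ev m u v
  high : ∀ v, n ≤ v → dd v = 0
  pendant : ∀ v < n, dd v ≠ 0 → ∃ i < m, eu i = v ∧ ev i = v + n
  shape : ∀ i < m, eu i < n ∧ (ev i < n ∨ ev i = eu i + n ∧ dd (eu i) ≠ 0)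
  ne : ∀ i < m, eu i ≠ ev i
  inj : ∀ i < m, ∀ j < m, eu i = eu j → ev i = ev j → i = j

theorem Linked.empty : Linked (DynGraph.empty n) 0 (fun _ => 0) eu ev := by
  constructor <;> simp [DynGraph.empty, Joins]

theorem Linked.card_le {D : DynGraph n} (h : Linked D m dd eu ev) : m ≤ n * (2 * n) := by
  have := Finset.card_le_card_of_injOn (s := Finset.range m)
    (t := Finset.range n ×ˢ Finset.range (2 * n)) (fun i => (eu i, ev i)) (fun i hi => by
      have := h.shape i (by simpa using hi)
      simp only [Finset.coe_product, Set.mem_prod, Finset.coe_range, Set.mem_Iio]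
      omega) (fun i hi j hj hij => by
      simp only [Prod.mk.injEq] at hij
      exact h.inj i (by simpa using hi) j (by simpa using hj) hij.1 hij.2)
  simpa using this

theorem Linked.edgesOk {D : DynGraph n} (h : Linked D m dd eu ev) (hb : D.graph.IsBipartite) :
    EdgesOk n m ((2 * n + 2) * (2 * n + 2)) dd eu ev := by
  obtain ⟨C⟩ := hb
  refine ⟨by have := h.card_le; nlinarith, fun i hi => by have := h.shape i hi; omega,
    fun i hi => by have := h.shape i hi; omega, h.ne,
    fun x => if hx : x < n then decide (C ⟨x, hx⟩ = 0) else false, fun i hi h1 h2 => ?_⟩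
  obtain ⟨hu, hv | hv⟩ := h.shape i hi
  · have hadj : D.graph.Adj ⟨eu i, hu⟩ ⟨ev i, hv⟩ :=
      (h.adj _ _).2 ⟨i, hi, h1, h2, .inl ⟨rfl, rfl⟩⟩
    have := C.valid hadj
    simp only [hu, hv, dite_true, ne_eq, decide_eq_decide]
    generalize C ⟨eu i, hu⟩ = a at *
    generalize C ⟨ev i, hv⟩ = b at *
    fin_cases a <;> fin_cases b <;> simp_all
  · exact absurd h1 hv.2

theorem Linked.insert {D : DynGraph n} (h : Linked D m dd eu ev) {u v : Fin n}
    (hD : D.Allows (.insertEdge u v)) : Linked (D.apply (.insertEdge u v)) (m + 1) dd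
      (Function.update eu m u) (Function.update ev m v) := by
  obtain ⟨hu, hv, huv, hadj⟩ := hD
  have du := (h.alive u).1 hu
  have dv := (h.alive v).1 hv
  have huv' : (u : ℕ) ≠ v := fun e => huv (Fin.ext e)
  have old : ∀ i < m, Function.update eu m u i = eu i ∧ Function.update ev m v i = ev i :=
    fun i hi => ⟨Function.update_of_ne (by omega) _ _, Function.update_of_ne (by omega) _ _⟩
  have new : ∀ i < m, eu i = u → ev i = v → False := fun i hi h1 h2 =>
    hadj ((h.adj u v).2 ⟨i, hi, by rw [h1, du], by rw [h2, dv], .inl ⟨h1, h2⟩⟩)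
  have cases : ∀ i < m + 1, i < m ∨ i = m := fun i hi => by omega
  refine ⟨h.alive, fun a b => ?_, h.high, fun a ha hd => ?_, fun i hi => ?_, fun i hi => ?_,
    fun i hi j hj => ?_⟩
  · rw [joins_succ]
    have hJ : Joins dd (Function.update eu m u) (Function.update ev m v) m a b ↔
        Joins dd eu ev m a b := by
      constructor <;> rintro ⟨i, hi, h'⟩ <;> refine ⟨i, hi, ?_⟩
      · rwa [(old i hi).1, (old i hi).2] at h'
      · rwa [(old i hi).1, (old i hi).2]
    rw [hJ, ← h.adj]
    simp only [DynGraph.apply, SimpleGraph.sup_adj, SimpleGraph.edge_adj, Function.update_self, du,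
      dv, true_and, Fin.ext_iff]
    by_cases hab : D.graph.Adj a b
    · simp [hab]
    · simp only [hab, false_or]
      omega
  · obtain ⟨i, hi, h1⟩ := h.pendant a ha hd
    exact ⟨i, by omega, by rwa [(old i hi).1, (old i hi).2]⟩
  · rcases cases i hi with hi | rfl
    · rw [(old i hi).1, (old i hi).2]; exact h.shape i hi
    · simp
  · rcases cases i hi with hi | rfl
    · rw [(old i hi).1, (old i hi).2]; exact h.ne i hi
    · simpa using huv'
  · rcases cases i hi with hi | rfl <;> rcases cases j hj with hj | rfl
    · rw [(old i hi).1, (old i hi).2, (old j hj).1, (old j hj).2]; exact h.inj i hi j hj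
    · rw [(old i hi).1, (old i hi).2, Function.update_self, Function.update_self]
      intro h1 h2
      exact absurd (new i hi h1 h2) id
    · rw [(old j hj).1, (old j hj).2, Function.update_self, Function.update_self]
      intro h1 h2
      exact absurd (new j hj h1.symm h2.symm) id
    · simp

theorem Linked.delete {D : DynGraph n} (h : Linked D m dd eu ev) {v : Fin n}
    (hD : D.Allows (.deleteVertex v)) : Linked (D.apply (.deleteVertex v)) (m + 1)
      (Function.update dd v 1) (Function.update eu m v) (Function.update ev m (v + n)) := by
  have dv := (h.alive v).1 hD
  have hvn := v.2
  have old : ∀ i < m, Function.update eu m v i = eu i ∧ Function.update ev m (v + n) i = ev i :=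
    fun i hi => ⟨Function.update_of_ne (by omega) _ _, Function.update_of_ne (by omega) _ _⟩
  have new : ∀ i < m, eu i = v → ev i = v + n → False := by
    intro i hi h1 h2
    rcases (h.shape i hi).2 with h3 | h3
    · omega
    · exact h3.2 (by rw [h1, dv])
  have cases : ∀ i < m + 1, i < m ∨ i = m := fun i hi => by omega
  have hd : ∀ a, Function.update dd v 1 a = 0 ↔ dd a = 0 ∧ a ≠ v := by
    intro a
    rw [Function.update_apply]
    split_ifs with e <;> simp [e]
  refine ⟨fun a => ?_, fun a b => ?_, fun a ha => (hd a).2 ⟨h.high a ha, by omega⟩,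
    fun a ha hda => ?_, fun i hi => ?_, fun i hi => ?_, fun i hi j hj => ?_⟩
  · rw [hd, ← h.alive]
    simp [DynGraph.apply, Fin.ext_iff]
  · rw [joins_succ]
    have hJ : Joins (Function.update dd v 1) (Function.update eu m v)
        (Function.update ev m (v + n)) m a b ↔ Joins dd eu ev m a b ∧ (a : ℕ) ≠ v ∧ (b : ℕ) ≠ v := by
      constructor
      · rintro ⟨i, hi, h1, h2, h3⟩
        rw [(old i hi).1, (old i hi).2] at h3
        rw [(old i hi).1, hd] at h1
        rw [(old i hi).2, hd] at h2
        exact ⟨⟨i, hi, h1.1, h2.1, h3⟩, by omega, by omega⟩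
      · rintro ⟨⟨i, hi, h1, h2, h3⟩, h4, h5⟩
        refine ⟨i, hi, ?_, ?_, by rwa [(old i hi).1, (old i hi).2]⟩
        · rw [(old i hi).1, hd]; exact ⟨h1, by omega⟩
        · rw [(old i hi).2, hd]; exact ⟨h2, by omega⟩
    rw [hJ, ← h.adj]
    simp [DynGraph.apply, SimpleGraph.deleteIncidenceSet_adj, Fin.ext_iff]
  · by_cases e : a = v
    · exact ⟨m, by omega, by simp [e], by simp [e]⟩
    · rw [Function.update_of_ne e] at hda
      obtain ⟨i, hi, h1⟩ := h.pendant a ha hda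
      exact ⟨i, by omega, by rwa [(old i hi).1, (old i hi).2]⟩
  · rcases cases i hi with hi | rfl
    · rw [(old i hi).1, (old i hi).2]
      refine (h.shape i hi).imp_right fun h' => h'.imp_right fun h'' => ⟨h''.1, fun e => ?_⟩
      exact h''.2 ((hd _).1 e).1
    · simp
  · rcases cases i hi with hi | rfl
    · rw [(old i hi).1, (old i hi).2]; exact h.ne i hi
    · simp; omega
  · rcases cases i hi with hi | rfl <;> rcases cases j hj with hj | rfl
    · rw [(old i hi).1, (old i hi).2, (old j hj).1, (old j hj).2]; exact h.inj i hi j hj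
    · rw [(old i hi).1, (old i hi).2, Function.update_self, Function.update_self]
      intro h1 h2
      exact absurd (new i hi h1 h2) id
    · rw [(old j hj).1, (old j hj).2, Function.update_self, Function.update_self]
      intro h1 h2
      exact absurd (new j hj h1.symm h2.symm) id
    · simp

theorem ncard_verts_eq {G : SimpleGraph (Fin n)} {M : G.Subgraph} (hM : M.IsMatching) :
    M.verts.ncard = 2 * M.edgeSet.ncard := by
  classical
  have key := M.spanningCoe.sum_degrees_eq_twice_card_edges
  have h1 : M.edgeSet.ncard = M.spanningCoe.edgeFinset.card := by
    rw [← Set.ncard_coe_finset, SimpleGraph.coe_edgeFinset, SimpleGraph.Subgraph.edgeSet_spanningCoe]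
  have h2 : ∑ v, M.spanningCoe.degree v = M.verts.ncard := by
    have : ∀ v, M.spanningCoe.degree v = if v ∈ M.verts then 1 else 0 := by
      intro v
      rw [SimpleGraph.Subgraph.degree_spanningCoe]
      split_ifs with hv
      · exact (SimpleGraph.Subgraph.isMatching_iff_forall_degree.1 hM) v hv
      · exact SimpleGraph.Subgraph.degree_of_notMem_verts hv
    rw [Finset.sum_congr rfl fun v _ => this v, Finset.sum_boole, Set.ncard_eq_toFinset_card']
    simp
  rw [← h2, h1, key]

/-- The sum of a function over the matched vertices counts each edge once. -/
theorem sum_mates {G : SimpleGraph (Fin n)} {M : G.Subgraph} (hM : M.IsMatching) (Q : ℕ)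
    (f : Fin n → ℕ) (hf : ∀ u v, M.Adj u v → Q ≤ f u + f v) (s : Finset (Fin n))
    (hs : ∀ v, v ∈ s ↔ v ∈ M.verts) : Q * s.card ≤ 2 * ∑ v ∈ s, f v := by
  have hmate : ∀ v ∈ s, ∃ w, M.Adj v w := fun v hv => (hM ((hs v).1 hv)).exists
  choose! g hg using hmate
  have hgs : ∀ v ∈ s, g v ∈ s := fun v hv => (hs _).2 (M.edge_vert (hg v hv).symm)
  have hgg : ∀ v ∈ s, g (g v) = v := fun v hv =>
    hM.eq_of_adj_left (hg _ (hgs v hv)) (hg v hv).symm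
  have e : ∑ v ∈ s, f (g v) = ∑ v ∈ s, f v :=
    Finset.sum_nbij' g g hgs hgs hgg hgg fun _ _ => rfl
  calc Q * s.card = ∑ v ∈ s, Q := by simp [mul_comm]
    _ ≤ ∑ v ∈ s, (f v + f (g v)) := Finset.sum_le_sum fun v hv => hf _ _ (hg v hv)
    _ = 2 * ∑ v ∈ s, f v := by rw [Finset.sum_add_distrib, e, two_mul]

theorem total_two_mul (n : ℕ) (y : ℕ → ℕ) :
    total (2 * n) y = ∑ v : Fin n, (y v + y (v + n)) := by
  rw [total, two_mul, Finset.sum_range_add, Finset.sum_add_distrib, Finset.sum_range,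
    Finset.sum_range]
  simp [add_comm]

theorem support_two_mul {f : ℕ → ℕ} (h : ∀ v, n ≤ v → v < 2 * n → f v = 0) (s : Finset (Fin n))
    (hs : ∀ v, v ∈ s ↔ f v ≠ 0) : support (2 * n) f = s.card := by
  rw [support]
  refine (Finset.card_nbij (fun v : Fin n => (v : ℕ)) ?_ ?_ ?_).symm
  · intro v hv
    simp only [Finset.coe_filter, Finset.mem_range, Set.mem_ofPred_eq]
    exact ⟨by omega, (hs v).1 hv⟩
  · intro a _ b _ hab
    exact Fin.ext hab
  · intro v hv
    simp only [Finset.coe_filter, Finset.mem_range, Set.mem_ofPred_eq] at hv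
    have hvn : v < n := by
      by_contra hge
      exact hv.2 (h v (by omega) hv.1)
    exact ⟨⟨v, hvn⟩, (hs _).2 hv.2, rfl⟩

/-- A matching whose size is close to half the sum of a cover is close to a maximum matching. -/
theorem Linked.exists_matching {D : DynGraph n} (h : Linked D m dd eu ev)
    (hM : Mates (2 * n) (Joins dd eu ev m) mt) (hy : Covers eu ev m (16 * k) y)
    (hle : 2 * total (2 * n) y ≤
      16 * k * (support (2 * n) mt + 2 * support (2 * n) dd) + 32 * n) :
    ∃ M : D.graph.Subgraph, M.IsMatching ∧ (∀ u v : Fin n, M.Adj u v → mt u = v + 1) ∧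
      (∀ u : Fin n, u ∉ M.verts → mt u = 0) ∧
      k * matchingNumber D.graph ≤ k * M.edgeSet.ncard + n := by
  classical
  have hlow : ∀ u v, Joins dd eu ev m u v → u < n ∧ v < n := by
    rintro u v ⟨i, hi, h1, h2, h3⟩
    have := h.shape i hi
    omega
  have hmt : ∀ u < 2 * n, mt u ≠ 0 → ∃ x, u < n ∧ x < n ∧ mt u = x + 1 ∧ mt x = u + 1 ∧
      Joins dd eu ev m u x := by
    intro u hu hne
    rcases hM u hu with h0 | ⟨x, hx, e1, e2, e3⟩
    · exact absurd h0 hne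
    · exact ⟨x, (hlow _ _ e3).1, (hlow _ _ e3).2, e1, e2, e3⟩
  let M : D.graph.Subgraph :=
    { verts := {u | mt u ≠ 0}
      Adj := fun u v => mt u = v + 1 ∧ mt v = u + 1
      adj_sub := by
        rintro u v ⟨h1, h2⟩
        obtain ⟨x, -, -, e1, -, e3⟩ := hmt u (by omega) (by omega)
        rw [h.adj]
        rwa [show (v : ℕ) = x by omega]
      edge_vert := by
        rintro u v ⟨h1, h2⟩
        simp only [Set.mem_ofPred_eq]
        omega
      symm := ⟨fun u v h => ⟨h.2, h.1⟩⟩ }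
  have hMM : M.IsMatching := by
    intro u hu
    obtain ⟨x, -, hx, e1, e2, e3⟩ := hmt u (by omega) hu
    refine ⟨⟨x, hx⟩, ⟨e1, e2⟩, ?_⟩
    rintro w ⟨w1, w2⟩
    refine Fin.ext ?_
    simp only
    omega
  refine ⟨M, hMM, fun u v h => h.1, fun u hu => by simpa [M] using hu, ?_⟩
  obtain ⟨M', hM', hcard⟩ : ∃ M' : D.graph.Subgraph, M'.IsMatching ∧
      M'.edgeSet.ncard = matchingNumber D.graph := by
    refine Nat.sSup_mem (s := {k : ℕ | ∃ M : D.graph.Subgraph, M.IsMatching ∧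
      M.edgeSet.ncard = k}) ⟨_, M, hMM, rfl⟩ ⟨Nat.card (Sym2 (Fin n)), ?_⟩
    rintro k ⟨M', -, rfl⟩
    exact Set.ncard_le_card _
  -- Sum the cover over the vertices of `M'` and over the pendant edges of deleted vertices.
  set V := Finset.univ.filter fun v : Fin n => v ∈ M.verts with hV
  set V' := Finset.univ.filter fun v : Fin n => v ∈ M'.verts with hV'
  set X := Finset.univ.filter fun v : Fin n => dd v ≠ 0 with hX
  have c1 : V.card = 2 * M.edgeSet.ncard := by
    rw [← ncard_verts_eq hMM, ← Set.ncard_coe_finset]; simp [hV]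
  have c2 : V'.card = 2 * M'.edgeSet.ncard := by
    rw [← ncard_verts_eq hM', ← Set.ncard_coe_finset]; simp [hV']
  have c3 : support (2 * n) mt = V.card := support_two_mul (fun v hv hv2 => by
    by_contra hne
    obtain ⟨_, h1, -⟩ := hmt v hv2 hne
    omega) V (by simp [hV, M])
  have c4 : support (2 * n) dd = X.card := support_two_mul (fun v hv _ => h.high v hv) X
    (by simp [hX])
  have alive : ∀ u v, M'.Adj u v → dd u = 0 := by
    intro u v huv
    obtain ⟨i, hi, h1, h2, ⟨h3, -⟩ | ⟨-, h3⟩⟩ := (h.adj u v).1 (M'.adj_sub huv)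
    · rwa [← h3]
    · rwa [← h3]
  have b1 := sum_mates hM' (16 * k) (fun v => y v) (fun u v huv => by
    obtain ⟨i, hi, -, -, ⟨h3, h4⟩ | ⟨h3, h4⟩⟩ := (h.adj u v).1 (M'.adj_sub huv)
    · have := hy i hi; rwa [h3, h4] at this
    · have := hy i hi; rw [h3, h4] at this; omega) V' (by simp [hV'])
  have b2 : ∑ v ∈ V', y v + 16 * k * X.card ≤ total (2 * n) y := by
    rw [total_two_mul, hV', hX, Finset.sum_filter, Finset.card_filter, Finset.mul_sum,
      ← Finset.sum_add_distrib]
    refine Finset.sum_le_sum fun v _ => ?_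
    by_cases hd : dd v = 0
    · simp only [hd, ne_eq, not_true, if_false, mul_zero, add_zero]
      split_ifs <;> omega
    · have hv : v ∉ M'.verts := by
        intro hv
        obtain ⟨w, hw, -⟩ := hM' hv
        exact hd (alive v w hw)
      obtain ⟨i, hi, h1, h2⟩ := h.pendant v v.2 hd
      have := hy i hi
      rw [h1, h2] at this
      simp only [hd, hv, ne_eq, not_false_eq_true, if_true, if_false, mul_one, zero_add]
      exact this
  rw [c3, c4, c1] at hle
  rw [c2] at b1
  rw [← hcard]
  nlinarith

end Graph

/-! ### Running the machine on an update sequence -/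

section Run

variable {n k w : ℕ}

/-- The length of the arrays. -/
def arrayLength (n : ℕ) : ℕ := (2 * n + 2) * (2 * n + 2)

/-- After the updates `τ`, the machine state `s` represents the store `h`, which satisfies the
invariants of the data structure for the current graph. The field `time` bounds the running
time so far. -/
structure Tracks (w k : ℕ) (τ : List (Update n)) (h : Store) (s : State) : Prop where
  rep : Represents w (arrayLength n) h s
  good : ∃ ph, Good (arrayLength n) n k τ.length ph h ∧
    h.clk ≤ 100 * (τ.length + 1) + (2 * n + τ.length) * charge k ph (h.v rc)
  le : h.v rS ≤ h.v rT
  linked : Linked (graphAfter τ) τ.length (h.A aX) (h.A aU) (h.A aV)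
  deleted : numInsertions τ + support (2 * n) (h.A aX) = τ.length

theorem graphAfter_append (τ : List (Update n)) (u : Update n) :
    graphAfter (τ ++ [u]) = (graphAfter τ).apply u := by
  simp [graphAfter]

theorem numInsertions_append (τ : List (Update n)) (u : Update n) :
    numInsertions (τ ++ [u]) = numInsertions τ + if u.isInsertion then 1 else 0 := by
  simp [numInsertions, List.countP_singleton]

theorem Tracks.holdsMatching {τ : List (Update n)} {h : Store} {s : State} {ε : ℝ}
    (hT : Tracks w k τ h s) (hk : 1 ≤ k) (hε : 1 ≤ ε * k) :
    HoldsMatching (graphAfter τ).graph (ε * n) s := by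
  obtain ⟨ph, hG, -⟩ := hT.good
  obtain ⟨M, hM, h1, h2, h3⟩ := hT.linked.exists_matching (k := k) hG.mates hG.cover (by
    have := hG.size
    have := hT.le
    have := hG.sum
    omega)
  have hmem : ∀ u : Fin n, s.mem u = h.A aM u := by
    intro u
    have := hT.rep.mem 0 (by omega) u (by unfold arrayLength; nlinarith [u.2])
    simpa using this
  refine ⟨M, hM, ⟨fun u v huv => by rw [hmem, h1 u v huv], fun u hu => by rw [hmem, h2 u hu]⟩, ?_⟩
  have hk' : (1 : ℝ) ≤ k := by exact_mod_cast hk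
  have h4 : (k : ℝ) * matchingNumber (graphAfter τ).graph ≤ k * M.edgeSet.ncard + n := by
    exact_mod_cast h3
  have h5 : (n : ℝ) ≤ k * (ε * n) := by
    have : (0 : ℝ) ≤ n := Nat.cast_nonneg n
    nlinarith
  nlinarith

/-- The word size suffices. -/
structure Word (w n k : ℕ) : Prop where
  sizes : Sizes (2 ^ w) (arrayLength n) n k
  arrays : 9 * arrayLength n ≤ 2 ^ w
  n_lt : n < 2 ^ w
  k_lt : k < 2 ^ w
  two_lt : 2 < 2 ^ w

theorem Word.of_pow_le (hn : 1 ≤ n) (hk : 2 ≤ k) (h : (n + k) ^ 10 ≤ 2 ^ w) : Word w n k := by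
  have h3 : 3 ≤ n + k := by omega
  have h4 : (n + k) * (n + k) * 3 ^ 8 ≤ 2 ^ w := by
    refine le_trans ?_ h
    rw [show (n + k) ^ 10 = (n + k) * (n + k) * (n + k) ^ 8 by ring]
    exact Nat.mul_le_mul_left _ (Nat.pow_le_pow_left h3 8)
  have h5 : 3 * (n + k) ≤ (n + k) * (n + k) := Nat.mul_le_mul_right _ h3
  have e1 : (n + k) * (n + k) = n * n + 2 * (n * k) + k * k := by ring
  have e2 : arrayLength n = 4 * (n * n) + 8 * n + 4 := by unfold arrayLength; ring
  rw [e1] at h4 h5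
  norm_num at h4
  refine ⟨⟨hn, by omega, ?_, ?_, ?_⟩, ?_, ?_, ?_, ?_⟩ <;> (try rw [e2]) <;> omega

theorem Tracks.start (hw : Word w n k) : ∃ t s h,
    RunsTo Prog.machine w (State.start n k) t s ∧ Tracks w k ([] : List (Update n)) h s ∧
      t ≤ h.clk := by
  obtain ⟨t, s, h, h1, h2, ⟨g1, g2, g3, g4, g5, g6⟩, h3⟩ :=
    Prog.run_start rfl hw.arrays hw.n_lt hw.k_lt (Prog.main_setup hw.sizes)
  have hX : h.A aX = fun _ => 0 := funext g4
  refine ⟨t, s, h, h1, ⟨h2, ⟨0, g1, ?_⟩, g2, ?_, ?_⟩, h3⟩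
  · simp only [List.length_nil]
    omega
  · rw [hX]
    exact Linked.empty
  · rw [hX]
    simp [numInsertions, support]

theorem Tracks.update (hw : Word w n k) {τ : List (Update n)} {u : Update n} {h : Store}
    {s : State} (hT : Tracks w k τ h s) (hu : (graphAfter τ).Allows u)
    (hb : ((graphAfter τ).apply u).graph.IsBipartite) : ∃ t s' h',
      RunsTo Prog.machine w (s.feed u) t s' ∧ Tracks w k (τ ++ [u]) h' s' ∧ h.clk + t ≤ h'.clk := by
  obtain ⟨ph, hG, hclk⟩ := hT.good
  have hn := hw.n_lt
  have h2 := hw.two_lt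
  -- An update adds one stored edge, so its charge may be computed with the new number of edges.
  have bound : ∀ c c' x x' m : ℕ, x ≤ 100 * (m + 1) + (2 * n + m) * c →
      x' + (2 * n + (m + 1)) * c ≤ x + (2 * n + (m + 1)) * c' + 100 →
      x' ≤ 100 * (m + 1 + 1) + (2 * n + (m + 1)) * c' := by
    intro c c' x x' m h1 h2
    have e : (2 * n + (m + 1)) * c = (2 * n + m) * c + c := by ring
    omega
  cases u with
  | insertEdge u v =>
    have hL := hT.linked.insert hu
    obtain ⟨t, s', h', r1, r2, ⟨ph', g1, g2, g3, g4, g5, g6⟩, r3⟩ :=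
      Prog.run_update hw.arrays hT.rep (op := 1) (x := u) (y := v) (by omega) (by omega)
        (by omega) (by omega) (Prog.main_insert hw.sizes hG (hL.edgesOk hb))
    refine ⟨t, s', h', r1, ⟨r2, ⟨ph', by simpa using g1, ?_⟩, g2, ?_, ?_⟩, r3⟩
    · simpa using bound _ _ _ _ _ hclk g6
    · rw [g3, g4, g5, graphAfter_append]
      simpa using hL
    · rw [g5, numInsertions_append]
      have := hT.deleted
      simp [Update.isInsertion]
      omega
  | deleteVertex v =>
    have hL := hT.linked.delete hu
    have hv := (hT.linked.alive v).1 hu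
    obtain ⟨t, s', h', r1, r2, ⟨ph', g1, g2, g3, g4, g5, g6⟩, r3⟩ :=
      Prog.run_update hw.arrays hT.rep (op := 2) (x := v) (y := 0) (by omega) (by omega)
        (by omega) (by omega) (Prog.main_kill hw.sizes hG v.2 hv (hL.edgesOk hb))
    refine ⟨t, s', h', r1, ⟨r2, ⟨ph', by simpa using g1, ?_⟩, g2, ?_, ?_⟩, r3⟩
    · simpa using bound _ _ _ _ _ hclk g6
    · rw [g3, g4, g5, graphAfter_append]
      simpa using hL
    · rw [g5, numInsertions_append]
      have := hT.deleted
      have hs := support_update (N := 2 * n) (u := v) (by omega) (h.A aX) 1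
      simp [hv] at hs
      simp [Update.isInsertion, hs]
      omega

/-- The number of operations, up to constants, is `(n + m) * k ^ 3`. -/
theorem Tracks.clk_le {τ : List (Update n)} {h : Store} {s : State} (hT : Tracks w k τ h s)
    (hn : 1 ≤ n) (hk : 1 ≤ k) : h.clk ≤ 2000000 * (k ^ 3 * (n + numInsertions τ)) := by
  obtain ⟨ph, hG, hclk⟩ := hT.good
  have hX : support (2 * n) (h.A aX) ≤ n := by
    rw [support_two_mul (fun v hv _ => hT.linked.high v hv)
      (Finset.univ.filter fun v : Fin n => h.A aX v ≠ 0) (by simp)]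
    exact (Finset.card_le_univ _).trans_eq (Fintype.card_fin n)
  have hdel := hT.deleted
  have k1 : 1 ≤ k ^ 3 := Nat.one_le_pow _ _ hk
  have hch : charge k ph (h.v rc) ≤ 500000 * k ^ 3 := by
    have h1 : k ≤ k ^ 3 := Nat.le_self_pow (by omega) k
    have h2 : k ^ 2 ≤ k ^ 3 := Nat.pow_le_pow_right hk (by omega)
    calc charge k ph (h.v rc)
        ≤ 100 * (8 * k * (16 * k * (16 * k) + 1) + 16 * k * (16 * k)) +
            800 * (32 * (k * k) + 1) * (8 * k) := by
          have := hG.phase_le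
          have := hG.count
          unfold charge
          gcongr
      _ = 409600 * k ^ 3 + 25600 * k ^ 2 + 7200 * k := by ring
      _ ≤ 500000 * k ^ 3 := by omega
  calc h.clk ≤ 100 * (τ.length + 1) + (2 * n + τ.length) * (500000 * k ^ 3) :=
        hclk.trans (by gcongr)
    _ ≤ 200 * (n + numInsertions τ) * k ^ 3 + 3 * (n + numInsertions τ) * (500000 * k ^ 3) := by
        have h3 := Nat.mul_le_mul_left (200 * (n + numInsertions τ)) k1
        have h4 := Nat.mul_le_mul_right (500000 * k ^ 3)
          (show 2 * n + τ.length ≤ 3 * (n + numInsertions τ) by omega)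
        omega
    _ ≤ 2000000 * (k ^ 3 * (n + numInsertions τ)) := by
        have : 200 * (n + numInsertions τ) * k ^ 3 + 3 * (n + numInsertions τ) * (500000 * k ^ 3) =
          1500200 * (k ^ 3 * (n + numInsertions τ)) := by ring
        omega

end Run

end DynMatching

theorem mainTheorem2 :
    ∃ (P : DynMatching.Program) (c : ℕ) (C : ℝ),
      ∀ ε : ℝ, 0 < ε → ε < 1 →
      ∀ n : ℕ, 1 ≤ n →
      ∀ w : ℕ, (n + ⌈1 / ε⌉₊) ^ c ≤ 2 ^ w →
      ∀ σ : List (DynMatching.Update n), DynMatching.IsLegal σ →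
        ∃ T : ℕ,
          DynMatching.MaintainsMatching P w n ⌈1 / ε⌉₊ (ε * n) σ T ∧
          (T : ℝ) ≤ C * (n / ε ^ 8 + DynMatching.numInsertions σ / ε ^ 5) := by
  open DynMatching in
  refine ⟨Prog.machine, 10, 16000000, fun ε hε hε1 n hn w hw σ hσ => ?_⟩
  have hinv : 1 < 1 / ε := by rw [lt_div_iff₀ hε]; linarith
  set k := ⌈1 / ε⌉₊ with hkdef
  have hk : 2 ≤ k := by
    have : 1 < k := Nat.lt_ceil.2 (by simpa using hinv)
    omega
  have hkε : 1 ≤ ε * k := by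
    have := Nat.le_ceil (1 / ε)
    rw [div_le_iff₀ hε] at this
    linarith
  have hkε2 : ε * k ≤ 2 := by
    have := (Nat.ceil_lt_add_one (by positivity : 0 ≤ 1 / ε)).le
    calc ε * k ≤ ε * (1 / ε + 1) := by gcongr
      _ = 1 + ε := by field_simp
      _ ≤ 2 := by linarith
  have hword := Word.of_pow_le hn hk hw
  -- Iterate a choice of the next state, store and time; each step depends only on the invariant.
  obtain ⟨t₀, s₀, h₀, hrun₀, hT₀, ht₀⟩ := Tracks.start hword
  have hstep : ∀ (i : ℕ) (p : State × Store × ℕ), ∃ q : State × Store × ℕ,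
      ∀ hi : i < σ.length, Tracks w k (σ.take i) p.2.1 p.1 →
        RunsTo Prog.machine w (p.1.feed σ[i]) q.2.2 q.1 ∧
          Tracks w k (σ.take (i + 1)) q.2.1 q.1 ∧ p.2.1.clk + q.2.2 ≤ q.2.1.clk := by
    intro i p
    by_cases h : i < σ.length ∧ Tracks w k (σ.take i) p.2.1 p.1
    · obtain ⟨hi, hT⟩ := h
      have hb := hσ.2 (i + 1) hi
      rw [List.take_succ_eq_append_getElem hi, graphAfter_append] at hb
      obtain ⟨t, s', h', r1, r2, r3⟩ := hT.update hword (hσ.1 i hi) hb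
      refine ⟨(s', h', t), fun _ _ => ⟨r1, ?_, r3⟩⟩
      rw [List.take_succ_eq_append_getElem hi]
      exact r2
    · exact ⟨p, fun hi hT => absurd ⟨hi, hT⟩ h⟩
  choose next hnext using hstep
  let seq : ℕ → State × Store × ℕ := fun i => Nat.rec (s₀, h₀, t₀) (fun i p => next i p) i
  have htracks : ∀ i ≤ σ.length, Tracks w k (σ.take i) (seq i).2.1 (seq i).1 := by
    intro i
    induction i with
    | zero => intro _; exact hT₀
    | succ i ih => intro hi; exact (hnext i (seq i) hi (ih (by omega))).2.1
  have hsum : ∀ i ≤ σ.length, ∑ j ∈ Finset.range (i + 1), (seq j).2.2 ≤ (seq i).2.1.clk := by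
    intro i
    induction i with
    | zero => intro _; rw [Finset.sum_range_one]; exact ht₀
    | succ i ih =>
      intro hi
      rw [Finset.sum_range_succ]
      have h1 := ih (by omega)
      have h2 := (hnext i (seq i) hi (htracks i (by omega))).2.2
      have h3 : seq (i + 1) = next i (seq i) := rfl
      rw [h3]
      omega
  refine ⟨_, ⟨fun i => (seq i).1, fun i => (seq i).2.2, hrun₀,
    fun i hi => (hnext i (seq i) hi (htracks i (by omega))).1,
    fun i hi => (htracks i hi).holdsMatching (by omega) hkε, rfl⟩, ?_⟩
  have hfin := htracks σ.length le_rfl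
  rw [List.take_length] at hfin
  have hle := (hsum σ.length le_rfl).trans (hfin.clk_le hn (by omega))
  have hk3 : (k : ℝ) ^ 3 ≤ 8 / ε ^ 3 := by
    rw [le_div_iff₀ (by positivity), ← mul_pow, mul_comm]
    calc (ε * k) ^ 3 ≤ 2 ^ 3 := by gcongr
      _ = 8 := by norm_num
  have e8 : 1 / ε ^ 3 ≤ 1 / ε ^ 8 :=
    one_div_le_one_div_of_le (by positivity) (pow_le_pow_of_le_one hε.le hε1.le (by norm_num))
  have e5 : 1 / ε ^ 3 ≤ 1 / ε ^ 5 :=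
    one_div_le_one_div_of_le (by positivity) (pow_le_pow_of_le_one hε.le hε1.le (by norm_num))
  calc ((∑ j ∈ Finset.range (σ.length + 1), (seq j).2.2 : ℕ) : ℝ)
      ≤ 2000000 * ((k : ℝ) ^ 3 * (n + numInsertions σ)) := by exact_mod_cast hle
    _ ≤ 2000000 * (8 / ε ^ 3 * (n + numInsertions σ)) := by gcongr
    _ = 16000000 * (n * (1 / ε ^ 3) + numInsertions σ * (1 / ε ^ 3)) := by ring
    _ ≤ 16000000 * (n * (1 / ε ^ 8) + numInsertions σ * (1 / ε ^ 5)) := by gcongr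
    _ = 16000000 * (n / ε ^ 8 + numInsertions σ / ε ^ 5) := by ring
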